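/- **Theorem ($k$-mismatch in multiple streams).** The $k$-mismatch problem over $s$ streams can be solved deterministically, on a unit cost RAM, in $O(k)$ worst-case time per arriving symbol and $O(m+ks)$ words of space (with $k$ read as $k+1$ in these bounds, so that $k=0$ is included). Precisely: let $P$ be a pattern of length $m\ge 1$ over the alphabet $\{0,\dots,q-1\}$, and let $k,s\ge 0$. There are $s$ texts, initially empty. At each time step one symbol of the alphabet (which need not occur in $P$) arrives and is appended to the end of one of the $s$ texts. If the text $T$ that has just been updated has length at least $m$ and the Hamming distance $d$ between $P$ and the last $m$ symbols of $T$ is at most $k$, then $d$ has to be reported; otherwise it has to be reported that there is no such alignment (the output is then $k+1$). There are a single deterministic RAM algorithm, independent of all the parameters, and constants $C,e$ such that for all $m\ge 1$, $k$, $s$, $q$ and $P$, the algorithm, given $m,k,s,q$ and $P$, first runs a preprocessing phase that terminates without any knowledge of the texts; after it, for every finite sequence of arrivals, the correct report is output after each arrival, and each single arrival is processed in at most $C(k+1)$ steps. The total space, that is, all registers and memory cells, including those that hold the pattern and those used by the preprocessing, is at most $C\,(m+(k+1)s)$ words, each of which holds a nonnegative integer less than $(m+k+s+q+2)^{e}$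 (words of $O(\log(m+k+s+q))$ bits, independent of the lengths of the texts). Each basic operation (loading a constant, $+$, truncated $-$, $\times$, integer quotient and remainder, comparison, reading or writing a memory cell at a computed address, testing a branch or loop condition) costs one step. -/

import Mathlib

namespace MultiStream

/-! ### The problem -/

/-- The text of stream `r` after the arrivals `l` (in order of arrival). An arrival `(r, c)` appends
the symbol `c` to the tail of stream `r`. -/
def streamText {s : ℕ} {α : Type} (l : List (Fin s × α)) (r : Fin s) : List α :=
  (l.filter fun a => a.1 = r).map Prod.snd

/-- The `k`-mismatch report for the pattern `P` at the right end of the text `T`: the Hamming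
distance `d` between `P` and the last `m` symbols of `T`, if `T` has at least `m` symbols and
`d ≤ k`; otherwise `none`. -/
def kMismatch {m : ℕ} {α : Type} [DecidableEq α] (k : ℕ) (P : Fin m → α) (T : List α) :
    Option ℕ :=
  if h : m ≤ T.length then
    let d := hammingDist (fun j : Fin m => T[T.length - m + j.1]'(by omega)) P
    if d ≤ k then some d else none
  else none

/-! ### Unit cost RAM -/

/-- Binary word operations. Subtraction is truncated at `0`, `div` and `mod` are quotient and
remainder, and `lt`, `eq` return `1` for true and `0` for false. -/
inductive Op where
  | add | sub | mul | div | mod | lt | eq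

def Op.eval : Op → ℕ → ℕ → ℕ
  | .add, a, b => a + b
  | .sub, a, b => a - b
  | .mul, a, b => a * b
  | .div, a, b => a / b
  | .mod, a, b => a % b
  | .lt, a, b => if a < b then 1 else 0
  | .eq, a, b => if a = b then 1 else 0

/-- Programs of a random access machine with registers `0, 1, 2, …` (a program names only
finitely many of them) and an array of memory cells. -/
inductive Com where
  /-- do nothing -/
  | skip
  /-- `reg x := c` -/
  | const (x c : ℕ)
  /-- `reg x := o (reg y) (reg z)` -/
  | op (o : Op) (x y z : ℕ)
  /-- `reg x := mem (reg y)` -/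
  | load (x y : ℕ)
  /-- `mem (reg x) := reg y` -/
  | store (x y : ℕ)
  /-- `p; q` -/
  | seq (p q : Com)
  /-- if `reg x ≠ 0` then `p` else `q` -/
  | ite (x : ℕ) (p q : Com)
  /-- while `reg x ≠ 0` do `p` -/
  | loop (x : ℕ) (p : Com)

/-- All registers that a program names have an index less than this number. -/
def Com.numRegs : Com → ℕ
  | .skip => 0
  | .const x _ => x + 1
  | .op _ x y z => max (x + 1) (max (y + 1) (z + 1))
  | .load x y => max (x + 1) (y + 1)
  | .store x y => max (x + 1) (y + 1)
  | .seq p q => max p.numRegs q.numRegs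
  | .ite x p q => max (x + 1) (max p.numRegs q.numRegs)
  | .loop x p => max (x + 1) p.numRegs

/-- Contents of the registers and of the memory cells. -/
structure Config where
  reg : ℕ → ℕ
  mem : ℕ → ℕ

def Config.setReg (σ : Config) (x v : ℕ) : Config :=
  { σ with reg := Function.update σ.reg x v }

def Config.setMem (σ : Config) (a v : ℕ) : Config :=
  { σ with mem := Function.update σ.mem a v }

/-- `Exec W N p σ t σ'`: started in `σ`, program `p` halts in `σ'` after `t` unit cost steps, on a
machine whose words hold the numbers less than `W` and whose memory consists of the `N` cells
`0, …, N - 1`. Every instruction and every test of a condition costs one step. There is no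
rule for an instruction whose result does not fit into a word or whose address is not less than `N`,
so an execution exists only if neither ever happens. -/
inductive Exec (W N : ℕ) : Com → Config → ℕ → Config → Prop where
  | skip (σ : Config) : Exec W N .skip σ 1 σ
  | const (σ : Config) (x c : ℕ) (h : c < W) : Exec W N (.const x c) σ 1 (σ.setReg x c)
  | op (σ : Config) (o : Op) (x y z : ℕ) (h : o.eval (σ.reg y) (σ.reg z) < W) :
      Exec W N (.op o x y z) σ 1 (σ.setReg x (o.eval (σ.reg y) (σ.reg z)))
  | load (σ : Config) (x y : ℕ) (h : σ.reg y < N) :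
      Exec W N (.load x y) σ 1 (σ.setReg x (σ.mem (σ.reg y)))
  | store (σ : Config) (x y : ℕ) (h : σ.reg x < N) :
      Exec W N (.store x y) σ 1 (σ.setMem (σ.reg x) (σ.reg y))
  | seq {p q : Com} {σ σ' σ'' : Config} {t t' : ℕ}
      (h : Exec W N p σ t σ') (h' : Exec W N q σ' t' σ'') : Exec W N (.seq p q) σ (t + t') σ''
  | iteTrue {x : ℕ} {p q : Com} {σ σ' : Config} {t : ℕ}
      (hx : σ.reg x ≠ 0) (h : Exec W N p σ t σ') : Exec W N (.ite x p q) σ (t + 1) σ'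
  | iteFalse {x : ℕ} {p q : Com} {σ σ' : Config} {t : ℕ}
      (hx : σ.reg x = 0) (h : Exec W N q σ t σ') : Exec W N (.ite x p q) σ (t + 1) σ'
  | loopTrue {x : ℕ} {p : Com} {σ σ' σ'' : Config} {t t' : ℕ}
      (hx : σ.reg x ≠ 0) (h : Exec W N p σ t σ') (h' : Exec W N (.loop x p) σ' t' σ'') :
      Exec W N (.loop x p) σ (t + t' + 1) σ''
  | loopFalse {x : ℕ} {p : Com} {σ : Config} (hx : σ.reg x = 0) :
      Exec W N (.loop x p) σ 1 σ

/-- The machine is deterministic: an execution is determined by the program and its start. -/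
theorem Exec.deterministic {W N : ℕ} {p : Com} {σ σ₁ σ₂ : Config} {t₁ t₂ : ℕ}
    (h₁ : Exec W N p σ t₁ σ₁) (h₂ : Exec W N p σ t₂ σ₂) : t₁ = t₂ ∧ σ₁ = σ₂ := by
  induction h₁ generalizing t₂ σ₂ with
  | skip => cases h₂; exact ⟨rfl, rfl⟩
  | const => cases h₂; exact ⟨rfl, rfl⟩
  | op => cases h₂; exact ⟨rfl, rfl⟩
  | load => cases h₂; exact ⟨rfl, rfl⟩
  | store => cases h₂; exact ⟨rfl, rfl⟩
  | seq _ _ ih ih' =>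
    cases h₂ with
    | seq g g' =>
      obtain ⟨rfl, rfl⟩ := ih g
      obtain ⟨rfl, rfl⟩ := ih' g'
      exact ⟨rfl, rfl⟩
  | iteTrue hx _ ih =>
    cases h₂ with
    | iteTrue _ g => obtain ⟨rfl, rfl⟩ := ih g; exact ⟨rfl, rfl⟩
    | iteFalse hx' _ => exact absurd hx' hx
  | iteFalse hx _ ih =>
    cases h₂ with
    | iteTrue hx' _ => exact absurd hx hx'
    | iteFalse _ g => obtain ⟨rfl, rfl⟩ := ih g; exact ⟨rfl, rfl⟩
  | loopTrue hx _ _ ih ih' =>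
    cases h₂ with
    | loopTrue _ g g' =>
      obtain ⟨rfl, rfl⟩ := ih g
      obtain ⟨rfl, rfl⟩ := ih' g'
      exact ⟨rfl, rfl⟩
    | loopFalse hx' => exact absurd hx' hx
  | loopFalse hx =>
    cases h₂ with
    | loopTrue hx' _ _ => exact absurd hx hx'
    | loopFalse _ => exact ⟨rfl, rfl⟩

/-! ### Algorithms in the multiple stream model -/

/-- A multiple stream algorithm: `pre` is run once, before any text symbol has arrived, and `step`
is run after each arrival. The machine starts with the pattern length, the bound `k`, the number of
streams and the alphabet size in registers `0, 1, 2, 3` and the pattern in the first cells of its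
memory; an arrival puts the number of its stream into register `4` and its symbol into register `5`;
the report is read off register `6`. -/
structure Algorithm where
  pre : Com
  step : Com

/-- The number of registers of the machine that runs the algorithm (including registers `0` to `6`
for input and output). -/
def Algorithm.numRegs (A : Algorithm) : ℕ :=
  max 7 (max A.pre.numRegs A.step.numRegs)

def initConfig {m q : ℕ} (k s : ℕ) (P : Fin m → Fin q) : Config where
  reg x := if x = 0 then m else if x = 1 then k else if x = 2 then s else if x = 3 then q else 0
  mem i := if h : i < m then (P ⟨i, h⟩ : ℕ) else 0

def Config.arrive {s q : ℕ} (σ : Config) (a : Fin s × Fin q) : Config :=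
  (σ.setReg 4 a.1).setReg 5 a.2

/-- With words holding the numbers less than `W`, and with `N` memory cells, algorithm `A` solves the
`k`-mismatch problem for the pattern `P` in `s` streams in at most `τ` steps for each arrival, in the
worst case. Here `run l` is the configuration after the arrivals `l`, and a report `none` is output
as the number `k + 1`. -/
def Algorithm.SolvesKMismatch (A : Algorithm) (W N τ : ℕ) {m q : ℕ} (k s : ℕ)
    (P : Fin m → Fin q) : Prop :=
  ∃ run : List (Fin s × Fin q) → Config,
    (∃ t, Exec W N A.pre (initConfig k s P) t (run [])) ∧
    ∀ (l : List (Fin s × Fin q)) (a : Fin s × Fin q),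
      (∃ t, t ≤ τ ∧ Exec W N A.step ((run l).arrive a) t (run (l ++ [a]))) ∧
      (run (l ++ [a])).reg 6 = (kMismatch k P (streamText (l ++ [a]) a.1)).getD (k + 1)

end MultiStream

/-!
The algorithm keeps each text as a sequence of pieces. A closed piece is a factor of the pattern
followed by a symbol with which it is no longer a factor, and the end of the text is an open piece,
which is a factor, given by its length and its first occurrence in the pattern.

* An arriving symbol either extends the open piece or closes it. The first occurrence of the extended
  factor is either that of the factor or a *branch*: a position `i` of the pattern at which the longest
  match that starts earlier is extended by one symbol. A branch is determined by the first occurrence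
  and the length of the earlier match and by the symbol (`IsFirst.exists_branch`,
  `IsBranch.eq_of_eq`), so a perfect hash table of linear size, with at most one key for each
  position of the pattern, decides the case in constant time (`hashData_spec`).
* A closed piece that lies within the last `m` symbols of the text contributes a mismatch, whatever
  factor of the pattern it is aligned with. So if there are at most `k` mismatches, then the open
  piece and the newest `k + 1` closed pieces cover the last `m` symbols, and `k + 1` pieces are all
  that has to be stored for a stream. The pattern is compared with the pieces from right to left,
  jumping from mismatch to mismatch by longest common extensions within the pattern. Each step finds a
  mismatch, finishes a piece or enters a new one; after `3 * k + 4` steps either the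
  comparison has ended or there are more than `k` mismatches (`Comparing.report`,
  `Progress.step`, `run_arrival`).
* The longest common extension of two positions is a minimum of the common extensions of neighbours in
  the suffix array. It is found in constant time and linear space: within intervals of length
  `b = log m + 1` by bit masks that mark the places where the running minimum decreases
  (`rankLce_eq_mask`), and between blocks of length `b` by a table for the intervals of `2 ^ j` blocks
  (`rankLce_blocks`, `rankLce_long`).

The time for the preprocessing is not bounded, so all tables are computed by brute force from their
definitions. The programs are written in a small language, whose expressions (`Ex`) have bounded sums
and total array access, and whose statements (`St`) have a total functional semantics; it is
compiled to the random access machine with exact running times (`Ex.exec`, `St.exec`). There are 32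
arrays of length `8 * (m + (k + 1) * s)`, and all stored numbers are kept below a fixed power of
`m + k + s + q + 2` by reduction; intermediate results have polynomial size since their degrees are
bounded by the syntax of the expression (`Ex.deg`). The running time for an arrival is bounded
syntactically, too, because the statements around and within the one loop are free of loops and sums
(`St.cost_seq_loop`).
-/

namespace MultiStream

/-! ### A total language of expressions and its compilation -/

/-- Expressions over named variables and 32 arrays. `arr a i` reads cell `i` of array `a`,
`letE x e b` binds `x` to the value of `e` in `b`, and `sum x n b` is the sum of `b` over
`x = 0, …, n - 1`. -/
inductive Ex where
  | var (x : ℕ)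
  | cst (c : ℕ)
  | op (o : Op) (a b : Ex)
  | arr (a : Fin 32) (i : Ex)
  | ite (c a b : Ex)
  | letE (x : ℕ) (e b : Ex)
  | sum (x : ℕ) (n b : Ex)

namespace Ex

/-- The value of an expression in the array contents `A` and the variable environment `ε`. -/
def eval (A : Fin 32 → ℕ → ℕ) : Ex → (ℕ → ℕ) → ℕ
  | var x, ε => ε x
  | cst c, _ => c
  | op o a b, ε => o.eval (a.eval A ε) (b.eval A ε)
  | arr a i, ε => A a (i.eval A ε)
  | ite c a b, ε => if c.eval A ε ≠ 0 then a.eval A ε else b.eval A ε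
  | letE x e b, ε => b.eval A (Function.update ε x (e.eval A ε))
  | sum x n b, ε => ∑ i ∈ Finset.range (n.eval A ε), b.eval A (Function.update ε x i)

/-- The running time of the compiled expression. -/
def cost (A : Fin 32 → ℕ → ℕ) : Ex → (ℕ → ℕ) → ℕ
  | var _, _ => 2
  | cst _, _ => 1
  | op _ a b, ε => a.cost A ε + b.cost A ε + 1
  | arr _ i, ε => i.cost A ε + 6
  | ite c a b, ε => c.cost A ε + 1 + if c.eval A ε ≠ 0 then a.cost A ε else b.cost A ε
  | letE x e b, ε => e.cost A ε + b.cost A (Function.update ε x (e.eval A ε)) + 2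
  | sum x n b, ε => n.cost A ε + 6 +
      ∑ i ∈ Finset.range (n.eval A ε), (b.cost A (Function.update ε x i) + 5)

/-- If the value of each variable `x` is less than `M ^ δ x` and the array cells hold numbers less
than `M`, then all the intermediate results are less than `M ^ e.deg δ`. -/
def deg : Ex → (ℕ → ℕ) → ℕ
  | var x, δ => δ x
  | cst c, _ => c + 1
  | op _ a b, δ => a.deg δ + b.deg δ + 1
  | arr _ i, δ => i.deg δ + 1
  | ite c a b, δ => c.deg δ + a.deg δ + b.deg δ
  | letE x e b, δ => e.deg δ + b.deg (Function.update δ x (e.deg δ))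
  | sum x n b, δ => n.deg δ + b.deg (Function.update δ x (n.deg δ)) + 1

/-- `r_x := r_y`, with the help of the register `z`. -/
def _root_.MultiStream.Com.move (x y z : ℕ) : Com := .seq (.const z 0) (.op .add x y z)

/-- Compilation. The variable `y` is kept in register `ρ y`, the result is left in register `d`, and
only registers from `d` on are changed. Register `7` holds the length of the arrays; reading an
array beyond its length gives `0`. -/
def comp : Ex → (ℕ → ℕ) → ℕ → Com
  | var x, ρ, d => .move d (ρ x) (d + 1)
  | cst c, _, d => .const d c
  | op o a b, ρ, d => .seq (a.comp ρ d) (.seq (b.comp ρ (d + 1)) (.op o d d (d + 1)))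
  | arr a i, ρ, d => .seq (i.comp ρ d) (.seq (.op .lt (d + 1) d 7)
      (.ite (d + 1)
        (.seq (.const (d + 1) a) (.seq (.op .mul (d + 1) (d + 1) 7)
          (.seq (.op .add d (d + 1) d) (.load d d))))
        (.seq (.const d 0) (.seq .skip (.seq .skip .skip)))))
  | ite c a b, ρ, d => .seq (c.comp ρ d) (.ite d (a.comp ρ d) (b.comp ρ d))
  | letE x e b, ρ, d => .seq (e.comp ρ d)
      (.seq (b.comp (Function.update ρ x d) (d + 1)) (.move d (d + 1) (d + 2)))
  | sum x n b, ρ, d => .seq (n.comp ρ d) (.seq (.const (d + 1) 0) (.seq (.const (d + 2) 0)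
      (.seq (.op .lt (d + 3) (d + 2) d) (.seq
        (.loop (d + 3) (.seq (b.comp (Function.update ρ x (d + 2)) (d + 4))
          (.seq (.op .add (d + 1) (d + 1) (d + 4)) (.seq (.const (d + 4) 1)
            (.seq (.op .add (d + 2) (d + 2) (d + 4)) (.op .lt (d + 3) (d + 2) d))))))
        (.move d (d + 1) (d + 3))))))

end Ex

theorem Exec.cast {W N : ℕ} {p : Com} {σ σ' : Config} {t t' : ℕ} (h : Exec W N p σ t σ')
    (e : t = t') : Exec W N p σ t' σ' := e ▸ h

@[simp] theorem Config.setReg_reg (σ : Config) (x v : ℕ) :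
    (σ.setReg x v).reg = Function.update σ.reg x v := rfl
@[simp] theorem Config.setReg_mem (σ : Config) (x v : ℕ) : (σ.setReg x v).mem = σ.mem := rfl
@[simp] theorem Config.setMem_reg (σ : Config) (x v : ℕ) : (σ.setMem x v).reg = σ.reg := rfl
@[simp] theorem Config.setMem_mem (σ : Config) (x v : ℕ) :
    (σ.setMem x v).mem = Function.update σ.mem x v := rfl

theorem Exec.move {W N : ℕ} (σ : Config) {x y z : ℕ} (hyz : y ≠ z) (h : σ.reg y < W) :
    Exec W N (.move x y z) σ 2 ((σ.setReg z 0).setReg x (σ.reg y)) := by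
  have h2 := Exec.op (W := W) (N := N) (σ.setReg z 0) .add x y z
    (by simp [Op.eval, Function.update_of_ne hyz, h])
  have := Exec.seq (Exec.const (W := W) (N := N) σ z 0 (by omega)) h2
  simpa [Op.eval, Function.update_of_ne hyz, Com.move] using this

theorem Op.eval_lt {M da db a b : ℕ} (hM : 2 ≤ M) (o : Op) (ha : a < M ^ da) (hb : b < M ^ db) :
    o.eval a b < M ^ (da + db + 1) := by
  have h1 : M ^ da ≤ M ^ (da + db + 1) := Nat.pow_le_pow_right (by omega) (by omega)
  have h2 : M ^ db ≤ M ^ (da + db + 1) := Nat.pow_le_pow_right (by omega) (by omega)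
  have h3 : 1 ≤ M ^ da := Nat.one_le_pow _ _ (by omega)
  have h4 : 1 ≤ M ^ db := Nat.one_le_pow _ _ (by omega)
  have h5 : 2 ≤ M ^ (da + db + 1) := by
    calc 2 ≤ M ^ 1 := by simpa
    _ ≤ _ := Nat.pow_le_pow_right (by omega) (by omega)
  cases o <;> simp only [Op.eval]
  · have : M ^ da + M ^ db ≤ M ^ (da + db + 1) := by
      rw [pow_succ, pow_add]; nlinarith [Nat.mul_le_mul h3 h4]
    omega
  · omega
  · calc a * b < M ^ da * M ^ db := Nat.mul_lt_mul'' ha hb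
      _ = M ^ (da + db) := (pow_add _ _ _).symm
      _ ≤ _ := Nat.pow_le_pow_right (by omega) (by omega)
  · exact (Nat.div_le_self _ _).trans_lt (by omega)
  · exact (Nat.mod_le _ _).trans_lt (by omega)
  · split <;> omega
  · split <;> omega

theorem Ex.eval_lt {M : ℕ} (hM : 2 ≤ M) {A : Fin 32 → ℕ → ℕ} (hA : ∀ a i, A a i < M) (e : Ex) :
    ∀ {ε δ : ℕ → ℕ}, (∀ y, ε y < M ^ δ y) → e.eval A ε < M ^ e.deg δ := by
  have up : ∀ {a b v : ℕ}, v < M ^ a → a ≤ b → v < M ^ b := fun h hab =>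
    h.trans_le (Nat.pow_le_pow_right (by omega) hab)
  have upd : ∀ {ε δ : ℕ → ℕ}, (∀ y, ε y < M ^ δ y) → ∀ {x v g : ℕ}, v < M ^ g →
      ∀ y, Function.update ε x v y < M ^ Function.update δ x g y := by
    intro ε δ h x v g hv y
    by_cases hy : y = x
    · subst hy; simpa
    · simpa [hy] using h y
  induction e with
  | var x => intro ε δ h; exact h x
  | cst c =>
    intro ε δ h
    calc c < 2 ^ c := Nat.lt_two_pow_self
      _ ≤ M ^ c := Nat.pow_le_pow_left hM c
      _ ≤ _ := Nat.pow_le_pow_right (by omega) (by simp [deg])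
  | op o a b iha ihb => intro ε δ h; exact Op.eval_lt hM o (iha h) (ihb h)
  | arr a i ih =>
    intro ε δ h
    refine up (a := 1) ?_ (by simp [deg])
    simpa [eval] using hA _ _
  | ite c a b ihc iha ihb =>
    intro ε δ h
    simp only [eval, deg]
    split
    · exact up (iha h) (by omega)
    · exact up (ihb h) (by omega)
  | letE x e b ihe ihb =>
    intro ε δ h
    exact up (ihb (upd h (ihe h))) (by simp [deg])
  | sum x n b ihn ihb =>
    intro ε δ h
    have h1 := ihn h
    have h2 : eval A (sum x n b) ε ≤ n.eval A ε * M ^ b.deg (Function.update δ x (n.deg δ)) := by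
      simp only [eval]
      refine (Finset.sum_le_card_nsmul _ _ (M ^ b.deg (Function.update δ x (n.deg δ)))
        fun i hi => ?_).trans (by simp)
      exact (ihb (upd h ((Finset.mem_range.1 hi).trans h1))).le
    refine h2.trans_lt ?_
    simp only [deg]
    have h3 : 1 ≤ M ^ b.deg (Function.update δ x (n.deg δ)) := Nat.one_le_pow _ _ (by omega)
    calc _ < M ^ n.deg δ * M ^ b.deg (Function.update δ x (n.deg δ)) := by gcongr
      _ = M ^ (n.deg δ + b.deg (Function.update δ x (n.deg δ))) := (pow_add _ _ _).symm
      _ ≤ _ := Nat.pow_le_pow_right (by omega) (by omega)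

/-- The machine parameters `W`, `N` leave room for 32 arrays of length `L` with entries less
than `M`, and for intermediate results less than `M ^ D`. -/
structure Room (W N L M D : ℕ) : Prop where
  two_le : 2 ≤ M
  pos : 0 < L
  cells : 32 * L ≤ N
  addr : N ≤ W
  word : M ^ D ≤ W

theorem Room.two_lt {W N L M D : ℕ} (h : Room W N L M D) : 2 < W := by
  have := h.pos; have := h.cells; have := h.addr; omega

/-- The memory `μ` holds the arrays `A`, one after the other. -/
def Holds (L : ℕ) (μ : ℕ → ℕ) (A : Fin 32 → ℕ → ℕ) : Prop :=
  ∀ (a : Fin 32) i, i < L → μ (a * L + i) = A a i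

theorem Room.addr_lt {W N L M D : ℕ} (h : Room W N L M D) (a : Fin 32) {i : ℕ} (hi : i < L) :
    a * L + i < N := by
  have h1 := h.cells
  have h2 : (a : ℕ) * L ≤ 31 * L := Nat.mul_le_mul_right _ (by omega)
  omega

/-- The compiled expression computes its value, in the time stated by `cost`, and changes only
registers from `d` on. -/
theorem Ex.exec {W N L M D : ℕ} (hR : Room W N L M D) {A : Fin 32 → ℕ → ℕ}
    (hA : ∀ a i, A a i < M) (hA0 : ∀ a i, L ≤ i → A a i = 0) (e : Ex) :
    ∀ {ε δ ρ : ℕ → ℕ} {d : ℕ} {σ : Config}, (∀ y, ρ y < d) → 8 ≤ d → (∀ y, σ.reg (ρ y) = ε y) →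
      (∀ y, ε y < M ^ δ y) → e.deg δ ≤ D → σ.reg 7 = L → Holds L σ.mem A →
      ∃ σ', Exec W N (e.comp ρ d) σ (e.cost A ε) σ' ∧ σ'.mem = σ.mem ∧
        (∀ x < d, σ'.reg x = σ.reg x) ∧ σ'.reg d = e.eval A ε := by
  have hM := hR.two_le
  have fit : ∀ {a v : ℕ}, v < M ^ a → a ≤ D → v < W := fun h hab =>
    h.trans_le ((Nat.pow_le_pow_right (by omega) hab).trans hR.word)
  have upd : ∀ {ε δ : ℕ → ℕ}, (∀ y, ε y < M ^ δ y) → ∀ {x v g : ℕ}, v < M ^ g →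
      ∀ y, Function.update ε x v y < M ^ Function.update δ x g y := by
    intro ε δ h x v g hv y
    by_cases hy : y = x
    · subst hy; simpa
    · simpa [hy] using h y
  have h2W := hR.two_lt
  induction e with
  | var x =>
    intro ε δ ρ d σ hρ hd hε hδ hD h7 hm
    have hx := hρ x
    refine ⟨_, Exec.move σ (by omega) ?_, rfl, ?_, ?_⟩
    · rw [hε]; exact fit (hδ x) hD
    · intro y hy
      simp [Function.update_of_ne (show y ≠ d by omega),
        Function.update_of_ne (show y ≠ d + 1 by omega)]
    · simp [eval, hε]
  | cst c =>
    intro ε δ ρ d σ hρ hd hε hδ hD h7 hm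
    refine ⟨_, Exec.const σ d c ?_, rfl, ?_, ?_⟩
    · have := Ex.eval_lt hM hA (cst c) hδ
      exact fit this hD
    · intro y hy
      simp [Function.update_of_ne (show y ≠ d by omega)]
    · simp [eval]
  | op o a b iha ihb =>
    intro ε δ ρ d σ hρ hd hε hδ hD h7 hm
    simp only [deg] at hD
    obtain ⟨σ₁, x₁, m₁, r₁, v₁⟩ := iha hρ hd hε hδ (by omega) h7 hm
    obtain ⟨σ₂, x₂, m₂, r₂, v₂⟩ := ihb (ρ := ρ) (d := d + 1) (σ := σ₁) (ε := ε) (δ := δ)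
      (fun y => (hρ y).trans (by omega)) (by omega) (fun y => by rw [r₁ _ (hρ y), hε]) hδ
      (by omega) (by rw [r₁ _ (by omega), h7]) (by rwa [m₁])
    have e1 : σ₂.reg d = a.eval A ε := by rw [r₂ _ (by omega), v₁]
    have hlt := Op.eval_lt hM o (Ex.eval_lt hM hA a hδ) (Ex.eval_lt hM hA b hδ)
    refine ⟨_, (Exec.seq x₁ (Exec.seq x₂ (Exec.op σ₂ o d d (d + 1) ?_))).cast ?_, ?_, ?_, ?_⟩
    · rw [e1, v₂]; exact fit hlt (by omega)
    · simp [cost]; ring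
    · simp [m₁, m₂]
    · intro y hy
      simp [Function.update_of_ne (show y ≠ d by omega)]
      rw [r₂ _ (by omega), r₁ _ hy]
    · simp [eval, e1, v₂]
  | arr a i ih =>
    intro ε δ ρ d σ hρ hd hε hδ hD h7 hm
    simp only [deg] at hD
    obtain ⟨σ₁, x₁, m₁, r₁, v₁⟩ := ih hρ hd hε hδ (by omega) h7 hm
    have h71 : σ₁.reg 7 = L := by rw [r₁ _ (by omega), h7]
    set n := i.eval A ε
    have ha := a.2
    have hNW := hR.addr
    have x₂ := Exec.op (W := W) (N := N) σ₁ .lt (d + 1) d 7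
      (by simp only [Op.eval]; split <;> omega)
    have ev : Op.lt.eval (σ₁.reg d) (σ₁.reg 7) = if n < L then 1 else 0 := by
      rw [v₁, h71]; rfl
    rw [ev] at x₂
    by_cases hn : n < L
    · rw [if_pos hn] at x₂
      have had := hR.addr_lt a hn
      have h1 : (a : ℕ) ≤ a * L := Nat.le_mul_of_pos_right _ hR.pos
      have c1 := Exec.const (W := W) (N := N) (σ₁.setReg (d + 1) 1) (d + 1) a (by omega)
      have c2 := Exec.op (W := W) (N := N) ((σ₁.setReg (d + 1) 1).setReg (d + 1) a) .mul
        (d + 1) (d + 1) 7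
        (by simp [Op.eval, Function.update_of_ne (show 7 ≠ d + 1 by omega), h71]; omega)
      have e2 : Op.mul.eval (((σ₁.setReg (d + 1) 1).setReg (d + 1) a).reg (d + 1))
          (((σ₁.setReg (d + 1) 1).setReg (d + 1) a).reg 7) = a * L := by
        simp [Op.eval, Function.update_of_ne (show 7 ≠ d + 1 by omega), h71]
      rw [e2] at c2
      set σ₃ := ((σ₁.setReg (d + 1) 1).setReg (d + 1) a).setReg (d + 1) (a * L)
      have e3 : Op.add.eval (σ₃.reg (d + 1)) (σ₃.reg d) = a * L + n := by
        simp [Op.eval, σ₃, v₁]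
      have c3 := Exec.op (W := W) (N := N) σ₃ .add d (d + 1) d (by rw [e3]; omega)
      rw [e3] at c3
      have c4 := Exec.load (W := W) (N := N) (σ₃.setReg d (a * L + n)) d d (by simpa using had)
      refine ⟨_, (Exec.seq x₁ (Exec.seq x₂ (Exec.iteTrue (by simp)
        (Exec.seq c1 (Exec.seq c2 (Exec.seq c3 c4)))))).cast ?_, ?_, ?_, ?_⟩
      · simp [cost]
      · simp [σ₃, m₁]
      · intro y hy
        simp [σ₃, Function.update_of_ne (show y ≠ d by omega),
          Function.update_of_ne (show y ≠ d + 1 by omega), r₁ _ hy]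
      · simp [σ₃, m₁, eval, hm a n hn, n]
    · rw [if_neg hn] at x₂
      refine ⟨_, (Exec.seq x₁ (Exec.seq x₂ (Exec.iteFalse (by simp)
        (Exec.seq (.const _ _ _ (by omega)) (Exec.seq (.skip _)
          (Exec.seq (.skip _) (.skip _))))))).cast ?_, ?_, ?_, ?_⟩
      · simp [cost]
      · simp [m₁]
      · intro y hy
        simp [Function.update_of_ne (show y ≠ d by omega),
          Function.update_of_ne (show y ≠ d + 1 by omega), r₁ _ hy]
      · simp [eval, hA0 a n (by omega), n]
  | ite c a b ihc iha ihb =>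
    intro ε δ ρ d σ hρ hd hε hδ hD h7 hm
    simp only [deg] at hD
    obtain ⟨σ₁, x₁, m₁, r₁, v₁⟩ := ihc hρ hd hε hδ (by omega) h7 hm
    have hε₁ : ∀ y, σ₁.reg (ρ y) = ε y := fun y => by rw [r₁ _ (hρ y), hε]
    have h71 : σ₁.reg 7 = L := by rw [r₁ _ (by omega), h7]
    have hm₁ : Holds L σ₁.mem A := by rwa [m₁]
    by_cases h0 : c.eval A ε ≠ 0
    · obtain ⟨σ₂, x₂, m₂, r₂, v₂⟩ := iha hρ hd hε₁ hδ (by omega) h71 hm₁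
      refine ⟨σ₂, (Exec.seq x₁ (Exec.iteTrue (by rwa [v₁]) x₂)).cast ?_, by rw [m₂, m₁], ?_, ?_⟩
      · simp [cost, h0]; ring
      · intro y hy; rw [r₂ _ hy, r₁ _ hy]
      · simp [eval, h0, v₂]
    · obtain ⟨σ₂, x₂, m₂, r₂, v₂⟩ := ihb hρ hd hε₁ hδ (by omega) h71 hm₁
      refine ⟨σ₂, (Exec.seq x₁ (Exec.iteFalse (by simpa [v₁] using h0) x₂)).cast ?_,
        by rw [m₂, m₁], ?_, ?_⟩
      · simp [cost, h0]; ring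
      · intro y hy; rw [r₂ _ hy, r₁ _ hy]
      · simp [eval, h0, v₂]
  | letE x e b ihe ihb =>
    intro ε δ ρ d σ hρ hd hε hδ hD h7 hm
    simp only [deg] at hD
    obtain ⟨σ₁, x₁, m₁, r₁, v₁⟩ := ihe hρ hd hε hδ (by omega) h7 hm
    have hδ' := upd hδ (x := x) (Ex.eval_lt hM hA e hδ)
    obtain ⟨σ₂, x₂, m₂, r₂, v₂⟩ := ihb (ρ := Function.update ρ x d) (d := d + 1) (σ := σ₁)
      (ε := Function.update ε x (e.eval A ε)) (δ := Function.update δ x (e.deg δ))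
      (fun y => by
        by_cases hy : y = x
        · subst hy; simp
        · have := hρ y
          simp only [Function.update_of_ne hy]; omega) (by omega)
      (fun y => by
        by_cases hy : y = x
        · subst hy; simpa using v₁
        · simp only [Function.update_of_ne hy]; rw [r₁ _ (hρ y), hε])
      hδ' (by omega) (by rw [r₁ _ (by omega), h7]) (by rwa [m₁])
    have hlt := Ex.eval_lt hM hA b hδ'
    refine ⟨_, (Exec.seq x₁ (Exec.seq x₂ (Exec.move σ₂ (by omega) ?_))).cast ?_, ?_, ?_, ?_⟩
    · rw [v₂]; exact fit hlt (by omega)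
    · simp [cost]; ring
    · simp [m₁, m₂]
    · intro y hy
      simp [Function.update_of_ne (show y ≠ d by omega),
        Function.update_of_ne (show y ≠ d + 2 by omega)]
      rw [r₂ y (by omega), r₁ _ hy]
    · simp [eval, v₂]
  | sum x n b ihn ihb =>
    intro ε δ ρ d σ hρ hd hε hδ hD h7 hm
    simp only [deg] at hD
    obtain ⟨σ₁, x₁, m₁, r₁, v₁⟩ := ihn hρ hd hε hδ (by omega) h7 hm
    set k := n.eval A ε with hk
    have hklt : k < M ^ n.deg δ := Ex.eval_lt hM hA n hδ
    have hkW : k < W := fit hklt (by omega)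
    set f : ℕ → ℕ := fun i => b.eval A (Function.update ε x i) with hf
    have hsum : ∑ i ∈ Finset.range k, f i < W :=
      fit (Ex.eval_lt hM hA (sum x n b) hδ) (by simpa [deg] using hD)
    -- the loop, entered with counter `k - j`
    have key : ∀ j ≤ k, ∀ τ : Config, τ.mem = σ.mem → (∀ y < d, τ.reg y = σ.reg y) →
        τ.reg d = k → τ.reg (d + 1) = ∑ i ∈ Finset.range (k - j), f i → τ.reg (d + 2) = k - j →
        τ.reg (d + 3) = (if k - j < k then 1 else 0) →
        ∃ τ', Exec W N (.loop (d + 3) (.seq (b.comp (Function.update ρ x (d + 2)) (d + 4))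
          (.seq (.op .add (d + 1) (d + 1) (d + 4)) (.seq (.const (d + 4) 1)
            (.seq (.op .add (d + 2) (d + 2) (d + 4)) (.op .lt (d + 3) (d + 2) d)))))) τ
          (1 + ∑ i ∈ Finset.Ico (k - j) k, (b.cost A (Function.update ε x i) + 5)) τ' ∧
          τ'.mem = σ.mem ∧ (∀ y < d, τ'.reg y = σ.reg y) ∧
          τ'.reg (d + 1) = ∑ i ∈ Finset.range k, f i := by
      intro j
      induction j with
      | zero =>
        intro _ τ hmem hreg h0 h1 h2 h3
        refine ⟨τ, (Exec.loopFalse (by simp [h3])).cast (by simp), hmem, hreg, by simpa using h1⟩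
      | succ j ih =>
        intro hj τ hmem hreg h0 h1 h2 h3
        obtain ⟨i, hi⟩ : ∃ i, i = k - (j + 1) := ⟨_, rfl⟩
        have hij : k - j = i + 1 := by omega
        have hik : i < k := by omega
        rw [← hi] at h1 h2 h3 ⊢
        rw [if_pos hik] at h3
        have hδ' := upd hδ (x := x) (hik.trans hklt)
        obtain ⟨τ₁, y₁, n₁, s₁, w₁⟩ := ihb (ρ := Function.update ρ x (d + 2)) (d := d + 4) (σ := τ)
          (ε := Function.update ε x i) (δ := Function.update δ x (n.deg δ))
          (fun y => by
            by_cases hy : y = x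
            · subst hy; simp
            · have := hρ y
              simp only [Function.update_of_ne hy]; omega) (by omega)
          (fun y => by
            by_cases hy : y = x
            · subst hy; simpa using h2
            · simp only [Function.update_of_ne hy]; rw [hreg _ (hρ y), hε])
          hδ' (by omega) (by rw [hreg _ (by omega), h7]) (by rwa [hmem])
        have hps : ∑ l ∈ Finset.range (i + 1), f l ≤ ∑ l ∈ Finset.range k, f l :=
          Finset.sum_le_sum_of_subset (Finset.range_mono (by omega))
        have a1 : τ₁.reg (d + 1) + τ₁.reg (d + 4) = ∑ l ∈ Finset.range (i + 1), f l := by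
          rw [s₁ _ (by omega), h1, w₁, Finset.sum_range_succ]
        have b1 := Exec.op (W := W) (N := N) τ₁ .add (d + 1) (d + 1) (d + 4)
          (by simp only [Op.eval]; omega)
        simp only [Op.eval, a1] at b1
        set τ₂ := τ₁.setReg (d + 1) (∑ l ∈ Finset.range (i + 1), f l) with hτ₂
        have b2 := Exec.const (W := W) (N := N) τ₂ (d + 4) 1 (by omega)
        have a3 : (τ₂.setReg (d + 4) 1).reg (d + 2) + (τ₂.setReg (d + 4) 1).reg (d + 4) = i + 1 := by
          simp [τ₂]; rw [s₁ _ (by omega), h2]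
        have b3 := Exec.op (W := W) (N := N) (τ₂.setReg (d + 4) 1) .add (d + 2) (d + 2) (d + 4)
          (by simp only [Op.eval]; omega)
        simp only [Op.eval, a3] at b3
        set τ₃ := (τ₂.setReg (d + 4) 1).setReg (d + 2) (i + 1) with hτ₃
        have a4 : τ₃.reg d = k := by
          simp [τ₃, τ₂]
          rw [s₁ _ (by omega), h0]
        have b4 := Exec.op (W := W) (N := N) τ₃ .lt (d + 3) (d + 2) d
          (by simp only [Op.eval]; split <;> omega)
        have a5 : Op.lt.eval (τ₃.reg (d + 2)) (τ₃.reg d) = if i + 1 < k then 1 else 0 := by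
          rw [a4]; simp [Op.eval, τ₃]
        rw [a5] at b4
        obtain ⟨τ', z, zm, zr, zv⟩ := ih (by omega) (τ₃.setReg (d + 3) (if i + 1 < k then 1 else 0))
          (by simp [τ₃, τ₂, n₁, hmem])
          (fun y hy => by
            simp [τ₃, τ₂, Function.update_of_ne (show y ≠ d + 1 by omega),
              Function.update_of_ne (show y ≠ d + 2 by omega),
              Function.update_of_ne (show y ≠ d + 3 by omega),
              Function.update_of_ne (show y ≠ d + 4 by omega)]
            rw [s₁ _ (by omega), hreg _ hy])
          (by simpa using a4) (by rw [hij]; simp [τ₃, τ₂]) (by rw [hij]; simp [τ₃]) (by rw [hij]; simp)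
        refine ⟨τ', (Exec.loopTrue (by rw [h3]; simp)
          (Exec.seq y₁ (Exec.seq b1 (Exec.seq b2 (Exec.seq b3 b4)))) z).cast ?_, zm, zr, zv⟩
        rw [Finset.sum_eq_sum_Ico_succ_bot hik, hij]
        ring
    have c1 := Exec.const (W := W) (N := N) σ₁ (d + 1) 0 (by omega)
    have c2 := Exec.const (W := W) (N := N) (σ₁.setReg (d + 1) 0) (d + 2) 0 (by omega)
    set σ₂ := (σ₁.setReg (d + 1) 0).setReg (d + 2) 0 with hσ₂
    have g1 : Op.lt.eval (σ₂.reg (d + 2)) (σ₂.reg d) = if 0 < k then 1 else 0 := by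
      simp [Op.eval, σ₂, v₁]
    have c3 := Exec.op (W := W) (N := N) σ₂ .lt (d + 3) (d + 2) d
      (by rw [g1]; split <;> omega)
    rw [g1] at c3
    obtain ⟨σ₃, z, zm, zr, zv⟩ := key k le_rfl (σ₂.setReg (d + 3) (if 0 < k then 1 else 0))
      (by simp [σ₂, m₁])
      (fun y hy => by
        simp [σ₂, Function.update_of_ne (show y ≠ d + 1 by omega),
          Function.update_of_ne (show y ≠ d + 2 by omega),
          Function.update_of_ne (show y ≠ d + 3 by omega), r₁ _ hy])
      (by simp [σ₂, v₁]) (by simp [σ₂]) (by simp [σ₂]) (by simp)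
    have c4 := Exec.move (W := W) (N := N) σ₃ (x := d) (y := d + 1) (z := d + 3) (by omega)
      (by rw [zv]; exact hsum)
    refine ⟨_, (Exec.seq x₁ (Exec.seq c1 (Exec.seq c2 (Exec.seq c3 (Exec.seq z c4))))).cast ?_,
      ?_, ?_, ?_⟩
    · simp [cost]; rw [← hk, Finset.range_eq_Ico]; ring
    · simp [zm]
    · intro y hy
      simp [Function.update_of_ne (show y ≠ d by omega),
        Function.update_of_ne (show y ≠ d + 3 by omega), zr _ hy]
    · simp [eval, zv, hf, hk]

end MultiStream

namespace MultiStream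

/-! ### Statements and their compilation -/

/-- The contents of the named variables and of the arrays. -/
@[ext] structure Sto where
  v : ℕ → ℕ
  a : Fin 32 → ℕ → ℕ

/-- Assignment to a variable. -/
def Sto.setV (S : Sto) (x v : ℕ) : Sto := { S with v := Function.update S.v x v }

/-- Assignment to an array cell. -/
def Sto.setA (S : Sto) (a : Fin 32) (i v : ℕ) : Sto :=
  { S with a := Function.update S.a a (Function.update (S.a a) i v) }

@[simp] theorem Sto.setV_v (S : Sto) (x v : ℕ) : (S.setV x v).v = Function.update S.v x v := rfl
@[simp] theorem Sto.setV_a (S : Sto) (x v : ℕ) : (S.setV x v).a = S.a := rfl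
@[simp] theorem Sto.setA_v (S : Sto) (a : Fin 32) (i v : ℕ) : (S.setA a i v).v = S.v := rfl
@[simp] theorem Sto.setA_a (S : Sto) (a : Fin 32) (i v : ℕ) :
    (S.setA a i v).a = Function.update S.a a (Function.update (S.a a) i v) := rfl

/-- Statements. The assignable variables are those numbered `10, …, 25`; the numbers below belong to
the input, the output and constants. `loop x n p` runs `p` for `x = 0, …, n - 1` and
leaves `0` in `x`. All assigned values are reduced modulo the value of variable `8`, so that every
statement has a meaning in every state. -/
inductive St where
  | assign (x : Fin 16) (e : Ex)
  | store (a : Fin 32) (i e : Ex)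
  | seq (p q : St)
  | ite (e : Ex) (p q : St)
  | loop (x : Fin 16) (n : Ex) (p : St)

/-- The state after `n` rounds of a loop with the variable `x` and the body `f`. -/
def iter (f : Sto → Sto) (x : ℕ) (S : Sto) : ℕ → Sto
  | 0 => S
  | n + 1 => f ((iter f x S n).setV x n)

namespace St

/-- The state in which a statement ends. The arrays have length `L`, and values are reduced
modulo `B`. -/
def run (L B : ℕ) : St → Sto → Sto
  | assign x e, S => S.setV (10 + x) (e.eval S.a S.v % B)
  | store a i e, S => if i.eval S.a S.v < L then S.setA a (i.eval S.a S.v) (e.eval S.a S.v % B) else S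
  | seq p q, S => q.run L B (p.run L B S)
  | ite e p q, S => if e.eval S.a S.v ≠ 0 then p.run L B S else q.run L B S
  | loop x n p, S => (iter (p.run L B) (10 + x) S (n.eval S.a S.v % B)).setV (10 + x) 0

/-- The running time of the compiled statement. -/
def cost (L B : ℕ) : St → Sto → ℕ
  | assign _ e, S => e.cost S.a S.v + 1
  | store _ i e, S => i.cost S.a S.v + e.cost S.a S.v + 7
  | seq p q, S => p.cost L B S + q.cost L B (p.run L B S)
  | ite e p q, S => e.cost S.a S.v + 1 +
      if e.eval S.a S.v ≠ 0 then p.cost L B S else q.cost L B S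
  | loop x n p, S => n.cost S.a S.v + 5 + ∑ i ∈ Finset.range (n.eval S.a S.v % B),
      (p.cost L B ((iter (p.run L B) (10 + x) S i).setV (10 + x) i) + 6)

/-- The exponent for the bound on intermediate results, all variables being less than `M`. -/
def deg : St → ℕ
  | assign _ e => e.deg fun _ => 1
  | store _ i e => (i.deg fun _ => 1) + e.deg fun _ => 1
  | seq p q => p.deg + q.deg
  | ite e p q => (e.deg fun _ => 1) + p.deg + q.deg
  | loop _ n p => (n.deg fun _ => 1) + p.deg

/-- The register of a named variable; names from `26` on only occur bound, and stand for `0`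
otherwise. -/
def home (y : ℕ) : ℕ := if y < 26 then y else 9

/-- Compilation, with the registers from `d` on as work space. -/
def comp : St → ℕ → Com
  | assign x e, d => .seq (e.comp home d) (.op .mod (10 + x) d 8)
  | store a i e, d => .seq (i.comp home d) (.seq (e.comp home (d + 1))
      (.seq (.op .mod (d + 1) (d + 1) 8) (.seq (.op .lt (d + 2) d 7)
        (.ite (d + 2)
          (.seq (.const (d + 2) a) (.seq (.op .mul (d + 2) (d + 2) 7)
            (.seq (.op .add d (d + 2) d) (.store d (d + 1)))))
          (.seq .skip (.seq .skip (.seq .skip .skip)))))))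
  | seq p q, d => .seq (p.comp d) (q.comp d)
  | ite e p q, d => .seq (e.comp home d) (.ite d (p.comp d) (q.comp d))
  | loop x n p, d => .seq (n.comp home d) (.seq (.op .mod d d 8) (.seq (.const (d + 1) 0)
      (.seq (.op .lt (d + 2) (d + 1) d) (.seq
        (.loop (d + 2) (.seq (.move (10 + x) (d + 1) (d + 2)) (.seq (p.comp (d + 2))
          (.seq (.const (d + 2) 1) (.seq (.op .add (d + 1) (d + 1) (d + 2))
            (.op .lt (d + 2) (d + 1) d))))))
        (.const (10 + x) 0)))))

end St

/-- States that fit the machine: variable `7` is the array length `L` and variable `8` the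
modulus `B`, numbers are in range, and array cells from `L` on are zero. -/
structure Fits (L B : ℕ) (S : Sto) : Prop where
  len : S.v 7 = L
  modulus : S.v 8 = B
  var_le : ∀ x, S.v x ≤ B
  var_zero : ∀ x, x = 9 ∨ 26 ≤ x → S.v x = 0
  cell_lt : ∀ a i, S.a a i < B
  cell_zero : ∀ a i, L ≤ i → S.a a i = 0

theorem Fits.pos {L B : ℕ} {S : Sto} (h : Fits L B S) : 0 < B :=
  (Nat.zero_le _).trans_lt (h.cell_lt 0 0)

theorem Fits.setV {L B : ℕ} {S : Sto} (h : Fits L B S) (x : Fin 16) {v : ℕ} (hv : v ≤ B) :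
    Fits L B (S.setV (10 + x) v) := by
  have hx := x.2
  refine ⟨?_, ?_, fun y => ?_, fun y hy => ?_, h.cell_lt, h.cell_zero⟩
  · simpa [Function.update_of_ne (show 7 ≠ 10 + (x : ℕ) by omega)] using h.len
  · simpa [Function.update_of_ne (show 8 ≠ 10 + (x : ℕ) by omega)] using h.modulus
  · by_cases hy : y = 10 + x
    · subst hy; simpa
    · simpa [hy] using h.var_le y
  · simpa [Function.update_of_ne (show y ≠ 10 + (x : ℕ) by omega)] using h.var_zero y hy

theorem Fits.setA {L B : ℕ} {S : Sto} (h : Fits L B S) (a : Fin 32) {i v : ℕ} (hi : i < L)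
    (hv : v < B) : Fits L B (S.setA a i v) := by
  refine ⟨h.len, h.modulus, h.var_le, h.var_zero, fun b j => ?_, fun b j hj => ?_⟩
  · by_cases hb : b = a
    · subst hb
      by_cases hj : j = i
      · subst hj; simpa
      · simpa [hj] using h.cell_lt b j
    · simpa [hb] using h.cell_lt b j
  · by_cases hb : b = a
    · subst hb
      simpa [Function.update_of_ne (show j ≠ i by omega)] using h.cell_zero b j hj
    · simpa [hb] using h.cell_zero b j hj

theorem Fits.iter {L B : ℕ} {f : Sto → Sto} (hf : ∀ S, Fits L B S → Fits L B (f S)) (x : Fin 16)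
    {S : Sto} (h : Fits L B S) : ∀ n ≤ B, Fits L B (iter f (10 + x) S n)
  | 0, _ => h
  | n + 1, hn => hf _ ((Fits.iter hf x h n (by omega)).setV x (by omega))

theorem Fits.run {L B : ℕ} (p : St) : ∀ {S : Sto}, Fits L B S → Fits L B (p.run L B S) := by
  induction p with
  | assign x e => intro S h; exact h.setV x (Nat.mod_lt _ h.pos).le
  | store a i e =>
    intro S h
    simp only [St.run]
    split
    · next hi => exact h.setA a hi (Nat.mod_lt _ h.pos)
    · exact h
  | seq p q ihp ihq => intro S h; exact ihq (ihp h)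
  | ite e p q ihp ihq =>
    intro S h
    simp only [St.run]
    split
    · exact ihp h
    · exact ihq h
  | loop x n p ih =>
    intro S h
    exact (Fits.iter (fun _ => ih) x h _ (Nat.mod_lt _ h.pos).le).setV x (Nat.zero_le _)

/-- The configuration `σ` represents the state `S`. -/
def Rep (L : ℕ) (σ : Config) (S : Sto) : Prop :=
  (∀ x < 26, σ.reg x = S.v x) ∧ Holds L σ.mem S.a

theorem Rep.setReg_high {L : ℕ} {σ : Config} {S : Sto} (h : Rep L σ S) {x : ℕ} (v : ℕ)
    (hx : 26 ≤ x) : Rep L (σ.setReg x v) S :=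
  ⟨fun y hy => by simpa [Function.update_of_ne (show y ≠ x by omega)] using h.1 y hy, h.2⟩

theorem Rep.setReg {L : ℕ} {σ : Config} {S : Sto} (h : Rep L σ S) (x v : ℕ) :
    Rep L (σ.setReg x v) (S.setV x v) :=
  ⟨fun y hy => by
    by_cases hx : y = x
    · subst hx; simp
    · simpa [hx] using h.1 y hy, h.2⟩

theorem Rep.setMem {L : ℕ} {σ : Config} {S : Sto} (h : Rep L σ S) (a : Fin 32) {i : ℕ} (v : ℕ)
    (hi : i < L) : Rep L (σ.setMem (a * L + i) v) (S.setA a i v) := by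
  refine ⟨h.1, fun b j hj => ?_⟩
  have hL : 0 < L := by omega
  by_cases hab : b = a
  · subst hab
    by_cases hij : j = i
    · subst hij; simp
    · simpa [hij, Function.update_apply] using h.2 b j hj
  · have : (b : ℕ) * L + j ≠ a * L + i := by
      intro he
      have h1 := congrArg (· / L) he
      simp only [Nat.mul_comm _ L, Nat.mul_add_div hL, Nat.div_eq_of_lt hj,
        Nat.div_eq_of_lt hi, add_zero] at h1
      exact hab (Fin.ext h1)
    simpa [this, hab, Function.update_apply] using h.2 b j hj

theorem Rep.of_eq {L : ℕ} {σ σ' : Config} {S : Sto} (h : Rep L σ S) {d : ℕ} (hd : 26 ≤ d)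
    (hm : σ'.mem = σ.mem) (hr : ∀ x < d, σ'.reg x = σ.reg x) : Rep L σ' S :=
  ⟨fun x hx => by rw [hr x (by omega), h.1 x hx], by rw [hm]; exact h.2⟩

theorem Ex.exec_of_rep {W N L B D : ℕ} (hR : Room W N L (B + 1) D) (e : Ex) {S : Sto}
    (hS : Fits L B S) {σ : Config} (hσ : Rep L σ S) {d : ℕ} (hd : 26 ≤ d)
    (hD : e.deg (fun _ => 1) ≤ D) :
    ∃ σ', Exec W N (e.comp St.home d) σ (e.cost S.a S.v) σ' ∧ σ'.mem = σ.mem ∧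
      (∀ x < d, σ'.reg x = σ.reg x) ∧ σ'.reg d = e.eval S.a S.v := by
  refine Ex.exec hR (fun a i => (hS.cell_lt a i).trans (Nat.lt_succ_self _)) hS.cell_zero e
    (fun y => ?_) (by omega) (fun y => ?_) (fun y => ?_) hD ?_ hσ.2
  · unfold St.home; split <;> omega
  · unfold St.home
    split
    · next h => exact hσ.1 y h
    · rw [hσ.1 _ (by omega), hS.var_zero _ (Or.inl rfl), hS.var_zero _ (Or.inr (by omega))]
  · have := hS.var_le y
    rw [pow_one]; omega
  · rw [hσ.1 _ (by omega), hS.len]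

/-- The compiled statement does on the machine what `run` says, in the time stated by `cost`. -/
theorem St.exec {W N L B D : ℕ} (hR : Room W N L (B + 1) D) (hBW : B < W) (p : St) :
    ∀ {S : Sto} {σ : Config} {d : ℕ}, Fits L B S → Rep L σ S → 26 ≤ d → p.deg ≤ D →
      ∃ σ', Exec W N (p.comp d) σ (p.cost L B S) σ' ∧ Rep L σ' (p.run L B S) ∧
        ∀ x < d, 26 ≤ x → σ'.reg x = σ.reg x := by
  have h2W := hR.two_lt
  have hNW := hR.addr
  induction p with
  | assign x e =>
    intro S σ d hS hσ hd hD
    obtain ⟨σ₁, x₁, m₁, r₁, v₁⟩ := e.exec_of_rep hR hS hσ hd hD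
    have e8 : σ₁.reg 8 = B := by rw [r₁ _ (by omega), hσ.1 _ (by omega), hS.modulus]
    have ev : Op.mod.eval (σ₁.reg d) (σ₁.reg 8) = e.eval S.a S.v % B := by rw [v₁, e8]; rfl
    have hlt := Nat.mod_lt (e.eval S.a S.v) hS.pos
    have c := Exec.op (W := W) (N := N) σ₁ .mod (10 + x) d 8 (by rw [ev]; omega)
    rw [ev] at c
    refine ⟨_, Exec.seq x₁ c, (hσ.of_eq hd m₁ r₁).setReg _ _, fun y hy h26 => ?_⟩
    have := x.2
    simp [Function.update_of_ne (show y ≠ 10 + (x : ℕ) by omega), r₁ y hy]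
  | store a i e =>
    intro S σ d hS hσ hd hD
    simp only [deg] at hD
    obtain ⟨σ₁, x₁, m₁, r₁, v₁⟩ := i.exec_of_rep hR hS hσ hd (by omega)
    have hσ₁ := hσ.of_eq hd m₁ r₁
    obtain ⟨σ₂, x₂, m₂, r₂, v₂⟩ := e.exec_of_rep hR hS hσ₁ (d := d + 1) (by omega) (by omega)
    have hσ₂ := hσ₁.of_eq (d := d + 1) (by omega) m₂ r₂
    have e8 : σ₂.reg 8 = B := by rw [hσ₂.1 _ (by omega), hS.modulus]
    have e7 : σ₂.reg 7 = L := by rw [hσ₂.1 _ (by omega), hS.len]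
    set n := i.eval S.a S.v with hn
    set w := e.eval S.a S.v % B with hw
    have hlt : w < B := Nat.mod_lt _ hS.pos
    have ev : Op.mod.eval (σ₂.reg (d + 1)) (σ₂.reg 8) = w := by rw [v₂, e8]; rfl
    have c := Exec.op (W := W) (N := N) σ₂ .mod (d + 1) (d + 1) 8 (by rw [ev]; omega)
    rw [ev] at c
    set σ₃ := σ₂.setReg (d + 1) w with hσ₃
    have q1 : σ₃.reg d = n := by
      simp [σ₃]; rw [r₂ _ (by omega), v₁]
    have q2 : σ₃.reg 7 = L := by
      simp [σ₃, Function.update_of_ne (show 7 ≠ d + 1 by omega), e7]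
    have ev2 : Op.lt.eval (σ₃.reg d) (σ₃.reg 7) = if n < L then 1 else 0 := by rw [q1, q2]; rfl
    have c2 := Exec.op (W := W) (N := N) σ₃ .lt (d + 2) d 7 (by rw [ev2]; split <;> omega)
    rw [ev2] at c2
    by_cases hL : n < L
    · rw [if_pos hL] at c2
      have had := hR.addr_lt a hL
      have h1 : (a : ℕ) ≤ a * L := Nat.le_mul_of_pos_right _ hR.pos
      set σ₄ := σ₃.setReg (d + 2) 1 with hσ₄
      have c3 := Exec.const (W := W) (N := N) σ₄ (d + 2) a (by omega)
      have e4 : Op.mul.eval ((σ₄.setReg (d + 2) a).reg (d + 2)) ((σ₄.setReg (d + 2) a).reg 7)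
          = a * L := by
        simp [Op.eval, σ₄, Function.update_of_ne (show 7 ≠ d + 2 by omega), q2]
      have c4 := Exec.op (W := W) (N := N) (σ₄.setReg (d + 2) a) .mul (d + 2) (d + 2) 7
        (by rw [e4]; omega)
      rw [e4] at c4
      set σ₅ := (σ₄.setReg (d + 2) a).setReg (d + 2) (a * L) with hσ₅
      have e5 : Op.add.eval (σ₅.reg (d + 2)) (σ₅.reg d) = a * L + n := by
        simp [Op.eval, σ₅, σ₄, q1]
      have c5 := Exec.op (W := W) (N := N) σ₅ .add d (d + 2) d (by rw [e5]; omega)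
      rw [e5] at c5
      have c6 := Exec.store (W := W) (N := N) (σ₅.setReg d (a * L + n)) d (d + 1)
        (by simpa using had)
      have e6 : (σ₅.setReg d (a * L + n)).reg (d + 1) = w := by simp [σ₅, σ₄, σ₃]
      have e7 : (σ₅.setReg d (a * L + n)).reg d = a * L + n := by simp
      rw [e6, e7] at c6
      refine ⟨_, (Exec.seq x₁ (Exec.seq x₂ (Exec.seq c (Exec.seq c2 (Exec.iteTrue
        (by simp [σ₄]) (Exec.seq c3 (Exec.seq c4 (Exec.seq c5 c6)))))))).cast
          (by simp [cost]; ring), ?_, fun y hy h26 => ?_⟩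
      · simp only [run, ← hn, ← hw, if_pos hL]
        exact ((((((hσ₂.setReg_high w (by omega)).setReg_high 1 (by omega)).setReg_high _
          (by omega)).setReg_high _ (by omega)).setReg_high _ (by omega)).setMem a w hL)
      · simp [σ₅, σ₄, σ₃, Function.update_of_ne (show y ≠ d by omega),
          Function.update_of_ne (show y ≠ d + 1 by omega),
          Function.update_of_ne (show y ≠ d + 2 by omega)]
        rw [r₂ y (by omega), r₁ y hy]
    · rw [if_neg hL] at c2
      refine ⟨_, (Exec.seq x₁ (Exec.seq x₂ (Exec.seq c (Exec.seq c2 (Exec.iteFalse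
        (by simp) (Exec.seq (.skip _) (Exec.seq (.skip _) (Exec.seq (.skip _) (.skip _))))))))).cast
          (by simp [cost]; ring), ?_, fun y hy h26 => ?_⟩
      · simp only [run, ← hn, if_neg hL]
        exact (hσ₂.setReg_high w (by omega)).setReg_high 0 (by omega)
      · simp [σ₃, Function.update_of_ne (show y ≠ d + 1 by omega),
          Function.update_of_ne (show y ≠ d + 2 by omega)]
        rw [r₂ y (by omega), r₁ y hy]
  | seq p q ihp ihq =>
    intro S σ d hS hσ hd hD
    simp only [deg] at hD
    obtain ⟨σ₁, x₁, h₁, r₁⟩ := ihp hS hσ hd (by omega)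
    obtain ⟨σ₂, x₂, h₂, r₂⟩ := ihq (hS.run p) h₁ hd (by omega)
    exact ⟨σ₂, Exec.seq x₁ x₂, h₂, fun y hy h => by rw [r₂ y hy h, r₁ y hy h]⟩
  | ite e p q ihp ihq =>
    intro S σ d hS hσ hd hD
    simp only [deg] at hD
    obtain ⟨σ₁, x₁, m₁, r₁, v₁⟩ := e.exec_of_rep hR hS hσ hd (by omega)
    have hσ₁ := hσ.of_eq hd m₁ r₁
    by_cases h0 : e.eval S.a S.v ≠ 0
    · obtain ⟨σ₂, x₂, h₂, r₂⟩ := ihp hS hσ₁ hd (by omega)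
      exact ⟨σ₂, (Exec.seq x₁ (Exec.iteTrue (by rwa [v₁]) x₂)).cast
        (by simp only [cost, if_pos h0]; ring), by simpa only [run, if_pos h0] using h₂,
        fun y hy h => by rw [r₂ y hy h, r₁ y hy]⟩
    · obtain ⟨σ₂, x₂, h₂, r₂⟩ := ihq hS hσ₁ hd (by omega)
      exact ⟨σ₂, (Exec.seq x₁ (Exec.iteFalse (by rw [v₁]; exact not_not.1 h0) x₂)).cast
        (by simp only [cost, if_neg h0]; ring), by simpa only [run, if_neg h0] using h₂,
        fun y hy h => by rw [r₂ y hy h, r₁ y hy]⟩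
  | loop x n p ih =>
    intro S σ d hS hσ hd hD
    simp only [deg] at hD
    have hx := x.2
    obtain ⟨σ₁, x₁, m₁, r₁, v₁⟩ := n.exec_of_rep hR hS hσ hd (by omega)
    have hσ₁ := hσ.of_eq hd m₁ r₁
    have e8 : σ₁.reg 8 = B := by rw [hσ₁.1 _ (by omega), hS.modulus]
    set k := n.eval S.a S.v % B with hk
    have hkB : k < B := Nat.mod_lt _ hS.pos
    have ev : Op.mod.eval (σ₁.reg d) (σ₁.reg 8) = k := by rw [v₁, e8]; rfl
    have c1 := Exec.op (W := W) (N := N) σ₁ .mod d d 8 (by rw [ev]; omega)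
    rw [ev] at c1
    have c2 := Exec.const (W := W) (N := N) (σ₁.setReg d k) (d + 1) 0 (by omega)
    set σ₂ := (σ₁.setReg d k).setReg (d + 1) 0 with hσ₂
    have ev2 : Op.lt.eval (σ₂.reg (d + 1)) (σ₂.reg d) = if 0 < k then 1 else 0 := by
      simp [Op.eval, σ₂]
    have c3 := Exec.op (W := W) (N := N) σ₂ .lt (d + 2) (d + 1) d
      (by rw [ev2]; split <;> omega)
    rw [ev2] at c3
    -- the loop, entered with counter `k - j`
    have key : ∀ j ≤ k, ∀ τ : Config, Rep L τ (iter (p.run L B) (10 + x) S (k - j)) →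
        (∀ y < d, 26 ≤ y → τ.reg y = σ.reg y) → τ.reg d = k → τ.reg (d + 1) = k - j →
        τ.reg (d + 2) = (if k - j < k then 1 else 0) →
        ∃ τ', Exec W N (.loop (d + 2) (.seq (.move (10 + x) (d + 1) (d + 2))
          (.seq (p.comp (d + 2)) (.seq (.const (d + 2) 1) (.seq (.op .add (d + 1) (d + 1) (d + 2))
            (.op .lt (d + 2) (d + 1) d)))))) τ
          (1 + ∑ i ∈ Finset.Ico (k - j) k,
            (p.cost L B ((iter (p.run L B) (10 + x) S i).setV (10 + x) i) + 6)) τ' ∧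
          Rep L τ' (iter (p.run L B) (10 + x) S k) ∧ ∀ y < d, 26 ≤ y → τ'.reg y = σ.reg y := by
      intro j
      induction j with
      | zero =>
        intro _ τ hrep hreg h0 h1 h2
        exact ⟨τ, (Exec.loopFalse (by simp [h2])).cast (by simp), by simpa using hrep, hreg⟩
      | succ j ihj =>
        intro hj τ hrep hreg h0 h1 h2
        obtain ⟨i, hi⟩ : ∃ i, i = k - (j + 1) := ⟨_, rfl⟩
        have hij : k - j = i + 1 := by omega
        have hik : i < k := by omega
        rw [← hi] at hrep h1 h2 ⊢
        rw [if_pos hik] at h2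
        have b1 := Exec.move (W := W) (N := N) τ (x := 10 + x) (y := d + 1) (z := d + 2)
          (by omega) (by omega)
        rw [h1] at b1
        have rep1 : Rep L ((τ.setReg (d + 2) 0).setReg (10 + x) i)
            ((iter (p.run L B) (10 + x) S i).setV (10 + x) i) :=
          (hrep.setReg_high 0 (by omega)).setReg _ _
        have fit1 : Fits L B ((iter (p.run L B) (10 + x) S i).setV (10 + x) i) :=
          (Fits.iter (fun _ => Fits.run p) x hS i (by omega)).setV x (by omega)
        obtain ⟨τ₁, y₁, rep2, s₁⟩ := ih fit1 rep1 (d := d + 2) (by omega) (by omega)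
        have f0 : τ₁.reg d = k := by
          rw [s₁ _ (by omega) hd]
          simp [Function.update_of_ne (show d ≠ 10 + (x : ℕ) by omega), h0]
        have f1 : τ₁.reg (d + 1) = i := by
          rw [s₁ _ (by omega) (by omega)]
          simp [Function.update_of_ne (show d + 1 ≠ 10 + (x : ℕ) by omega), h1]
        have b2 := Exec.const (W := W) (N := N) τ₁ (d + 2) 1 (by omega)
        have a3 : (τ₁.setReg (d + 2) 1).reg (d + 1) + (τ₁.setReg (d + 2) 1).reg (d + 2) = i + 1 := by
          simp [f1]
        have b3 := Exec.op (W := W) (N := N) (τ₁.setReg (d + 2) 1) .add (d + 1) (d + 1) (d + 2)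
          (by simp only [Op.eval]; omega)
        simp only [Op.eval, a3] at b3
        set τ₂ := (τ₁.setReg (d + 2) 1).setReg (d + 1) (i + 1) with hτ₂
        have a4 : Op.lt.eval (τ₂.reg (d + 1)) (τ₂.reg d) = if i + 1 < k then 1 else 0 := by
          simp [Op.eval, τ₂, f0]
        have b4 := Exec.op (W := W) (N := N) τ₂ .lt (d + 2) (d + 1) d
          (by rw [a4]; split <;> omega)
        rw [a4] at b4
        obtain ⟨τ', z, zr, zy⟩ := ihj (by omega) (τ₂.setReg (d + 2) (if i + 1 < k then 1 else 0))
          (by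
            rw [hij]
            exact ((rep2.setReg_high 1 (by omega)).setReg_high _ (by omega)).setReg_high _
              (by omega))
          (fun y hy h26 => by
            simp [τ₂, Function.update_of_ne (show y ≠ d + 1 by omega),
              Function.update_of_ne (show y ≠ d + 2 by omega)]
            rw [s₁ y (by omega) h26]
            simp [Function.update_of_ne (show y ≠ d + 2 by omega),
              Function.update_of_ne (show y ≠ 10 + (x : ℕ) by omega), hreg y hy h26])
          (by simp [τ₂, f0]) (by rw [hij]; simp [τ₂]) (by rw [hij]; simp)
        refine ⟨τ', (Exec.loopTrue (by rw [h2]; simp)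
          (Exec.seq b1 (Exec.seq y₁ (Exec.seq b2 (Exec.seq b3 b4)))) z).cast ?_, zr, zy⟩
        rw [Finset.sum_eq_sum_Ico_succ_bot hik, hij]
        ring
    obtain ⟨σ₃, z, zr, zy⟩ := key k le_rfl (σ₂.setReg (d + 2) (if 0 < k then 1 else 0))
      (by
        rw [Nat.sub_self]
        exact ((hσ₁.setReg_high _ hd).setReg_high _ (by omega)).setReg_high _ (by omega))
      (fun y hy h26 => by
        simp [σ₂, Function.update_of_ne (show y ≠ d by omega),
          Function.update_of_ne (show y ≠ d + 1 by omega),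
          Function.update_of_ne (show y ≠ d + 2 by omega), r₁ y hy])
      (by simp [σ₂]) (by simp [σ₂]) (by simp)
    have c4 := Exec.const (W := W) (N := N) σ₃ (10 + x) 0 (by omega)
    refine ⟨_, (Exec.seq x₁ (Exec.seq c1 (Exec.seq c2 (Exec.seq c3 (Exec.seq z c4))))).cast ?_,
      ?_, fun y hy h26 => ?_⟩
    · simp only [cost, ← hk, Finset.range_eq_Ico, Nat.sub_self]; ring
    · exact zr.setReg _ _
    · simp [Function.update_of_ne (show y ≠ 10 + (x : ℕ) by omega), zy y hy h26]

end MultiStream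

namespace MultiStream

/-! ### Bounded search and longest common extensions -/

open Classical in
/-- The least `i < n` with `φ i`, and `n` if there is none. -/
noncomputable def mu (n : ℕ) (φ : ℕ → Prop) : ℕ :=
  ((Finset.range n).filter fun i => ∀ j ≤ i, ¬ φ j).card

theorem mu_eq {n t : ℕ} {φ : ℕ → Prop} (h1 : t ≤ n) (h2 : ∀ i < t, ¬ φ i) (h3 : t < n → φ t) :
    mu n φ = t := by
  classical
  have : (Finset.range n).filter (fun i => ∀ j ≤ i, ¬ φ j) = Finset.range t := by
    ext i
    simp only [Finset.mem_filter, Finset.mem_range]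
    constructor
    · rintro ⟨hi, h⟩
      by_contra hti
      exact h t (by omega) (h3 (by omega))
    · intro hi
      exact ⟨by omega, fun j hj => h2 j (by omega)⟩
  unfold mu
  convert congrArg Finset.card this
  simp

theorem mu_spec (n : ℕ) (φ : ℕ → Prop) :
    mu n φ ≤ n ∧ (∀ i < mu n φ, ¬ φ i) ∧ (mu n φ < n → φ (mu n φ)) := by
  classical
  by_cases h : ∃ i, i < n ∧ φ i
  · have hs := Nat.find_spec h
    have hm : ∀ i < Nat.find h, ¬ φ i := fun i hi hφ =>
      Nat.find_min h hi ⟨hi.trans hs.1, hφ⟩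
    rw [mu_eq hs.1.le hm fun _ => hs.2]
    exact ⟨hs.1.le, hm, fun _ => hs.2⟩
  · push Not at h
    rw [mu_eq le_rfl h (fun h => absurd h (lt_irrefl _))]
    exact ⟨le_rfl, h, fun h => absurd h (lt_irrefl _)⟩

theorem mu_le (n : ℕ) (φ : ℕ → Prop) : mu n φ ≤ n := (mu_spec n φ).1

theorem mu_lt {n i : ℕ} {φ : ℕ → Prop} (hi : i < n) (h : φ i) : mu n φ < n := by
  by_contra hn
  exact (mu_spec n φ).2.1 i (by omega) h

/-- The length of the longest common prefix of the sequences `c i, c (i + 1), …` and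
`c j, c (j + 1), …`, at most `m`. -/
noncomputable def lce (c : ℕ → ℕ) (m i j : ℕ) : ℕ := mu m fun d => c (i + d) ≠ c (j + d)

/-- `c` is a string of length `m` over the positive numbers, continued by zeros. -/
def Sentinel (c : ℕ → ℕ) (m : ℕ) : Prop := ∀ i, c i = 0 ↔ m ≤ i

section

variable {c : ℕ → ℕ} {m : ℕ}

theorem lce_le (i j : ℕ) : lce c m i j ≤ m := mu_le _ _

theorem lce_eq {i j d : ℕ} (h : d < lce c m i j) : c (i + d) = c (j + d) :=
  not_not.1 ((mu_spec _ _).2.1 d h)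

theorem lce_ne {i j : ℕ} (h : lce c m i j < m) : c (i + lce c m i j) ≠ c (j + lce c m i j) :=
  (mu_spec m fun d => c (i + d) ≠ c (j + d)).2.2 h

theorem lce_symm (i j : ℕ) : lce c m i j = lce c m j i := by
  unfold lce; simp only [ne_comm]

theorem lce_self (i : ℕ) : lce c m i i = m := mu_eq le_rfl (by simp) (by simp)

theorem le_lce {i j n : ℕ} (hn : n ≤ m) (h : ∀ d < n, c (i + d) = c (j + d)) :
    n ≤ lce c m i j := by
  by_contra hlt
  exact lce_ne (by omega) (h _ (not_le.1 hlt))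

theorem lce_eq_of {i j n : ℕ} (hn : n < m) (h : ∀ d < n, c (i + d) = c (j + d))
    (hne : c (i + n) ≠ c (j + n)) : lce c m i j = n :=
  mu_eq hn.le (fun d hd => not_not.2 (h d hd)) fun _ => hne

theorem add_lce_le (hc : Sentinel c m) {i j : ℕ} (hi : i < m) (hj : j < m) (hij : i ≠ j) :
    i + lce c m i j ≤ m := by
  by_contra hlt
  have h1 : c (i + (m - i)) = c (j + (m - i)) := lce_eq (m := m) (by omega)
  rw [(hc _).2 (by omega)] at h1
  have h2 := (hc _).1 h1.symm
  have h3 : c (i + (m - j)) = c (j + (m - j)) := lce_eq (m := m) (by omega)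
  rw [(hc (j + (m - j))).2 (by omega)] at h3
  have h4 := (hc _).1 h3
  omega

theorem lce_lt (hc : Sentinel c m) {i j : ℕ} (hi : i < m) (hj : j < m) (hij : i ≠ j) :
    lce c m i j < m := by
  have h1 := add_lce_le hc hi hj hij
  have h2 := add_lce_le hc hj hi hij.symm
  rw [lce_symm] at h2
  omega

/-! ### The suffix array -/

/-- The suffix at `i` precedes the suffix at `j` in the lexicographic order. -/
def SufLt (c : ℕ → ℕ) (m i j : ℕ) : Prop := c (i + lce c m i j) < c (j + lce c m i j)

theorem SufLt.lce_lt (hc : Sentinel c m) {i j : ℕ} (h : SufLt c m i j) : lce c m i j < m := by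
  by_contra hm
  unfold SufLt at h
  rw [(hc (j + _)).2 (by omega)] at h
  omega

/-- The longest common extension of the outer two of three suffixes in lexicographic order. -/
theorem SufLt.trans_min (hc : Sentinel c m) {i j h : ℕ} (h1 : SufLt c m i j)
    (h2 : SufLt c m j h) :
    SufLt c m i h ∧ lce c m i h = min (lce c m i j) (lce c m j h) := by
  have m1 := h1.lce_lt hc
  have m2 := h2.lce_lt hc
  unfold SufLt at h1 h2 ⊢
  have key : c (i + min (lce c m i j) (lce c m j h)) < c (h + min (lce c m i j) (lce c m j h)) ∧
      lce c m i h = min (lce c m i j) (lce c m j h) := by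
    have hlt : c (i + min (lce c m i j) (lce c m j h)) <
        c (h + min (lce c m i j) (lce c m j h)) := by
      rcases lt_trichotomy (lce c m i j) (lce c m j h) with hl | hl | hl
      · rw [min_eq_left hl.le, ← lce_eq (i := j) (j := h) hl]; exact h1
      · rw [hl, min_self]; rw [hl] at h1; exact h1.trans h2
      · rw [min_eq_right hl.le, lce_eq (i := i) (j := j) hl]; exact h2
    refine ⟨hlt, lce_eq_of (by omega) (fun d hd => ?_) hlt.ne⟩
    rw [lce_eq (c := c) (m := m) (i := i) (j := j) (d := d) (by omega),
      lce_eq (c := c) (m := m) (i := j) (j := h) (d := d) (by omega)]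
  exact ⟨by rw [key.2]; exact key.1, key.2⟩

theorem SufLt.irrefl (i : ℕ) : ¬ SufLt c m i i := lt_irrefl _

theorem sufLt_or (hc : Sentinel c m) {i j : ℕ} (hi : i < m) (hj : j < m) (hij : i ≠ j) :
    SufLt c m i j ∨ SufLt c m j i := by
  have h := lce_ne (lce_lt hc hi hj hij)
  unfold SufLt
  rw [lce_symm j i]
  omega

open Classical in
/-- The rank of the suffix at `i` in the lexicographic order. -/
noncomputable def sufRank (c : ℕ → ℕ) (m i : ℕ) : ℕ :=
  ((Finset.range m).filter fun j => SufLt c m j i).card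

theorem sufRank_lt_sufRank (hc : Sentinel c m) {i j : ℕ} (hi : i < m) (h : SufLt c m i j) :
    sufRank c m i < sufRank c m j := by
  classical
  refine Finset.card_lt_card ⟨fun x hx => ?_, fun hsub => ?_⟩
  · simp only [Finset.mem_filter] at hx ⊢
    exact ⟨hx.1, (hx.2.trans_min hc h).1⟩
  · have := hsub (Finset.mem_filter.2 ⟨Finset.mem_range.2 hi, h⟩)
    exact SufLt.irrefl _ (Finset.mem_filter.1 this).2

theorem sufRank_le (i : ℕ) : sufRank c m i ≤ m := by
  classical
  unfold sufRank
  exact (Finset.card_filter_le _ _).trans (by simp)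

theorem sufRank_lt {i : ℕ} (hi : i < m) : sufRank c m i < m := by
  classical
  have : ((Finset.range m).filter fun j => SufLt c m j i).card < (Finset.range m).card := by
    refine Finset.card_lt_card ⟨Finset.filter_subset _ _, fun hsub => ?_⟩
    exact SufLt.irrefl _ (Finset.mem_filter.1 (hsub (Finset.mem_range.2 hi))).2
  unfold sufRank
  convert this
  simp

theorem sufRank_inj (hc : Sentinel c m) {i j : ℕ} (hi : i < m) (hj : j < m)
    (h : sufRank c m i = sufRank c m j) : i = j := by
  by_contra hij
  rcases sufLt_or hc hi hj hij with hlt | hlt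
  · exact (sufRank_lt_sufRank hc hi hlt).ne h
  · exact (sufRank_lt_sufRank hc hj hlt).ne' h

/-- The suffix array: the position of the suffix of rank `r`. -/
noncomputable def sufArr (c : ℕ → ℕ) (m r : ℕ) : ℕ := mu m fun i => sufRank c m i = r

theorem sufArr_le (r : ℕ) : sufArr c m r ≤ m := mu_le _ _

theorem sufArr_sufRank (hc : Sentinel c m) {i : ℕ} (hi : i < m) :
    sufArr c m (sufRank c m i) = i :=
  mu_eq hi.le (fun _ hj h => hj.ne (sufRank_inj hc (hj.trans hi) hi h)) fun _ => rfl

theorem sufArr_spec (hc : Sentinel c m) {r : ℕ} (hr : r < m) :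
    sufArr c m r < m ∧ sufRank c m (sufArr c m r) = r := by
  classical
  have hsurj : Function.Surjective fun i : Fin m => (⟨sufRank c m i, sufRank_lt i.2⟩ : Fin m) :=
    Finite.injective_iff_surjective.1 fun i j h =>
      Fin.ext (sufRank_inj hc i.2 j.2 (congrArg Fin.val h))
  obtain ⟨i, hi⟩ := hsurj ⟨r, hr⟩
  have hi' : sufRank c m i = r := by simpa using hi
  have hlt : sufArr c m r < m := mu_lt i.2 hi'
  exact ⟨hlt, (mu_spec m fun i => sufRank c m i = r).2.2 hlt⟩

/-- The longest common extension of the suffixes of ranks `l` and `r`. -/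
noncomputable def rankLce (c : ℕ → ℕ) (m l r : ℕ) : ℕ := lce c m (sufArr c m l) (sufArr c m r)

theorem rankLce_le (l r : ℕ) : rankLce c m l r ≤ m := lce_le _ _

theorem sufLt_sufArr (hc : Sentinel c m) {l r : ℕ} (hlr : l < r) (hr : r < m) :
    SufLt c m (sufArr c m l) (sufArr c m r) := by
  obtain ⟨h1, h2⟩ := sufArr_spec hc (hlr.trans hr)
  obtain ⟨h3, h4⟩ := sufArr_spec hc hr
  rcases sufLt_or hc h1 h3 (fun h => by rw [h, h4] at h2; omega) with h | h
  · exact h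
  · have := sufRank_lt_sufRank hc h3 h
    omega

theorem rankLce_split (hc : Sentinel c m) {l t r : ℕ} (hlt : l ≤ t) (htr : t ≤ r) (hr : r < m) :
    rankLce c m l r = min (rankLce c m l t) (rankLce c m t r) := by
  rcases hlt.eq_or_lt with rfl | h1
  · rw [min_eq_right]
    unfold rankLce
    rw [lce_self]; exact lce_le _ _
  rcases htr.eq_or_lt with rfl | h2
  · rw [min_eq_left]
    unfold rankLce
    rw [lce_self]; exact lce_le _ _
  exact ((sufLt_sufArr hc h1 (h2.trans hr)).trans_min hc (sufLt_sufArr hc h2 hr)).2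

theorem rankLce_overlap (hc : Sentinel c m) {l t t' r : ℕ} (hlt : l ≤ t) (htt : t ≤ t')
    (htr : t' ≤ r) (hr : r < m) :
    rankLce c m l r = min (rankLce c m l t') (rankLce c m t r) := by
  rw [rankLce_split hc (hlt.trans htt) htr hr, rankLce_split hc htt htr hr,
    rankLce_split hc hlt htt (htr.trans_lt hr)]
  omega

/-! ### Constant time range minima -/

open Classical in
/-- The bits of this number below `n` mark the places where the minimum of the common extensions
of neighbours in the suffix array, taken from `i` on, decreases. -/
noncomputable def mask (c : ℕ → ℕ) (m i n : ℕ) : ℕ :=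
  ∑ t ∈ Finset.range n,
    if t = 0 ∨ rankLce c m i (i + t + 1) < rankLce c m i (i + t) then 2 ^ t else 0

theorem mask_succ (i n : ℕ) [Decidable (n = 0 ∨
    rankLce c m i (i + n + 1) < rankLce c m i (i + n))] : mask c m i (n + 1) = mask c m i n +
    if n = 0 ∨ rankLce c m i (i + n + 1) < rankLce c m i (i + n) then 2 ^ n else 0 := by
  unfold mask
  rw [Finset.sum_range_succ]
  congr

theorem mask_lt (i n : ℕ) : mask c m i n < 2 ^ n := by
  classical
  induction n with
  | zero => simp [mask]
  | succ n ih =>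
    rw [mask_succ, pow_succ]
    split <;> omega

theorem mask_mod (i : ℕ) {n b : ℕ} (h : n ≤ b) : mask c m i b % 2 ^ n = mask c m i n := by
  classical
  induction b, h using Nat.le_induction with
  | base => exact Nat.mod_eq_of_lt (mask_lt i n)
  | succ b hb ih =>
    rw [mask_succ, Nat.add_mod, ih]
    have : (if b = 0 ∨ rankLce c m i (i + b + 1) < rankLce c m i (i + b) then 2 ^ b else 0)
        % 2 ^ n = 0 := by
      split
      · exact Nat.mod_eq_zero_of_dvd (pow_dvd_pow 2 hb)
      · simp
    rw [this, add_zero]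
    exact Nat.mod_eq_of_lt (mask_lt i n)

/-- The highest bit of the mask is the place of the minimum. -/
theorem rankLce_eq_mask (hc : Sentinel c m) (i n : ℕ) (h : i + (n + 1) < m) :
    rankLce c m i (i + (n + 1)) =
      rankLce c m (i + Nat.log 2 (mask c m i (n + 1))) (i + Nat.log 2 (mask c m i (n + 1)) + 1) ∧
    Nat.log 2 (mask c m i (n + 1)) ≤ n := by
  classical
  induction n with
  | zero => simp [mask]
  | succ n ih =>
    obtain ⟨ih1, ih2⟩ := ih (by omega)
    have hs := rankLce_split hc (show i ≤ i + (n + 1) by omega)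
      (show i + (n + 1) ≤ i + (n + 1) + 1 by omega) h
    rw [mask_succ i (n + 1)]
    have hlt := mask_lt (c := c) (m := m) i (n + 1)
    split
    · next hd =>
      have hd' := hd.resolve_left (by omega)
      have hlog : Nat.log 2 (mask c m i (n + 1) + 2 ^ (n + 1)) = n + 1 :=
        (Nat.log_eq_iff (by omega)).2 ⟨by omega, by rw [pow_succ 2 (n + 1)]; omega⟩
      rw [hlog]
      refine ⟨?_, le_rfl⟩
      rw [← add_assoc i (n + 1) 1]
      omega
    · next hd =>
      rw [not_or] at hd
      rw [add_zero]
      refine ⟨?_, by omega⟩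
      rw [← ih1, ← add_assoc i (n + 1) 1]
      omega

/-- Two overlapping intervals of `2 ^ j` blocks of length `b` cover an interval of blocks. -/
theorem rankLce_blocks (hc : Sentinel c m) {b x y : ℕ} (hxy : x < y) (hy : y * b < m) :
    rankLce c m (x * b) (y * b) =
      min (rankLce c m (x * b) (x * b + b * 2 ^ Nat.log 2 (y - x)))
        (rankLce c m ((y - 2 ^ Nat.log 2 (y - x)) * b)
          ((y - 2 ^ Nat.log 2 (y - x)) * b + b * 2 ^ Nat.log 2 (y - x))) := by
  set p := 2 ^ Nat.log 2 (y - x) with hp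
  have h1 : p ≤ y - x := Nat.pow_log_le_self 2 (by omega)
  have h2 : y - x < p * 2 := by
    have := Nat.lt_pow_succ_log_self (b := 2) (by omega) (y - x)
    rwa [pow_succ] at this
  have e1 : (y - p) * b + b * p = y * b := by
    rw [mul_comm b p, ← add_mul]; congr 1; omega
  have e2 : x * b + b * p = (x + p) * b := by ring
  rw [e1, e2]
  exact rankLce_overlap hc (Nat.mul_le_mul_right _ (by omega)) (Nat.mul_le_mul_right _ (by omega))
    (Nat.mul_le_mul_right _ (by omega)) hy

/-- Away from its two end intervals of length `b`, a long interval consists of blocks. -/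
theorem rankLce_long (hc : Sentinel c m) {b l r : ℕ} (hb : 0 < b) (hlr : l + b ≤ r) (hr : r < m) :
    rankLce c m l r = min (min (rankLce c m l (l + b)) (rankLce c m (r - b) r))
      (if (l + b - 1) / b < r / b then rankLce c m ((l + b - 1) / b * b) (r / b * b) else m) := by
  set x := (l + b - 1) / b with hx
  set y := r / b with hy
  have x1 : x * b ≤ l + b - 1 := Nat.div_mul_le_self _ _
  have x2 : l ≤ x * b := by
    have := Nat.lt_div_mul_add (a := l + b - 1) hb
    rw [← hx] at this
    omega
  have y1 : y * b ≤ r := Nat.div_mul_le_self _ _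
  have y2 : r < y * b + b := Nat.lt_div_mul_add (a := r) hb
  by_cases hxy : x < y
  · rw [if_pos hxy]
    have hle : x * b ≤ y * b := Nat.mul_le_mul_right _ hxy.le
    rw [rankLce_overlap hc (t := x * b) (t' := l + b) x2 (by omega) (by omega) hr,
      rankLce_overlap hc (l := x * b) (t := max (x * b) (r - b)) (t' := y * b) (by omega)
        (by omega) y1 hr]
    have h3 : rankLce c m (r - b) r ≤ rankLce c m (max (x * b) (r - b)) r := by
      rw [rankLce_split hc (l := r - b) (t := max (x * b) (r - b)) (r := r) (by omega)
        (by omega) hr]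
      omega
    have h4 : min (rankLce c m l (l + b)) (rankLce c m (x * b) r) =
        rankLce c m l r :=
      (rankLce_overlap hc (t := x * b) (t' := l + b) x2 (by omega) (by omega) hr).symm
    have h5 : rankLce c m l r ≤ rankLce c m (r - b) r := by
      rw [rankLce_split hc (l := l) (t := r - b) (r := r) (by omega) (by omega) hr]
      omega
    rw [rankLce_overlap hc (l := x * b) (t := max (x * b) (r - b)) (t' := y * b) (by omega)
        (by omega) y1 hr] at h4
    omega
  · rw [if_neg hxy]
    have hle : y * b ≤ x * b := Nat.mul_le_mul_right _ (by omega)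
    rw [rankLce_overlap hc (t := r - b) (t' := l + b) (by omega) (by omega) (by omega) hr,
      min_eq_left (a := min _ _)]
    exact (min_le_left _ _).trans (rankLce_le _ _)

end

end MultiStream

namespace MultiStream

/-! ### First occurrences of factors -/

section

variable {c : ℕ → ℕ} {m : ℕ}

/-- The length of the longest factor of the string `c` that starts at `i` and has an earlier
occurrence. -/
noncomputable def prevLen (c : ℕ → ℕ) (m i : ℕ) : ℕ := mu m fun l => ∀ j < i, lce c m j i ≤ l

/-- The place of the first occurrence of the factor of length `prevLen c m i` at `i`. -/
noncomputable def prevPos (c : ℕ → ℕ) (m i : ℕ) : ℕ := mu m fun j => prevLen c m i ≤ lce c m j i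

/-- The factor of length `prevLen c m i + 1` at `i`, which has its first occurrence there, exists:
it is not cut short by the end of the string. -/
def IsBranch (c : ℕ → ℕ) (m i : ℕ) : Prop := 0 < i ∧ i + prevLen c m i < m

/-- The factor of length `l` at `p` has no earlier occurrence. -/
def IsFirst (c : ℕ → ℕ) (m p l : ℕ) : Prop := p + l ≤ m ∧ ∀ j < p, lce c m j p < l

theorem IsFirst.zero : IsFirst c m 0 0 := ⟨Nat.zero_le _, by simp⟩

theorem prevLen_le (i : ℕ) : prevLen c m i ≤ m := mu_le _ _

theorem prevPos_le (i : ℕ) : prevPos c m i ≤ m := mu_le _ _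

theorem IsBranch.lt {i : ℕ} (h : IsBranch c m i) : i < m := by have := h.2; omega

theorem IsBranch.lce_le {i : ℕ} (h : IsBranch c m i) {j : ℕ} (hj : j < i) :
    lce c m j i ≤ prevLen c m i :=
  (mu_spec m fun l => ∀ j < i, lce c m j i ≤ l).2.2 (show prevLen c m i < m by
    have := h.2; omega) j hj

theorem IsBranch.prevPos_spec {i : ℕ} (h : IsBranch c m i) :
    prevPos c m i < i ∧ prevLen c m i ≤ lce c m (prevPos c m i) i := by
  obtain ⟨j, hj, hl⟩ : ∃ j < i, prevLen c m i ≤ lce c m j i := by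
    rcases Nat.eq_zero_or_pos (prevLen c m i) with h0 | h0
    · exact ⟨0, h.1, by omega⟩
    · have := (mu_spec m fun l => ∀ j < i, lce c m j i ≤ l).2.1 (prevLen c m i - 1)
        (show prevLen c m i - 1 < prevLen c m i by omega)
      push Not at this
      obtain ⟨j, hj, hl⟩ := this
      exact ⟨j, hj, by omega⟩
  have hs := mu_spec m fun j => prevLen c m i ≤ lce c m j i
  have hle : prevPos c m i ≤ j := by
    by_contra hlt
    exact hs.2.1 j (not_le.1 hlt) hl
  exact ⟨by omega, hs.2.2 (show prevPos c m i < m by have := h.lt; omega)⟩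

theorem IsFirst.succ (hc : Sentinel c m) {p l : ℕ} (h : IsFirst c m p l) (h0 : c (p + l) ≠ 0) :
    IsFirst c m p (l + 1) := by
  have : ¬ m ≤ p + l := fun hm => h0 ((hc _).2 hm)
  exact ⟨by omega, fun j hj => (h.2 j hj).trans (Nat.lt_succ_self _)⟩

/-- A factor that extends the longest earlier match of a branch by one symbol is new. -/
theorem IsBranch.isFirst {i : ℕ} (h : IsBranch c m i) : IsFirst c m i (prevLen c m i + 1) :=
  ⟨h.2, fun _ hj => Nat.lt_succ_of_le (h.lce_le hj)⟩

/-- A branch is determined by the factor that it extends and by the symbol. -/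
theorem IsBranch.eq_of_eq {i j : ℕ} (hi : IsBranch c m i) (hj : IsBranch c m j)
    (h1 : prevPos c m i = prevPos c m j) (h2 : prevLen c m i = prevLen c m j)
    (h3 : c (i + prevLen c m i) = c (j + prevLen c m j)) : i = j := by
  have key : ∀ {i j : ℕ}, IsBranch c m i → IsBranch c m j → prevPos c m i = prevPos c m j →
      prevLen c m i = prevLen c m j → c (i + prevLen c m i) = c (j + prevLen c m j) →
      ¬ i < j := by
    intro i j hi hj h1 h2 h3 hlt
    have h4 : prevLen c m i + 1 ≤ lce c m i j := by
      refine le_lce (by have := hi.2; omega) fun d hd => ?_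
      rcases Nat.lt_succ_iff_lt_or_eq.1 hd with hd | rfl
      · rw [← lce_eq (c := c) (m := m) (hd.trans_le hi.prevPos_spec.2), h1,
          lce_eq (c := c) (m := m) (hd.trans_le (h2 ▸ hj.prevPos_spec.2))]
      · rw [h3, h2]
    have := hj.lce_le hlt
    omega
  rcases lt_trichotomy i j with h | h | h
  · exact absurd h (key hi hj h1 h2 h3)
  · exact h
  · exact absurd h (key hj hi h1.symm h2.symm h3.symm)

/-- If the factor `w` of length `l` at its first occurrence `p` is not followed by `a` there, but
`w a` is a factor, then `w a` is found as a branch. -/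
theorem IsFirst.exists_branch (hc : Sentinel c m) {p l a i : ℕ} (h : IsFirst c m p l) (ha : a ≠ 0)
    (hp : c (p + l) ≠ a) (hi : ∀ d < l, c (i + d) = c (p + d)) (hia : c (i + l) = a) :
    ∃ i, IsBranch c m i ∧ prevPos c m i = p ∧ prevLen c m i = l ∧ c (i + l) = a := by
  classical
  have hex : ∃ i, (∀ d < l, c (i + d) = c (p + d)) ∧ c (i + l) = a := ⟨i, hi, hia⟩
  obtain ⟨i, ⟨hi, hia⟩, hmin⟩ : ∃ i, ((∀ d < l, c (i + d) = c (p + d)) ∧ c (i + l) = a) ∧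
      ∀ j < i, ¬ ((∀ d < l, c (j + d) = c (p + d)) ∧ c (j + l) = a) :=
    ⟨_, Nat.find_spec hex, fun j hj => Nat.find_min hex hj⟩
  have him : i + l < m := by
    by_contra hm
    exact ha (hia ▸ (hc _).2 (not_lt.1 hm))
  have hlm : l ≤ m := by omega
  have hpi : p < i := by
    rcases lt_trichotomy p i with hlt | rfl | hlt
    · exact hlt
    · exact absurd hia hp
    · have := h.2 i hlt
      have h2 : l ≤ lce c m i p := le_lce hlm hi
      omega
  have hlen : prevLen c m i = l := by
    refine mu_eq hlm (fun l' hl' hcon => ?_) fun _ j hj => ?_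
    · have h1 : l ≤ lce c m p i := le_lce hlm fun d hd => (hi d hd).symm
      have h2 := hcon p hpi
      omega
    · by_contra hgt
      refine hmin j hj ⟨fun d hd => ?_, ?_⟩
      · rw [lce_eq (c := c) (m := m) (i := j) (j := i) (by omega), hi d hd]
      · rw [lce_eq (c := c) (m := m) (i := j) (j := i) (by omega), hia]
  refine ⟨i, ⟨by omega, by omega⟩, ?_, hlen, hia⟩
  refine mu_eq (by omega) (fun j hj hcon => ?_) fun _ => ?_
  · rw [hlen] at hcon
    have h1 : l ≤ lce c m j p := le_lce hlm fun d hd => by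
      rw [lce_eq (c := c) (m := m) (i := j) (j := i) (by omega), hi d hd]
    have h2 := h.2 j hj
    omega
  · rw [hlen]
    exact le_lce hlm fun d hd => (hi d hd).symm

end

/-! ### Perfect hashing -/

/-- For two keys below the prime `p`, few multipliers lead to a collision modulo `r`. -/
theorem card_collision_mul_le {p r x y : ℕ} (hp : p.Prime) (hx : x < p) (hy : y < p)
    (hxy : x ≠ y) :
    ((Finset.Ico 1 p).filter fun a => a * x % p % r = a * y % p % r).card * r ≤ 2 * (p - 1) := by
  wlog hlt : y < x generalizing x y
  · have := this hy hx hxy.symm (by omega)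
    simpa only [eq_comm] using this
  set w := x - y with hw
  have hpw : ¬ p ∣ w := Nat.not_dvd_of_pos_of_lt (by omega) (by omega)
  set Z := (Finset.Ioc 0 (p - 1)).filter fun z => r ∣ z with hZ
  have hZc : Z.card = (p - 1) / r := Nat.Ioc_filter_dvd_card_eq_div _ _
  have hmaps : ∀ a ∈ (Finset.Ico 1 p).filter (fun a => a * x % p % r = a * y % p % r),
      a * w % p ∈ Z ∪ Z.image fun z => p - z := by
    intro a ha
    simp only [Finset.mem_filter, Finset.mem_Ico] at ha
    obtain ⟨⟨ha1, hap⟩, hcol⟩ := ha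
    have hz0 : a * w % p ≠ 0 := fun h => by
      rcases (Nat.Prime.dvd_mul hp).1 (Nat.dvd_of_mod_eq_zero h) with h | h
      · exact Nat.not_dvd_of_pos_of_lt (by omega) hap h
      · exact hpw h
    have hzp := Nat.mod_lt (a * w) hp.pos
    have hxp := Nat.mod_lt (a * x) hp.pos
    have hyp := Nat.mod_lt (a * y) hp.pos
    have hsum : (a * y % p + a * w % p) % p = a * x % p := by
      rw [← Nat.add_mod, ← mul_add]; congr 2; omega
    have hmod : a * x % p ≡ a * y % p [MOD r] := hcol
    simp only [hZ, Finset.mem_union, Finset.mem_image, Finset.mem_filter, Finset.mem_Ioc]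
    rcases Nat.lt_or_ge (a * y % p + a * w % p) p with h | h
    · left
      rw [Nat.mod_eq_of_lt h] at hsum
      refine ⟨⟨by omega, by omega⟩, ?_⟩
      have := (Nat.modEq_iff_dvd' (by omega)).1 hmod.symm
      rwa [show a * x % p - a * y % p = a * w % p by omega] at this
    · right
      rw [Nat.mod_eq_sub_mod h, Nat.mod_eq_of_lt (by omega)] at hsum
      refine ⟨p - a * w % p, ⟨⟨by omega, by omega⟩, ?_⟩, by omega⟩
      have := (Nat.modEq_iff_dvd' (by omega)).1 hmod
      rwa [show a * y % p - a * x % p = p - a * w % p by omega] at this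
  have hinj : Set.InjOn (fun a => a * w % p)
      ((Finset.Ico 1 p).filter (fun a => a * x % p % r = a * y % p % r) : Finset ℕ) := by
    intro a ha b hb hab
    simp only [Finset.coe_filter, Finset.mem_Ico, Set.mem_ofPred_eq] at ha hb
    have h1 : a * w ≡ b * w [MOD p] := hab
    have h2 : a ≡ b [MOD p] :=
      Nat.ModEq.cancel_right_of_coprime ((Nat.Prime.coprime_iff_not_dvd hp).2 hpw) h1
    have h3 : a % p = b % p := h2
    rwa [Nat.mod_eq_of_lt ha.1.2, Nat.mod_eq_of_lt hb.1.2] at h3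
  have hcard := Finset.card_le_card_of_injOn _ hmaps hinj
  have h2 := (Finset.card_union_le Z (Z.image fun z => p - z)).trans
    (Nat.add_le_add_left Finset.card_image_le _)
  have h3 := Nat.div_mul_le_self (p - 1) r
  rw [hZc] at h2
  nlinarith

/-- Some multiplier leads to few collisions. -/
theorem exists_few_collisions {p : ℕ} (hp : p.Prime) (r : ℕ) (S : Finset ℕ) (key : ℕ → ℕ)
    (hkey : ∀ i ∈ S, key i < p) (hinj : Set.InjOn key S) :
    ∃ a < p, (S.offDiag.filter fun x => a * key x.1 % p % r = a * key x.2 % p % r).card * r ≤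
      2 * S.offDiag.card := by
  have hp1 := hp.one_lt
  have hne : (Finset.Ico 1 p).Nonempty := ⟨1, by simp [hp1]⟩
  have hsum : ∑ a ∈ Finset.Ico 1 p,
      (S.offDiag.filter fun x => a * key x.1 % p % r = a * key x.2 % p % r).card * r ≤
      ∑ a ∈ Finset.Ico 1 p, 2 * S.offDiag.card := by
    rw [← Finset.sum_mul]
    have hswap : ∑ a ∈ Finset.Ico 1 p,
        (S.offDiag.filter fun x => a * key x.1 % p % r = a * key x.2 % p % r).card =
        ∑ x ∈ S.offDiag,
          ((Finset.Ico 1 p).filter fun a => a * key x.1 % p % r = a * key x.2 % p % r).card := by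
      simp only [Finset.card_filter]
      exact Finset.sum_comm
    rw [hswap, Finset.sum_mul]
    calc _ ≤ ∑ x ∈ S.offDiag, 2 * (p - 1) := by
          refine Finset.sum_le_sum fun x hx => ?_
          obtain ⟨h1, h2, h3⟩ := Finset.mem_offDiag.1 hx
          exact card_collision_mul_le hp (hkey _ h1) (hkey _ h2) fun h => h3 (hinj h1 h2 h)
      _ = _ := by simp; ring
  obtain ⟨a, ha, hle⟩ := Finset.exists_le_of_sum_le hne hsum
  exact ⟨a, (Finset.mem_Ico.1 ha).2, hle⟩

/-- The hash function with the index `t`, which encodes a multiplier and a modulus less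
than `U`. -/
def hash (U t x : ℕ) : ℕ := t / U * x % (t % U)

/-- There is a prime between `X` and `2 * X`, so some index less than `U ^ 2`, where `U = 2 * X + 2`,
encodes a multiplier and a prime with few collisions. -/
theorem exists_hash {X : ℕ} (hX : 0 < X) (r : ℕ) (S : Finset ℕ) (key : ℕ → ℕ)
    (hkey : ∀ i ∈ S, key i < X) (hinj : Set.InjOn key S) :
    ∃ t < (2 * X + 2) * (2 * X + 2),
      (S.offDiag.filter fun x =>
        hash (2 * X + 2) t (key x.1) % r = hash (2 * X + 2) t (key x.2) % r).card * r ≤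
      2 * S.offDiag.card := by
  obtain ⟨p, hp, hlt, hle⟩ := Nat.exists_prime_lt_and_le_two_mul X hX.ne'
  obtain ⟨a, ha, h⟩ := exists_few_collisions hp r S key (fun i hi => (hkey i hi).trans hlt) hinj
  have hpU : p < 2 * X + 2 := by omega
  refine ⟨a * (2 * X + 2) + p, ?_, ?_⟩
  · have : (a + 1) * (2 * X + 2) ≤ (2 * X + 2) * (2 * X + 2) := Nat.mul_le_mul_right _ (by omega)
    rw [add_mul] at this
    omega
  · have h1 : (a * (2 * X + 2) + p) / (2 * X + 2) = a := by
      rw [mul_comm, Nat.mul_add_div (by omega), Nat.div_eq_of_lt hpU, add_zero]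
    have h2 : (a * (2 * X + 2) + p) % (2 * X + 2) = p := by
      rw [mul_comm, Nat.mul_add_mod, Nat.mod_eq_of_lt hpU]
    simpa only [hash, h1, h2] using h

/-- Data of a two-level hash table for the keys `key i` of the indices `i < m` with `V i`: keys are
distributed over `m` buckets by the hash function `t`; bucket `b` is given twice the square of its
size many cells, in which its keys are placed by the hash function `u b`. -/
structure HashData (m U : ℕ) (V : ℕ → Prop) (key : ℕ → ℕ) where
  t : ℕ
  size : ℕ → ℕ
  off : ℕ → ℕ
  u : ℕ → ℕ

namespace HashData

variable {m U : ℕ} {V : ℕ → Prop} {key : ℕ → ℕ}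

/-- The bucket of a key. -/
def bucket (D : HashData m U V key) (x : ℕ) : ℕ := hash U D.t x % m

/-- The cell of a key. -/
def slot (D : HashData m U V key) (x : ℕ) : ℕ :=
  D.off (D.bucket x) + hash U (D.u (D.bucket x)) x % D.size (D.bucket x)

end HashData

open Classical in
/-- The hash table that is found by trying all the hash functions. -/
noncomputable def hashData (m U : ℕ) (V : ℕ → Prop) (key : ℕ → ℕ) : HashData m U V key :=
  let t := mu (U * U) fun t => (∑ i ∈ Finset.range m, ∑ j ∈ Finset.range m,
    if V i ∧ V j ∧ hash U t (key i) % m = hash U t (key j) % m then 1 else 0) ≤ 3 * m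
  let cnt := fun b => ∑ i ∈ Finset.range m, if V i ∧ hash U t (key i) % m = b then 1 else 0
  let size := fun b => 2 * (cnt b * cnt b)
  { t := t
    size := size
    off := fun b => ∑ x ∈ Finset.range b, size x
    u := fun b => mu (U * U) fun u => ∀ i < m, ∀ j < m, V i ∧ hash U t (key i) % m = b →
      V j ∧ hash U t (key j) % m = b → i ≠ j →
      hash U u (key i) % size b ≠ hash U u (key j) % size b }

section

variable {m U X : ℕ} {V : ℕ → Prop} {key : ℕ → ℕ}

/-- The table has linear size and no collisions. -/
theorem hashData_spec (hm : 0 < m) (hX : 0 < X) (hU : U = 2 * X + 2) (hkey : ∀ i < m, V i → key i < X)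
    (hinj : ∀ i < m, ∀ j < m, V i → V j → key i = key j → i = j) :
    (∀ i < m, V i → (hashData m U V key).slot (key i) < 6 * m) ∧
    (∀ i < m, ∀ j < m, V i → V j →
      (hashData m U V key).slot (key i) = (hashData m U V key).slot (key j) → i = j) := by
  classical
  set D := hashData m U V key with hD
  set S := (Finset.range m).filter V with hS
  have memS : ∀ i, i ∈ S ↔ i < m ∧ V i := fun i => by simp [hS]
  have hinjS : Set.InjOn key S := fun i hi j hj h =>
    hinj i ((memS i).1 hi).1 j ((memS j).1 hj).1 ((memS i).1 hi).2 ((memS j).1 hj).2 h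
  have hSm : S.card ≤ m := (Finset.card_filter_le _ _).trans (by simp)
  set B : ℕ → ℕ := fun i => hash U D.t (key i) % m with hB
  have hBm : ∀ i, B i < m := fun i => Nat.mod_lt _ hm
  set Sb : ℕ → Finset ℕ := fun b => S.filter fun i => B i = b with hSb
  -- the sizes of the buckets
  have hsize : ∀ b, D.size b = 2 * ((Sb b).card * (Sb b).card) := by
    intro b
    have : (Sb b).card = ∑ i ∈ Finset.range m, if V i ∧ B i = b then 1 else 0 := by
      rw [← Finset.card_filter, ← Finset.filter_filter]
    rw [this]
    rfl
  -- the first level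
  have hpairs : ∀ t, (∑ i ∈ Finset.range m, ∑ j ∈ Finset.range m,
      if V i ∧ V j ∧ hash U t (key i) % m = hash U t (key j) % m then 1 else 0) =
      ((S ×ˢ S).filter fun x =>
        hash U t (key x.1) % m = hash U t (key x.2) % m).card := by
    intro t
    rw [Finset.card_filter, Finset.sum_product, hS, Finset.sum_filter]
    refine Finset.sum_congr rfl fun i _ => ?_
    rw [Finset.sum_filter]
    by_cases hi : V i
    · simp only [hi, true_and, if_true]
      refine Finset.sum_congr rfl fun j _ => ?_
      by_cases hj : V j <;> simp [hj]
    · simp [hi]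
  have hlevel : ((S ×ˢ S).filter fun x => B x.1 = B x.2).card ≤ 3 * m := by
    rw [hB, ← hpairs]
    obtain ⟨t, ht, hle⟩ := exists_hash hX m S key
      (fun i hi => hkey i ((memS i).1 hi).1 ((memS i).1 hi).2) hinjS
    rw [← hU] at ht hle
    refine (mu_spec (U * U) fun t => (∑ i ∈ Finset.range m, ∑ j ∈ Finset.range m,
      if V i ∧ V j ∧ hash U t (key i) % m = hash U t (key j) % m then 1 else 0) ≤ 3 * m).2.2
      (mu_lt ht ?_)
    rw [hpairs, ← Finset.diag_union_offDiag, Finset.filter_union]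
    refine (Finset.card_union_le _ _).trans ?_
    have h1 := Finset.card_filter_le S.diag fun x =>
      hash U t (key x.1) % m = hash U t (key x.2) % m
    rw [Finset.diag_card] at h1
    have h2 : (S.offDiag.filter fun x =>
        hash U t (key x.1) % m = hash U t (key x.2) % m).card ≤ 2 * m := by
      rw [Finset.offDiag_card] at hle
      have h3 : 2 * (S.card * S.card - S.card) ≤ 2 * m * m := by
        have : S.card * S.card ≤ m * m := Nat.mul_le_mul hSm hSm
        have h4 : 2 * m * m = 2 * (m * m) := by ring
        omega
      exact Nat.le_of_mul_le_mul_right (hle.trans h3) hm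
    omega
  have htotal : ∑ b ∈ Finset.range m, D.size b ≤ 6 * m := by
    have h1 : ((S ×ˢ S).filter fun x => B x.1 = B x.2).card =
        ∑ b ∈ Finset.range m, (Sb b).card * (Sb b).card := by
      rw [Finset.card_eq_sum_card_fiberwise (f := fun x => B x.1) (t := Finset.range m)
        (fun x _ => by simpa using hBm x.1)]
      refine Finset.sum_congr rfl fun b _ => ?_
      rw [← Finset.card_product]
      congr 1
      ext x
      simp only [hSb, Finset.mem_filter, Finset.mem_product]
      constructor
      · rintro ⟨⟨⟨h1, h2⟩, h3⟩, h4⟩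
        exact ⟨⟨h1, h4⟩, h2, by rw [← h3, h4]⟩
      · rintro ⟨⟨h1, h2⟩, h3, h4⟩
        exact ⟨⟨⟨h1, h3⟩, by rw [h2, h4]⟩, h2⟩
    simp only [hsize]
    rw [← Finset.mul_sum, ← h1]
    omega
  -- the second level
  have hsecond : ∀ i j, i ∈ S → j ∈ S → B i = B j → i ≠ j →
      hash U (D.u (B i)) (key i) % D.size (B i) ≠ hash U (D.u (B i)) (key j) % D.size (B i) := by
    intro i j hi hj hij hne
    set b := B i with hb
    have hiS : i ∈ Sb b := Finset.mem_filter.2 ⟨hi, rfl⟩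
    have hpos : 0 < (Sb b).card := Finset.card_pos.2 ⟨i, hiS⟩
    obtain ⟨u, hu, hle⟩ := exists_hash hX (D.size b) (Sb b) key
      (fun i hi => by
        have := (memS i).1 (Finset.mem_filter.1 hi).1
        exact hkey i this.1 this.2)
      (hinjS.mono fun i hi => (Finset.mem_filter.1 hi).1)
    rw [← hU] at hu hle
    have hzero : ((Sb b).offDiag.filter fun x =>
        hash U u (key x.1) % D.size b = hash U u (key x.2) % D.size b).card = 0 := by
      by_contra h0
      have h1 : D.size b ≤ 2 * (Sb b).offDiag.card :=
        (Nat.le_mul_of_pos_left _ (Nat.pos_of_ne_zero h0)).trans hle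
      rw [Finset.offDiag_card, hsize] at h1
      have : (Sb b).card ≤ (Sb b).card * (Sb b).card := Nat.le_mul_of_pos_left _ hpos
      omega
    have hφ : ∀ i < m, ∀ j < m, V i ∧ B i = b → V j ∧ B j = b → i ≠ j →
        hash U u (key i) % D.size b ≠ hash U u (key j) % D.size b := by
      intro i hi j hj h1 h2 hne heq
      rw [Finset.card_eq_zero] at hzero
      have : (i, j) ∈ (Sb b).offDiag.filter fun x =>
          hash U u (key x.1) % D.size b = hash U u (key x.2) % D.size b := by
        simp only [Finset.mem_filter, Finset.mem_offDiag, hSb, memS]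
        exact ⟨⟨⟨⟨hi, h1.1⟩, h1.2⟩, ⟨⟨hj, h2.1⟩, h2.2⟩, hne⟩, heq⟩
      rw [hzero] at this
      simp at this
    have := (mu_spec (U * U) fun u => ∀ i < m, ∀ j < m, V i ∧ B i = b → V j ∧ B j = b → i ≠ j →
        hash U u (key i) % D.size b ≠ hash U u (key j) % D.size b).2.2 (mu_lt hu hφ)
    exact this i ((memS i).1 hi).1 j ((memS j).1 hj).1 ⟨((memS i).1 hi).2, rfl⟩
      ⟨((memS j).1 hj).2, hij.symm⟩ hne
  -- the place of a key within the table
  have hoff : ∀ b, D.off b = ∑ x ∈ Finset.range b, D.size x := fun b => rfl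
  have hslot : ∀ i, D.slot (key i) = D.off (B i) + hash U (D.u (B i)) (key i) % D.size (B i) :=
    fun i => rfl
  have hrange : ∀ i ∈ S, D.off (B i) ≤ D.slot (key i) ∧ D.slot (key i) < D.off (B i + 1) := by
    intro i hi
    have hpos : 0 < (Sb (B i)).card := Finset.card_pos.2 ⟨i, Finset.mem_filter.2 ⟨hi, rfl⟩⟩
    have hs : 0 < D.size (B i) := by rw [hsize]; positivity
    have := Nat.mod_lt (hash U (D.u (B i)) (key i)) hs
    rw [hslot, hoff (B i + 1), Finset.sum_range_succ, ← hoff]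
    omega
  have hmono : ∀ {a b}, a ≤ b → D.off a ≤ D.off b := fun h =>
    Finset.sum_le_sum_of_subset (Finset.range_mono h)
  refine ⟨fun i hi hV => ?_, fun i hi j hj hVi hVj heq => ?_⟩
  · exact ((hrange i ((memS i).2 ⟨hi, hV⟩)).2.trans_le (hmono (hBm i))).trans_le htotal
  · have hiS := (memS i).2 ⟨hi, hVi⟩
    have hjS := (memS j).2 ⟨hj, hVj⟩
    have hbb : B i = B j := by
      have h1 := hrange i hiS
      have h2 := hrange j hjS
      rcases lt_trichotomy (B i) (B j) with h | h | h
      · have := hmono (a := B i + 1) (b := B j) h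
        omega
      · exact h
      · have := hmono (a := B j + 1) (b := B i) h
        omega
    by_contra hne
    refine hsecond i j hiS hjS hbb hne ?_
    rw [hslot, hslot, ← hbb] at heq
    omega

end

end MultiStream

namespace MultiStream

/-! ### Texts as sequences of factors of the pattern -/

/-- A closed piece of a text: the factor of the pattern of length `len` at `pos`, followed by the
symbol `sym`. -/
structure Piece where
  pos : ℕ
  len : ℕ
  sym : ℕ

/-- The factor of `c` of length `l` at `p`, in reverse. -/
def revFactor (c : ℕ → ℕ) (p l : ℕ) : List ℕ := (List.range l).map fun e => c (p + l - 1 - e)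

/-- The reverse of the text that consists of the given pieces, the newest piece coming first. -/
def revText (c : ℕ → ℕ) (ps : List Piece) : List ℕ :=
  ps.flatMap fun b => b.sym :: revFactor c b.pos b.len

/-- The text of a piece is not a factor of `c`, but its proper prefixes are. -/
structure Piece.Maximal (c : ℕ → ℕ) (m : ℕ) (b : Piece) : Prop where
  sym_ne : b.sym ≠ 0
  le : b.pos + b.len ≤ m
  not_factor : ∀ i, (∀ d < b.len, c (i + d) = c (b.pos + d)) → c (i + b.len) ≠ b.sym

section

variable {c : ℕ → ℕ} {m : ℕ}

@[simp] theorem length_revFactor (p l : ℕ) : (revFactor c p l).length = l := by simp [revFactor]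

theorem revFactor_getElem? {p l e : ℕ} (h : e < l) :
    (revFactor c p l)[e]? = some (c (p + l - 1 - e)) := by
  simp [revFactor, h]

theorem revFactor_succ (p l : ℕ) : revFactor c p (l + 1) = c (p + l) :: revFactor c p l := by
  unfold revFactor
  rw [List.range_succ_eq_map]
  simp only [List.map_cons, List.map_map, Nat.sub_zero, List.cons.injEq]
  refine ⟨by congr 1, List.map_congr_left fun e _ => ?_⟩
  simp only [Function.comp]
  congr 1
  omega

theorem revFactor_congr {p p' l : ℕ} (h : ∀ d < l, c (p + d) = c (p' + d)) :
    revFactor c p l = revFactor c p' l := by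
  unfold revFactor
  refine List.map_congr_left fun e he => ?_
  have hl := List.mem_range.1 he
  rw [show p + l - 1 - e = p + (l - 1 - e) by omega, show p' + l - 1 - e = p' + (l - 1 - e) by omega]
  exact h _ (by omega)

/-- The reverse text `R` is divided into the open piece of length `l` at `p`, given by its first
occurrence, and the closed pieces `ps`. -/
structure Divided (c : ℕ → ℕ) (m : ℕ) (R : List ℕ) (ps : List Piece) (p l : ℕ) : Prop where
  eq : R = revFactor c p l ++ revText c ps
  first : IsFirst c m p l
  maximal : ∀ b ∈ ps, b.Maximal c m

theorem Divided.nil : Divided c m [] [] 0 0 :=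
  ⟨by simp [revFactor, revText], IsFirst.zero, by simp⟩

theorem Divided.extend (hc : Sentinel c m) {R : List ℕ} {ps : List Piece} {p l a : ℕ}
    (h : Divided c m R ps p l) (ha : a ≠ 0) (hp : c (p + l) = a) :
    Divided c m (a :: R) ps p (l + 1) :=
  ⟨by rw [h.eq, revFactor_succ, hp]; rfl, h.first.succ hc (hp ▸ ha), h.maximal⟩

/-- The open piece, extended by the arrived symbol, is still a factor, with a later first occurrence. -/
theorem Divided.branch {R : List ℕ} {ps : List Piece} {p l a i : ℕ}
    (h : Divided c m R ps p l) (hi : IsBranch c m i) (hp : prevPos c m i = p)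
    (hl : prevLen c m i = l) (hia : c (i + l) = a) : Divided c m (a :: R) ps i (l + 1) := by
  refine ⟨?_, hl ▸ hi.isFirst, h.maximal⟩
  rw [h.eq, revFactor_succ, hia, revFactor_congr (p := p) (p' := i) fun d hd => ?_]
  · rfl
  · rw [← hp]
    exact lce_eq (hd.trans_le (hl ▸ hi.prevPos_spec.2))

/-- The open piece is closed by a symbol with which it is not a factor of the pattern. -/
theorem Divided.close (hc : Sentinel c m) {R : List ℕ} {ps : List Piece} {p l a : ℕ}
    (h : Divided c m R ps p l) (ha : a ≠ 0) (hp : c (p + l) ≠ a)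
    (hno : ¬ ∃ i, IsBranch c m i ∧ prevPos c m i = p ∧ prevLen c m i = l ∧ c (i + l) = a) :
    Divided c m (a :: R) (⟨p, l, a⟩ :: ps) 0 0 := by
  refine ⟨by rw [h.eq]; simp [revText, revFactor], IsFirst.zero, fun b hb => ?_⟩
  rcases List.mem_cons.1 hb with rfl | hb
  · exact ⟨ha, h.first.1, fun i hi hia => hno (h.first.exists_branch hc ha hp hi hia)⟩
  · exact h.maximal b hb

/-! ### Counting mismatches -/

/-- `1` if place `t` of the pattern, aligned with the end of the text, is a mismatch. -/
def mis (c : ℕ → ℕ) (m : ℕ) (R : List ℕ) (t : ℕ) : ℕ :=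
  if R[m - 1 - t]? = some (c t) then 0 else 1

/-- Total number of mismatches at the places from `x` on. -/
def misFrom (c : ℕ → ℕ) (m : ℕ) (R : List ℕ) (x : ℕ) : ℕ := ∑ t ∈ Finset.Ico x m, mis c m R t

/-- The state of the comparison of the pattern with the end of the text, from right to left. The
pieces before `j` have been considered, they cover the places from `x` on; the places from `y`
to `y + rem`, which face the factor of the pattern at `a`, have not been compared yet; `cnt`
mismatches have been found. -/
structure Comparing (c : ℕ → ℕ) (m k : ℕ) (R : List ℕ) (ps : List Piece)
    (x y a rem j cnt : ℕ) : Prop where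
  x_le : x ≤ y
  y_le : y + rem ≤ m
  a_le : a + rem ≤ m
  face : ∀ e < rem, R[m - 1 - (y + e)]? = some (c (a + e))
  count : cnt + ∑ t ∈ Finset.Ico y (y + rem), mis c m R t = misFrom c m R x
  rest : 0 < x → R.drop (m - x) = revText c (ps.drop j) ∧ j ≤ misFrom c m R x
  len_le : m - x ≤ R.length
  j_le : j ≤ k + 1

theorem misFrom_anti (R : List ℕ) {x x' : ℕ} (h : x ≤ x') : misFrom c m R x' ≤ misFrom c m R x :=
  Finset.sum_le_sum_of_subset (Finset.Ico_subset_Ico_left h)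

theorem misFrom_le (R : List ℕ) (x : ℕ) : misFrom c m R x ≤ m := by
  unfold misFrom
  refine (Finset.sum_le_card_nsmul _ _ 1 fun t _ => ?_).trans (by simp)
  unfold mis; split <;> omega

theorem Comparing.cnt_le {k : ℕ} {R : List ℕ} {ps : List Piece} {x y a rem j cnt : ℕ}
    (h : Comparing c m k R ps x y a rem j cnt) : cnt ≤ misFrom c m R x := by
  have := h.count; omega

theorem Divided.comparing {R : List ℕ} {ps : List Piece} {p l : ℕ} (h : Divided c m R ps p l)
    (k : ℕ) : Comparing c m k R ps (m - l) (m - l) p l 0 0 := by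
  have hl : l ≤ m := by have := h.first.1; omega
  refine ⟨le_rfl, by omega, h.first.1, fun e he => ?_, ?_, fun _ => ⟨?_, Nat.zero_le _⟩, ?_, by omega⟩
  · rw [h.eq, List.getElem?_append_left (by simp; omega), revFactor_getElem? (by omega)]
    congr 2
    omega
  · rw [Nat.sub_add_cancel hl, zero_add]; rfl
  · rw [show m - (m - l) = l by omega, h.eq, List.drop_left' (by simp)]; simp
  · rw [h.eq]; simp; omega

/-- The rest of the factor matches the pattern. -/
theorem Comparing.agree {k : ℕ} {R : List ℕ} {ps : List Piece} {x y a rem j cnt : ℕ}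
    (h : Comparing c m k R ps x y a rem j cnt) (hd : rem ≤ lce c m a y) :
    Comparing c m k R ps x y a 0 j cnt := by
  refine ⟨h.x_le, by have := h.y_le; omega, by have := h.a_le; omega, by simp, ?_, h.rest,
    h.len_le, h.j_le⟩
  rw [← h.count, add_zero, Finset.Ico_self, Finset.sum_empty, Finset.sum_eq_zero]
  intro t ht
  obtain ⟨e, rfl⟩ := Nat.exists_eq_add_of_le (Finset.mem_Ico.1 ht).1
  have he : e < rem := by have := (Finset.mem_Ico.1 ht).2; omega
  rw [mis, if_pos]
  rw [h.face e he, lce_eq (c := c) (m := m) (he.trans_le hd)]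

/-- The next mismatch is found by a longest common extension. -/
theorem Comparing.differ {k : ℕ} {R : List ℕ} {ps : List Piece} {x y a rem j cnt d : ℕ}
    (h : Comparing c m k R ps x y a rem j cnt) (hl : lce c m a y = d) (hd : d < rem) :
    Comparing c m k R ps x (y + d + 1) (a + d + 1) (rem - (d + 1)) j (cnt + 1) := by
  have h1 := h.x_le
  have h2 := h.y_le
  have h3 := h.a_le
  refine ⟨by omega, by omega, by omega, fun e he => ?_, ?_, h.rest, h.len_le, h.j_le⟩
  · rw [show y + d + 1 + e = y + (d + 1 + e) by omega, h.face _ (by omega)]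
    congr 2
    omega
  · have h0 : ∑ t ∈ Finset.Ico y (y + d), mis c m R t = 0 := by
      refine Finset.sum_eq_zero fun t ht => ?_
      obtain ⟨e, rfl⟩ := Nat.exists_eq_add_of_le (Finset.mem_Ico.1 ht).1
      have he : e < d := by have := (Finset.mem_Ico.1 ht).2; omega
      rw [mis, if_pos]
      rw [h.face e (by omega), lce_eq (c := c) (m := m) (i := a) (j := y) (by omega)]
    have hone : mis c m R (y + d) = 1 := by
      rw [mis, if_neg]
      rw [h.face d hd, Option.some_inj]
      have := lce_ne (c := c) (m := m) (i := a) (j := y) (by omega)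
      rwa [hl] at this
    rw [show y + d + 1 + (rem - (d + 1)) = y + rem by omega, ← h.count,
      ← Finset.sum_Ico_consecutive _ (show y ≤ y + d by omega) (show y + d ≤ y + rem by omega),
      Finset.sum_eq_sum_Ico_succ_bot (show y + d < y + rem by omega)]
    omega

/-- The comparison goes on with the next closed piece. If the piece lies within the pattern completely,
it contributes a mismatch, since it is not a factor. -/
theorem Comparing.load {k : ℕ} {R : List ℕ} {ps : List Piece} {x y a j cnt : ℕ} {b : Piece}
    (hps : ∀ b ∈ ps, b.Maximal c m)
    (h : Comparing c m k R ps x y a 0 j cnt) (hx : 0 < x) (hj : j ≤ k) (hb : ps[j]? = some b) :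
    Comparing c m k R ps (x - 1 - min b.len (x - 1)) (x - 1 - min b.len (x - 1))
      (b.pos + (b.len - min b.len (x - 1))) (min b.len (x - 1)) (j + 1)
      (cnt + if c (x - 1) = b.sym then 0 else 1) := by
  have hxm : x ≤ m := by have := h.x_le; have := h.y_le; omega
  have hlen := h.len_le
  obtain ⟨hrest, hjm⟩ := h.rest hx
  have hbm := hps b (List.mem_of_getElem? hb)
  have hdrop : ps.drop j = b :: ps.drop (j + 1) := by
    obtain ⟨hjl, rfl⟩ := List.getElem?_eq_some_iff.1 hb
    exact List.drop_eq_getElem_cons hjl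
  have hR : R.drop (m - x) = b.sym :: (revFactor c b.pos b.len ++ revText c (ps.drop (j + 1))) := by
    rw [hrest, hdrop]; simp [revText]
  have hsym : R[m - 1 - (x - 1)]? = some b.sym := by
    have := List.getElem?_drop (xs := R) (i := m - x) (j := 0)
    rw [hR] at this
    simpa [show m - 1 - (x - 1) = m - x by omega] using this.symm
  have hmem : ∀ e, e < b.len → R[m - x + 1 + e]? = some (c (b.pos + b.len - 1 - e)) := by
    intro e he
    have := List.getElem?_drop (xs := R) (i := m - x) (j := e + 1)
    rw [hR, List.getElem?_cons_succ, List.getElem?_append_left (by simpa),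
      revFactor_getElem? he] at this
    rw [this]
    congr 1
    omega
  have hRlen : m - x + 1 + b.len ≤ R.length := by
    have := congrArg List.length hR
    simp at this
    omega
  have hcount := h.count
  simp only [add_zero, Finset.Ico_self, Finset.sum_empty] at hcount
  set l := min b.len (x - 1) with hl
  have hl1 : l ≤ b.len := min_le_left _ _
  have hl2 : l ≤ x - 1 := min_le_right _ _
  have hmis : mis c m R (x - 1) = if c (x - 1) = b.sym then 0 else 1 := by
    rw [mis, hsym]
    simp only [Option.some_inj, eq_comm]
  have hface : ∀ e < l, R[m - 1 - (x - 1 - l + e)]? = some (c (b.pos + (b.len - l) + e)) := by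
    intro e he
    rw [show m - 1 - (x - 1 - l + e) = m - x + 1 + (l - 1 - e) by omega, hmem _ (by omega)]
    congr 2
    omega
  have hsplit : misFrom c m R (x - 1 - l) = ∑ t ∈ Finset.Ico (x - 1 - l) (x - 1), mis c m R t +
      (mis c m R (x - 1) + misFrom c m R x) := by
    unfold misFrom
    rw [← Finset.sum_Ico_consecutive _ (show x - 1 - l ≤ x - 1 by omega) (show x - 1 ≤ m by omega),
      Finset.sum_eq_sum_Ico_succ_bot (show x - 1 < m by omega), Nat.sub_add_cancel hx]
  have hble := hbm.le
  refine ⟨le_rfl, by omega, by omega, hface, ?_, fun hx' => ?_, by omega, by omega⟩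
  · rw [hsplit, hmis, ← hcount, show x - 1 - l + l = x - 1 by omega]
    omega
  · have hlb : l = b.len := by omega
    refine ⟨?_, ?_⟩
    · rw [show m - (x - 1 - l) = (m - x) + (1 + b.len) by omega, ← List.drop_drop, hR,
        Nat.add_comm 1, List.drop_succ_cons, List.drop_left' (by simp)]
    · -- a whole piece is not a factor of the pattern, so it causes a mismatch
      have : 1 ≤ ∑ t ∈ Finset.Ico (x - 1 - l) (x - 1), mis c m R t + mis c m R (x - 1) := by
        by_contra hlt
        have h0 : ∑ t ∈ Finset.Ico (x - 1 - l) (x - 1), mis c m R t = 0 := by omega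
        rw [Finset.sum_eq_zero_iff] at h0
        have h1 : mis c m R (x - 1) = 0 := by omega
        rw [hmis] at h1
        refine hbm.not_factor (x - 1 - l) (fun d hd => ?_) ?_
        · have h2 := h0 (x - 1 - l + d) (Finset.mem_Ico.2 ⟨by omega, by omega⟩)
          rw [mis, hface d (by omega)] at h2
          have h3 : c (b.pos + (b.len - l) + d) = c (x - 1 - l + d) := by
            by_contra hne
            rw [if_neg (by simpa using hne)] at h2
            omega
          rw [← h3, hlb, Nat.sub_self, add_zero]
        · rw [← hlb, Nat.sub_add_cancel hl2]
          by_contra hne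
          rw [if_neg hne] at h1
          omega
      omega

/-- The comparison cannot go on. -/
def Stuck (k : ℕ) (ps : List Piece) (x rem j : ℕ) : Prop :=
  rem = 0 ∧ (x = 0 ∨ j = k + 1 ∨ ps[j]? = none)

/-- The report can be read off when the comparison cannot go on, and also when more than `k`
mismatches have been found. -/
theorem Comparing.report {k : ℕ} {R : List ℕ} {ps : List Piece} {x y a rem j cnt : ℕ}
    (h : Comparing c m k R ps x y a rem j cnt) (hend : Stuck k ps x rem j ∨ k < cnt) :
    (if x = 0 ∧ rem = 0 ∧ cnt ≤ k then cnt else k + 1) =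
      if m ≤ R.length ∧ misFrom c m R 0 ≤ k then misFrom c m R 0 else k + 1 := by
  have h1 := h.cnt_le
  have h2 := misFrom_anti (c := c) (m := m) R (Nat.zero_le x)
  have h3 := h.count
  have h4 := h.len_le
  rcases lt_or_ge k cnt with hk | hk
  · rw [if_neg (by omega), if_neg (by omega)]
  obtain ⟨rfl, hx⟩ := hend.resolve_right (by omega)
  simp only [add_zero, Finset.Ico_self, Finset.sum_empty] at h3
  rcases Nat.eq_zero_or_pos x with rfl | hpos
  · rw [if_pos ⟨rfl, rfl, hk⟩, if_pos ⟨by omega, by omega⟩, h3]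
  rw [if_neg (by omega), if_neg]
  rintro ⟨hm, hle⟩
  obtain ⟨hrest, hj⟩ := h.rest hpos
  rcases hx with rfl | rfl | hx
  · omega
  · omega
  · rw [List.drop_eq_nil_of_le (List.getElem?_eq_none_iff.1 hx)] at hrest
    have := congrArg List.length hrest
    simp [revText] at this
    have hxm : x ≤ m := by have := h.x_le; have := h.y_le; omega
    omega

end

end MultiStream

namespace MultiStream

/-! ### Expressions for quantifiers and bounded search -/

namespace Ex

instance : Add Ex := ⟨op .add⟩
instance : Sub Ex := ⟨op .sub⟩
instance : Mul Ex := ⟨op .mul⟩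
instance : Div Ex := ⟨op .div⟩
instance : Mod Ex := ⟨op .mod⟩

-- A value other than `0` counts as true; the connectives and comparisons follow this convention.
def notE (a : Ex) : Ex := op .eq a (cst 0)
def andE (a b : Ex) : Ex := a * b
def ltE (a b : Ex) : Ex := op .lt a b
def eqE (a b : Ex) : Ex := op .eq a b
def leE (a b : Ex) : Ex := notE (ltE b a)
def neE (a b : Ex) : Ex := notE (eqE a b)

/-- For all `x < n`: `b`. -/
def allE (x : ℕ) (n b : Ex) : Ex := notE (sum x n (notE b))

/-- The least `x < n` with `b`, and `n` if there is none. It is computed as the number of `x` such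
that all the numbers up to `x` violate `b`. -/
def muE (x : ℕ) (n b : Ex) : Ex := sum x n (allE x (var x + cst 1) (notE b))

/-- The expression has a value other than `0`. -/
def Holds (e : Ex) (A : Fin 32 → ℕ → ℕ) (ε : ℕ → ℕ) : Prop := e.eval A ε ≠ 0

section

variable (A : Fin 32 → ℕ → ℕ) (ε : ℕ → ℕ) (a b e n : Ex) (x : ℕ)

@[simp] theorem eval_var : (var x).eval A ε = ε x := rfl
@[simp] theorem eval_cst (i : ℕ) : (cst i).eval A ε = i := rfl
@[simp] theorem eval_add : (a + b).eval A ε = a.eval A ε + b.eval A ε := rfl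
@[simp] theorem eval_sub : (a - b).eval A ε = a.eval A ε - b.eval A ε := rfl
@[simp] theorem eval_mul : (a * b).eval A ε = a.eval A ε * b.eval A ε := rfl
@[simp] theorem eval_div : (a / b).eval A ε = a.eval A ε / b.eval A ε := rfl
@[simp] theorem eval_mod : (a % b).eval A ε = a.eval A ε % b.eval A ε := rfl
@[simp] theorem eval_arr (i : Fin 32) : (arr i a).eval A ε = A i (a.eval A ε) := rfl
@[simp] theorem eval_letE :
    (letE x e b).eval A ε = b.eval A (Function.update ε x (e.eval A ε)) := rfl
@[simp] theorem eval_sum : (sum x n b).eval A ε =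
    ∑ i ∈ Finset.range (n.eval A ε), b.eval A (Function.update ε x i) := rfl

open Classical in
@[simp] theorem eval_ite :
    (ite e a b).eval A ε = if e.Holds A ε then a.eval A ε else b.eval A ε := by
  by_cases h : e.eval A ε = 0 <;> simp [eval, Holds, h]

@[simp] theorem holds_not : (notE a).Holds A ε ↔ ¬ a.Holds A ε := by
  by_cases h : a.eval A ε = 0 <;> simp [notE, Holds, eval, Op.eval, h]
@[simp] theorem holds_and : (andE a b).Holds A ε ↔ a.Holds A ε ∧ b.Holds A ε := by
  simp [andE, Holds]
@[simp] theorem holds_lt : (ltE a b).Holds A ε ↔ a.eval A ε < b.eval A ε := by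
  simp [ltE, Holds, eval, Op.eval]
@[simp] theorem holds_eq : (eqE a b).Holds A ε ↔ a.eval A ε = b.eval A ε := by
  simp [eqE, Holds, eval, Op.eval]
@[simp] theorem holds_le : (leE a b).Holds A ε ↔ a.eval A ε ≤ b.eval A ε := by simp [leE]
@[simp] theorem holds_ne : (neE a b).Holds A ε ↔ a.eval A ε ≠ b.eval A ε := by simp [neE]

theorem holds_arr (i : Fin 32) : (arr i a).Holds A ε ↔ A i (a.eval A ε) ≠ 0 := Iff.rfl

open Classical in
theorem eval_not : (notE a).eval A ε = if a.Holds A ε then 0 else 1 := by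
  by_cases h : eval A a ε = 0 <;> simp [notE, Holds, eval, Op.eval, h]

open Classical in
theorem eval_lt_op : (ltE a b).eval A ε = if a.eval A ε < b.eval A ε then 1 else 0 := by
  simp [ltE, eval, Op.eval]

@[simp] theorem holds_all : (allE x n b).Holds A ε ↔
    ∀ i < n.eval A ε, b.Holds A (Function.update ε x i) := by
  classical
  simp only [allE, holds_not]
  simp only [Holds, eval_sum, ne_eq, not_not, Finset.sum_eq_zero_iff, Finset.mem_range, eval_not]
  refine forall₂_congr fun i _ => ?_
  by_cases h : b.eval A (Function.update ε x i) = 0 <;> simp [h]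

@[simp] theorem eval_mu : (muE x n b).eval A ε =
    mu (n.eval A ε) fun i => b.Holds A (Function.update ε x i) := by
  classical
  unfold mu
  rw [Finset.card_filter]
  simp only [muE, eval_sum]
  refine Finset.sum_congr rfl fun i _ => ?_
  have h := holds_all A (Function.update ε x i) (notE b) (var x + cst 1) x
  simp only [eval_add, eval_var, Function.update_self, eval_cst, Nat.lt_succ_iff, holds_not,
    Function.update_idem] at h
  rw [allE, eval_not]
  rw [allE, holds_not] at h
  by_cases h1 : (sum x (var x + cst 1) b.notE.notE).Holds A (Function.update ε x i)
  · rw [if_pos h1, if_neg fun h2 => (h.2 h2) h1]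
  · rw [if_neg h1, if_pos (h.1 h1)]

end

/-- Array `a` does not occur in the expression. -/
def free (a : Fin 32) : Ex → Bool
  | var _ => true
  | cst _ => true
  | op _ e f => e.free a && f.free a
  | arr b i => decide (b ≠ a) && i.free a
  | ite c e f => c.free a && e.free a && f.free a
  | letE _ e f => e.free a && f.free a
  | sum _ n f => n.free a && f.free a

theorem eval_congr {a : Fin 32} {A A' : Fin 32 → ℕ → ℕ} (hA : ∀ b ≠ a, A b = A' b) (e : Ex) :
    ∀ {ε : ℕ → ℕ}, e.free a = true → e.eval A ε = e.eval A' ε := by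
  induction e with
  | var x => intro ε _; rfl
  | cst c => intro ε _; rfl
  | op o e f ihe ihf =>
    intro ε h
    simp only [free, Bool.and_eq_true] at h
    simp only [eval, ihe h.1, ihf h.2]
  | arr b i ih =>
    intro ε h
    simp only [free, Bool.and_eq_true, decide_eq_true_eq] at h
    simp only [eval, ih h.2, hA b h.1]
  | ite c e f ihc ihe ihf =>
    intro ε h
    simp only [free, Bool.and_eq_true] at h
    simp only [eval, ihc h.1.1, ihe h.1.2, ihf h.2]
  | letE x e f ihe ihf =>
    intro ε h
    simp only [free, Bool.and_eq_true] at h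
    simp only [eval, ihe h.1, ihf h.2]
  | sum x n f ihn ihf =>
    intro ε h
    simp only [free, Bool.and_eq_true] at h
    simp only [eval, ihn h.1, ihf h.2]

end Ex

/-! ### Filling an array -/

/-- Computes array `a`: cell `i` gets the value of `e` with `i` for variable `25`. -/
def St.fill (a : Fin 32) (e : Ex) : St := .loop 15 (.var 7) (.store a (.var 25) e)

theorem St.run_fill {L B : ℕ} {S : Sto} (hS : Fits L B S) (hLB : L < B) (h25 : S.v 25 = 0)
    (a : Fin 32) {e : Ex} (he : e.free a = true) (f : ℕ → ℕ)
    (hf : ∀ i < L, e.eval S.a (Function.update S.v 25 i) = f i ∧ f i < B) :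
    (St.fill a e).run L B S =
      ⟨S.v, Function.update S.a a fun i => if i < L then f i else 0⟩ := by
  have key : ∀ n ≤ L, ∀ i, (iter ((St.store a (.var 25) e).run L B) 25 S n).setV 25 i =
      ⟨Function.update S.v 25 i, Function.update S.a a fun j => if j < n then f j else S.a a j⟩ := by
    intro n
    induction n with
    | zero => intro _ i; simp [iter, Sto.setV]
    | succ n ih =>
      intro hn i
      have h1 := ih (by omega) n
      have h2 : e.eval (Function.update S.a a fun j => if j < n then f j else S.a a j)
          (Function.update S.v 25 n) = f n := by
        rw [← (hf n (by omega)).1]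
        exact Ex.eval_congr (a := a) (fun b hb => by simp [hb]) e he
      rw [iter, h1]
      simp only [run, Ex.eval_var, Function.update_self, if_pos (show n < L by omega), h2,
        Nat.mod_eq_of_lt (hf n (by omega)).2, Sto.setA, Sto.setV]
      ext1
      · simp
      · simp only [Function.update_idem]
        congr 1
        funext j
        rcases lt_trichotomy j n with hj | rfl | hj
        · simp [hj.ne, hj, show j < n + 1 by omega]
        · simp
        · simp [hj.ne', show ¬ j < n by omega, show ¬ j < n + 1 by omega]
  have h7 : S.v 7 % B = L := by rw [hS.len, Nat.mod_eq_of_lt hLB]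
  have := key L le_rfl 0
  simp only [fill, run, Ex.eval_var, h7]
  refine this.trans ?_
  ext1
  · simp only
    rw [← h25, Function.update_eq_self]
  · simp only
    congr 1
    funext j
    split
    · rfl
    · next hj => exact hS.cell_zero a j (not_lt.1 hj)

/-- Computes the binary logarithms of the numbers less than `L` in array `2`. -/
def St.logs : St := .loop 15 (.var 7)
  (.store 2 (.var 25) (.ite (.ltE (.var 25) (.cst 2)) (.cst 0) (.arr 2 (.var 25 / .cst 2) + .cst 1)))

theorem St.run_logs {L B : ℕ} {S : Sto} (hS : Fits L B S) (hLB : L < B) (h25 : S.v 25 = 0) :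
    St.logs.run L B S =
      ⟨S.v, Function.update S.a 2 fun i => if i < L then Nat.log 2 i else 0⟩ := by
  have key : ∀ n ≤ L, ∀ i, (iter ((St.store 2 (.var 25) (.ite (.ltE (.var 25) (.cst 2)) (.cst 0)
      (.arr 2 (.var 25 / .cst 2) + .cst 1))).run L B) 25 S n).setV 25 i =
      ⟨Function.update S.v 25 i,
        Function.update S.a 2 fun j => if j < n then Nat.log 2 j else S.a 2 j⟩ := by
    intro n
    induction n with
    | zero => intro _ i; simp [iter, Sto.setV]
    | succ n ih =>
      intro hn i
      have h1 := ih (by omega) n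
      have hlog : Nat.log 2 n < B := (Nat.log_le_self 2 n).trans_lt (by omega)
      have h2 : (if n < 2 then 0 else (if n / 2 < n then Nat.log 2 (n / 2) else
          S.a 2 (n / 2)) + 1) = Nat.log 2 n := by
        split
        · next h => exact (Nat.log_of_lt h).symm
        · next h =>
          rw [if_pos (by omega), ← Nat.log_of_one_lt_of_le (b := 2) (by omega) (by omega)]
      rw [iter, h1]
      simp only [run, Ex.eval_var, Function.update_self, if_pos (show n < L by omega),
        Ex.eval_ite, Ex.holds_lt, Ex.eval_cst, Ex.eval_add, Ex.eval_arr, Ex.eval_div, h2,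
        Nat.mod_eq_of_lt hlog, Sto.setA, Sto.setV]
      ext1
      · simp
      · simp only [Function.update_idem]
        congr 1
        funext j
        rcases lt_trichotomy j n with hj | rfl | hj
        · simp [hj.ne, hj, show j < n + 1 by omega]
        · simp
        · simp [hj.ne', show ¬ j < n by omega, show ¬ j < n + 1 by omega]
  have h7 : S.v 7 % B = L := by rw [hS.len, Nat.mod_eq_of_lt hLB]
  have := key L le_rfl 0
  simp only [logs, run, Ex.eval_var, h7]
  refine this.trans ?_
  ext1
  · simp only
    rw [← h25, Function.update_eq_self]
  · simp only
    congr 1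
    funext j
    split
    · rfl
    · next hj => exact hS.cell_zero 2 j (not_lt.1 hj)

end MultiStream

namespace MultiStream

/-! ### The tables computed in advance -/

/-- Pattern length, bound on the mismatches, alphabet size, number of streams, length of the arrays,
modulus for the values, and the pattern, continued by zeros. -/
structure Par where
  (m k s q L B : ℕ)
  p : ℕ → ℕ

namespace Par

variable (π : Par)

/-- The pattern over the positive numbers, continued by zeros. -/
def c (i : ℕ) : ℕ := if i < π.m then π.p i + 1 else 0

/-- The length of the intervals within which range minima are found by means of masks. -/
def b : ℕ := Nat.log 2 π.m + 1

/-- A bound for the keys of the hash table. -/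
def X : ℕ := (π.m + 1) * (π.m + 1) * (π.q + 1)

/-- A bound for the multipliers and the primes in the hash functions for keys less than `X`. -/
def U : ℕ := 2 * π.X + 2

/-- The pair of a factor of length `l`, with the first occurrence `p`, and a symbol, as a number. -/
def code (p l a : ℕ) : ℕ := (p * (π.m + 1) + l) * (π.q + 1) + a

/-- The key of the branch `i`. -/
noncomputable def key (i : ℕ) : ℕ :=
  π.code (prevPos π.c π.m i) (prevLen π.c π.m i) (π.c (i + prevLen π.c π.m i))

/-- The hash table of the branches. -/
noncomputable def D : HashData π.m π.U (IsBranch π.c π.m) π.key := hashData _ _ _ _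

open Classical in
/-- The contents of the arrays after the preprocessing. -/
noncomputable def raw : ℕ → ℕ → ℕ
  | 0, i => π.p i
  | 1, i => π.c i
  | 2, i => Nat.log 2 i
  | 3, i => min (2 ^ i) π.L
  | 4, i => sufRank π.c π.m i
  | 5, i => sufArr π.c π.m i
  | 6, i => if i < π.m then rankLce π.c π.m i (i + 1) else 0
  | 7, i => if i < π.m then mask π.c π.m i π.b else 0
  | 8, i => rankLce π.c π.m (i % (π.m / π.b + 1) * π.b)
      (if i % (π.m / π.b + 1) * π.b + π.b * min (2 ^ (i / (π.m / π.b + 1))) π.L < π.m then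
        i % (π.m / π.b + 1) * π.b + π.b * min (2 ^ (i / (π.m / π.b + 1))) π.L else 0)
  | 9, i => prevLen π.c π.m i
  | 10, i => prevPos π.c π.m i
  | 11, i => π.key i
  | 12, i => if IsBranch π.c π.m i then 1 else 0
  | 13, i => π.D.bucket (π.key i)
  | 14, i => π.D.size i
  | 15, i => if i < π.m then π.D.off i else 0
  | 16, i => π.D.u i
  | 17, i => mu π.m fun j => IsBranch π.c π.m j ∧ π.D.slot (π.key j) = i
  | _, _ => 0

/-- The arrays after the first `n + 1` of them have been filled. -/
noncomputable def arrs (n : ℕ) (a : Fin 32) (i : ℕ) : ℕ :=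
  if (a : ℕ) ≤ n ∧ i < π.L then π.raw a i else 0

/-- The variables during the preprocessing; with `st = 1` the parameters of the tables have been
computed, with `st = 2` the index of the first hash function, too. -/
noncomputable def vars (st : ℕ) (x : ℕ) : ℕ :=
  if x = 0 then π.m else if x = 1 then π.k else if x = 2 then π.s else if x = 3 then π.q
  else if x = 7 then π.L else if x = 8 then π.B
  else if 1 ≤ st ∧ x = 10 then π.b else if 1 ≤ st ∧ x = 11 then π.m / π.b + 1
  else if 2 ≤ st ∧ x = 12 then π.D.t
  else if 1 ≤ st ∧ x = 13 then π.X else if 1 ≤ st ∧ x = 14 then π.U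
  else 0

/-- The parameters belong to a problem instance, the arrays are large enough and the modulus is
large enough. -/
structure Ok : Prop where
  m_pos : 0 < π.m
  L_eq : π.L = 8 * (π.m + (π.k + 1) * π.s)
  p_lt : ∀ i < π.m, π.p i < π.q
  p_zero : ∀ i, π.m ≤ i → π.p i = 0
  L_lt : π.L < π.B
  U_lt : π.U * π.U < π.B
  k_lt : 3 * π.k + 4 < π.B
  s_lt : π.s ≤ π.B

end Par

/-! ### Expressions for the tables -/

namespace Ex

-- Variables `0` and `3` are the pattern length `m` and the alphabet size `q`, variables `10` to `14`
-- are `b`, `m / b + 1`, the index of the first hash function, `X` and `U`, and variable `25` is the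
-- index of the cell to be filled. Names from `200` on are bound in the expressions.

/-- The longest common extension at the positions that are the values of `x` and `y`, by brute force. -/
def lceE (x y : ℕ) : Ex :=
  muE 200 (var 0) (neE (arr 1 (var x + var 200)) (arr 1 (var y + var 200)))

theorem eval_lceE (A : Fin 32 → ℕ → ℕ) (ε : ℕ → ℕ) {x y : ℕ} (hx : x ≠ 200) (hy : y ≠ 200) :
    (lceE x y).eval A ε = lce (A 1) (ε 0) (ε x) (ε y) := by
  simp [lceE, lce, hx, hy]

/-- Whether the suffix at `x` precedes the suffix at `y`. -/
def sufLtE (x y : ℕ) : Ex :=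
  letE 201 (lceE x y) (ltE (arr 1 (var x + var 201)) (arr 1 (var y + var 201)))

open Classical in
theorem eval_sufLtE (A : Fin 32 → ℕ → ℕ) (ε : ℕ → ℕ) {x y : ℕ} (hx : x ≠ 200) (hy : y ≠ 200)
    (hx' : x ≠ 201) (hy' : y ≠ 201) :
    (sufLtE x y).eval A ε = if SufLt (A 1) (ε 0) (ε x) (ε y) then 1 else 0 := by
  simp only [sufLtE, eval_letE, eval_lceE A ε hx hy, eval_lt_op, eval_arr, eval_add, eval_var,
    Function.update_self, Function.update_of_ne hx', Function.update_of_ne hy', SufLt]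
  congr

/-- The longest common extension of the suffixes of ranks `x` and `y`, by means of the suffix array. -/
def rankLceE (x y : ℕ) : Ex :=
  letE 202 (arr 5 (var x)) (letE 203 (arr 5 (var y)) (lceE 202 203))

theorem eval_rankLceE (A : Fin 32 → ℕ → ℕ) (ε : ℕ → ℕ) {x y : ℕ} (hy : y ≠ 202) :
    (rankLceE x y).eval A ε = lce (A 1) (ε 0) (A 5 (ε x)) (A 5 (ε y)) := by
  simp [rankLceE, eval_lceE, hy]

/-- The hash function with the index `t`. -/
def hashE (t x : Ex) : Ex := t / var 14 * x % (t % var 14)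

@[simp] theorem eval_hashE (A : Fin 32 → ℕ → ℕ) (ε : ℕ → ℕ) (t x : Ex) :
    (hashE t x).eval A ε = hash (ε 14) (t.eval A ε) (x.eval A ε) := rfl

/-- The pattern over the positive numbers, for array `1`. -/
def patE : Ex := ite (ltE (var 25) (var 0)) (arr 0 (var 25) + cst 1) (cst 0)

/-- The powers of two, for array `3`, capped at the array length: for `0 < i` the numbers less than
`2 ^ i` are those with logarithm less than `i`; as `log 0 = 0`, the case `i = 0` is separate. -/
def powE : Ex := ite (eqE (var 25) (cst 0)) (cst 1)
  (sum 210 (var 7) (ltE (arr 2 (var 210)) (var 25)))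

/-- The ranks of the suffixes, for array `4`. -/
def rankE : Ex := sum 210 (var 0) (sufLtE 210 25)

/-- The suffix array, for array `5`. -/
def sufArrE : Ex := muE 210 (var 0) (eqE (arr 4 (var 210)) (var 25))

/-- The common extensions of neighbours in the suffix array, for array `6`. -/
def neighbourE : Ex := ite (ltE (var 25) (var 0)) (letE 210 (var 25 + cst 1) (rankLceE 25 210)) (cst 0)

/-- The masks for the intervals of length `b` from each place on, for array `7`. -/
def maskE : Ex := ite (ltE (var 25) (var 0))
  (sum 210 (var 10) (letE 211 (var 25 + var 210) (letE 212 (var 25 + var 210 + cst 1)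
    (ite (eqE (var 210) (cst 0)) (arr 3 (var 210))
      (ite (ltE (rankLceE 25 212) (rankLceE 25 211)) (arr 3 (var 210)) (cst 0)))))) (cst 0)

/-- The common extensions over `2 ^ j` blocks of length `b`, for array `8`; the cell is
`j * (m / b + 1) + x` for the blocks from `x` on. -/
def blocksE : Ex :=
  letE 210 (var 25 % var 11 * var 10) (letE 211 (var 210 + var 10 * arr 3 (var 25 / var 11))
    (letE 212 (ite (ltE (var 211) (var 0)) (var 211) (cst 0)) (rankLceE 210 212)))

/-- The lengths of the longest earlier matches, for array `9`. -/
def prevLenE : Ex := muE 210 (var 0) (allE 211 (var 25) (leE (lceE 211 25) (var 210)))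

/-- The first positions of the longest earlier matches, for array `10`. -/
def prevPosE : Ex := muE 210 (var 0) (leE (arr 9 (var 25)) (lceE 210 25))

/-- The factor of length `l` at `p` and the symbol `a`, as a number. -/
def codeE (p l a : Ex) : Ex := (p * (var 0 + cst 1) + l) * (var 3 + cst 1) + a

/-- The keys, for array `11`. -/
def keyE : Ex := codeE (arr 10 (var 25)) (arr 9 (var 25)) (arr 1 (var 25 + arr 9 (var 25)))

/-- The indicator function of the branches, for array `12`. -/
def branchE : Ex :=
  ite (andE (ltE (cst 0) (var 25)) (ltE (var 25 + arr 9 (var 25)) (var 0))) (cst 1) (cst 0)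

/-- The index of the hash function for the buckets. -/
def firstHashE : Ex := muE 210 (var 14 * var 14)
  (leE (sum 211 (var 0) (sum 212 (var 0)
    (ite (andE (arr 12 (var 211)) (andE (arr 12 (var 212))
      (eqE (hashE (var 210) (arr 11 (var 211)) % var 0)
        (hashE (var 210) (arr 11 (var 212)) % var 0)))) (cst 1) (cst 0)))) (cst 3 * var 0))

/-- The bucket of the key `x`; array `13` holds the buckets of the keys. -/
def bucketE (x : Ex) : Ex := hashE (var 12) x % var 0

/-- The sizes of the second level tables, for array `14`. -/
def sizeE : Ex := letE 210 (sum 211 (var 0)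
    (ite (andE (arr 12 (var 211)) (eqE (arr 13 (var 211)) (var 25))) (cst 1) (cst 0)))
  (cst 2 * (var 210 * var 210))

/-- The first cells of the second level tables, for array `15`. -/
def offE : Ex := ite (ltE (var 25) (var 0)) (sum 210 (var 25) (arr 14 (var 210))) (cst 0)

/-- The indices of the hash functions of the second level tables, for array `16`. -/
def secondHashE : Ex := muE 210 (var 14 * var 14) (allE 211 (var 0) (allE 212 (var 0) (notE
  (andE (andE (arr 12 (var 211)) (eqE (arr 13 (var 211)) (var 25)))
    (andE (andE (arr 12 (var 212)) (eqE (arr 13 (var 212)) (var 25)))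
      (andE (neE (var 211) (var 212))
        (eqE (hashE (var 210) (arr 11 (var 211)) % arr 14 (var 25))
          (hashE (var 210) (arr 11 (var 212)) % arr 14 (var 25)))))))))

/-- The cell of the hash table for the key `x`, with the auxiliary name `y` for its bucket. -/
def slotE (y : ℕ) (x : Ex) : Ex :=
  letE y (bucketE x) (arr 15 (var y) + hashE (arr 16 (var y)) x % arr 14 (var y))

/-- The hash table, for array `17`. -/
def tableE : Ex := muE 210 (var 0)
  (andE (arr 12 (var 210)) (eqE (slotE 211 (arr 11 (var 210))) (var 25)))

end Ex

/-- The preprocessing. -/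
def St.prepare : St :=
  .seq (.fill 1 Ex.patE) <| .seq .logs <|
  .seq (.assign 0 (.arr 2 (.var 0) + .cst 1)) <| .seq (.assign 1 (.var 0 / .var 10 + .cst 1)) <|
  .seq (.assign 3 ((.var 0 + .cst 1) * (.var 0 + .cst 1) * (.var 3 + .cst 1))) <|
  .seq (.assign 4 (.cst 2 * .var 13 + .cst 2)) <|
  .seq (.fill 3 Ex.powE) <| .seq (.fill 4 Ex.rankE) <| .seq (.fill 5 Ex.sufArrE) <|
  .seq (.fill 6 Ex.neighbourE) <| .seq (.fill 7 Ex.maskE) <| .seq (.fill 8 Ex.blocksE) <|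
  .seq (.fill 9 Ex.prevLenE) <| .seq (.fill 10 Ex.prevPosE) <| .seq (.fill 11 Ex.keyE) <|
  .seq (.fill 12 Ex.branchE) <| .seq (.assign 2 Ex.firstHashE) <|
  .seq (.fill 13 (Ex.bucketE (.arr 11 (.var 25)))) <| .seq (.fill 14 Ex.sizeE) <|
  .seq (.fill 15 Ex.offE) <| .seq (.fill 16 Ex.secondHashE) <| .fill 17 Ex.tableE

namespace Par

variable {π : Par}

theorem Ok.sentinel (_ : π.Ok) : Sentinel π.c π.m := fun i => by
  unfold c; split <;> omega

theorem c_zero {i : ℕ} (h : π.m ≤ i) : π.c i = 0 := if_neg (by omega)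

theorem Ok.c_le (h : π.Ok) (i : ℕ) : π.c i ≤ π.q := by
  unfold c
  split
  · next hi => exact h.p_lt i hi
  · omega

theorem Ok.m_le_L (h : π.Ok) : 8 * π.m ≤ π.L := by
  rw [h.L_eq]; exact Nat.mul_le_mul_left _ (Nat.le_add_right _ _)

theorem code_lt {p l a : ℕ} (hp : p ≤ π.m) (hl : l ≤ π.m) (ha : a ≤ π.q) :
    π.code p l a < π.X := by
  unfold code X
  have h1 : p * (π.m + 1) + l + 1 ≤ (π.m + 1) * (π.m + 1) := by
    have : p * (π.m + 1) ≤ π.m * (π.m + 1) := Nat.mul_le_mul_right _ hp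
    nlinarith
  have h2 := Nat.mul_le_mul_right (π.q + 1) h1
  rw [add_mul _ 1] at h2
  omega

theorem code_inj {p l a p' l' a' : ℕ} (hl : l ≤ π.m) (hl' : l' ≤ π.m) (ha : a ≤ π.q)
    (ha' : a' ≤ π.q) (h : π.code p l a = π.code p' l' a') : p = p' ∧ l = l' ∧ a = a' := by
  unfold code at h
  have key : ∀ {n x y x' y' : ℕ}, y ≤ n → y' ≤ n → x * (n + 1) + y = x' * (n + 1) + y' →
      x = x' ∧ y = y' := by
    intro n x y x' y' hy hy' h
    have h1 := congrArg (· % (n + 1)) h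
    have h2 := congrArg (· / (n + 1)) h
    simp only [Nat.mul_add_mod', Nat.mod_eq_of_lt (Nat.lt_succ_of_le hy),
      Nat.mod_eq_of_lt (Nat.lt_succ_of_le hy')] at h1
    subst h1
    exact ⟨Nat.eq_of_mul_eq_mul_right (show 0 < n + 1 by omega) (by omega), rfl⟩
  obtain ⟨h1, h2⟩ := key ha ha' h
  obtain ⟨h3, h4⟩ := key hl hl' h1
  exact ⟨h3, h4, h2⟩

theorem Ok.X_pos (_ : π.Ok) : 0 < π.X := by unfold X; positivity

theorem Ok.cube_lt (h : π.Ok) : 2 * (π.m * π.m) * π.m < π.B := by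
  refine lt_of_le_of_lt ?_ h.U_lt
  have h1 : π.m * π.m ≤ π.X := by
    unfold X
    calc π.m * π.m ≤ (π.m + 1) * (π.m + 1) := Nat.mul_le_mul (by omega) (by omega)
      _ ≤ _ := Nat.le_mul_of_pos_right _ (by omega)
  have h2 : 2 * (π.m * π.m) ≤ π.U := by unfold U; omega
  have h3 : π.m ≤ π.m * π.m := Nat.le_mul_self _
  exact Nat.mul_le_mul h2 (by omega)

theorem Ok.U_le (h : π.Ok) : π.U < π.B := (Nat.le_mul_self _).trans_lt h.U_lt

theorem Ok.X_lt (h : π.Ok) : π.X < π.B := by have := h.U_le; unfold U at this; omega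

theorem Ok.key_lt (h : π.Ok) (i : ℕ) : π.key i < π.X :=
  code_lt (prevPos_le i) (prevLen_le i) (h.c_le _)

theorem Ok.key_inj (h : π.Ok) (i : ℕ) (_ : i < π.m) (j : ℕ) (_ : j < π.m)
    (hi : IsBranch π.c π.m i) (hj : IsBranch π.c π.m j) (hij : π.key i = π.key j) : i = j := by
  obtain ⟨h1, h2, h3⟩ := code_inj (prevLen_le i) (prevLen_le j) (h.c_le _) (h.c_le _) hij
  exact hi.eq_of_eq hj h1 h2 h3

theorem Ok.hash_spec (h : π.Ok) :
    (∀ i < π.m, IsBranch π.c π.m i → π.D.slot (π.key i) < 6 * π.m) ∧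
    (∀ i < π.m, ∀ j < π.m, IsBranch π.c π.m i → IsBranch π.c π.m j →
      π.D.slot (π.key i) = π.D.slot (π.key j) → i = j) :=
  hashData_spec h.m_pos h.X_pos rfl (fun i _ _ => h.key_lt i) h.key_inj

end Par

end MultiStream

namespace MultiStream

/-! ### Correctness of the preprocessing -/

theorem mu_congr {n : ℕ} {φ ψ : ℕ → Prop} (h : ∀ i < n, (φ i ↔ ψ i)) : mu n φ = mu n ψ := by
  have hs := mu_spec n ψ
  exact mu_eq hs.1 (fun i hi hφ => hs.2.1 i hi ((h i (by omega)).1 hφ))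
    fun hlt => (h _ hlt).2 (hs.2.2 hlt)

namespace Par

variable {π : Par}

theorem D_bucket_lt (h : π.Ok) (x : ℕ) : π.D.bucket x < π.m := Nat.mod_lt _ h.m_pos

theorem D_size_le (b : ℕ) : π.D.size b ≤ 2 * (π.m * π.m) := by
  classical
  change 2 * ((∑ i ∈ Finset.range π.m, _) * (∑ i ∈ Finset.range π.m, _)) ≤ _
  have : (∑ i ∈ Finset.range π.m, if IsBranch π.c π.m i ∧ hash π.U π.D.t (π.key i) % π.m = b
      then 1 else 0) ≤ π.m := by
    refine (Finset.sum_le_card_nsmul _ _ 1 fun i _ => ?_).trans (by simp)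
    split <;> omega
  exact Nat.mul_le_mul_left _ (Nat.mul_le_mul this this)

theorem D_off_le {b : ℕ} (hb : b < π.m) : π.D.off b ≤ 2 * (π.m * π.m) * π.m := by
  change ∑ x ∈ Finset.range b, π.D.size x ≤ _
  refine (Finset.sum_le_card_nsmul _ _ _ fun x _ => D_size_le x).trans ?_
  rw [Finset.card_range, smul_eq_mul, mul_comm]
  exact Nat.mul_le_mul_left _ hb.le

theorem D_u_le (b : ℕ) : π.D.u b ≤ π.U * π.U := mu_le _ _

theorem D_t_le : π.D.t ≤ π.U * π.U := mu_le _ _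

theorem b_lt (h : π.Ok) : 2 ^ π.b ≤ 2 * π.m := by
  have := Nat.pow_log_le_self 2 h.m_pos.ne'
  unfold b
  rw [pow_succ]; omega

theorem b_le (h : π.Ok) : π.b ≤ π.m := by
  have h1 := b_lt h
  have h2 : Nat.log 2 π.m < π.m := Nat.log_lt_self 2 h.m_pos.ne'
  unfold b; omega

theorem Ok.raw_lt (h : π.Ok) : ∀ a i, i < π.L → π.raw a i < π.B := by
  have h1 := h.m_le_L
  have h2 := h.L_lt
  have h3 := h.X_lt
  have h4 := h.U_lt
  have h5 := h.cube_lt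
  have hm := h.m_pos
  have hq : π.q < π.X := by
    unfold X
    exact (Nat.lt_succ_self _).trans_le (Nat.le_mul_of_pos_left _ (by positivity))
  intro a i hi
  match a with
  | 0 =>
    simp only [raw]
    rcases lt_or_ge i π.m with hi | hi
    · have := h.p_lt i hi; omega
    · rw [h.p_zero i hi]; omega
  | 1 => have := h.c_le i; simp only [raw]; omega
  | 2 => have := Nat.log_le_self 2 i; simp only [raw]; omega
  | 3 => simp only [raw]; omega
  | 4 => have := sufRank_le (c := π.c) (m := π.m) i; simp only [raw]; omega
  | 5 => have := sufArr_le (c := π.c) (m := π.m) i; simp only [raw]; omega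
  | 6 =>
    have := rankLce_le (c := π.c) (m := π.m) i (i + 1)
    simp only [raw]; split <;> omega
  | 7 =>
    have := mask_lt (c := π.c) (m := π.m) i π.b
    have := b_lt h
    simp only [raw]; split <;> omega
  | 8 => exact (rankLce_le _ _).trans_lt (by omega)
  | 9 => have := prevLen_le (c := π.c) (m := π.m) i; simp only [raw]; omega
  | 10 => have := prevPos_le (c := π.c) (m := π.m) i; simp only [raw]; omega
  | 11 => exact (h.key_lt i).trans h3
  | 12 => simp only [raw]; split <;> omega
  | 13 => have := D_bucket_lt h (π.key i); simp only [raw]; omega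
  | 14 =>
    have h6 := D_size_le (π := π) i
    have h7 : 2 * (π.m * π.m) ≤ 2 * (π.m * π.m) * π.m := Nat.le_mul_of_pos_right _ hm
    simp only [raw]; omega
  | 15 =>
    simp only [raw]
    split
    · next hi => have := D_off_le hi; omega
    · omega
  | 16 => have := D_u_le (π := π) i; simp only [raw]; omega
  | 17 => exact (mu_le _ _).trans_lt (by omega)
  | _ + 18 => simp only [raw]; omega

theorem Ok.fits (h : π.Ok) (st n : ℕ) : Fits π.L π.B ⟨π.vars st, π.arrs n⟩ := by
  have h1 := h.m_le_L
  have h2 := h.L_lt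
  have h3 := h.X_lt
  have h4 := h.U_lt
  have h5 := h.U_le
  have h6 := h.k_lt
  have h7 := h.s_lt
  have hm := h.m_pos
  have hq : π.q < π.X := by
    unfold X
    exact (Nat.lt_succ_self _).trans_le (Nat.le_mul_of_pos_left _ (by positivity))
  refine ⟨by simp [vars], by simp [vars], fun x => ?_, fun x hx => ?_, fun a i => ?_,
    fun a i hi => ?_⟩
  · have h8 := b_le h
    have h9 := D_t_le (π := π)
    have h10 := Nat.div_le_self π.m π.b
    have hle : ∀ {c : Prop} [Decidable c] {a b : ℕ}, a ≤ π.B → b ≤ π.B →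
        (if c then a else b) ≤ π.B := by
      intro c _ a b ha hb
      split <;> assumption
    unfold vars
    refine hle ?_ <| hle ?_ <| hle ?_ <| hle ?_ <| hle ?_ <| hle ?_ <| hle ?_ <| hle ?_ <|
      hle ?_ <| hle ?_ <| hle ?_ ?_ <;> omega
  · simp only [vars]
    repeat rw [if_neg (by omega)]
  · simp only [arrs]
    split
    · next hi => exact h.raw_lt a i hi.2
    · omega
  · simp only [arrs]
    rw [if_neg (by omega)]

theorem arrs_eq {n i : ℕ} {a : Fin 32} (ha : (a : ℕ) ≤ n) (hi : i < π.L) :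
    π.arrs n a i = π.raw a i := if_pos ⟨ha, hi⟩

theorem Ok.arrs_one (h : π.Ok) {n : ℕ} (hn : 1 ≤ n) : π.arrs n 1 = π.c := by
  funext i
  unfold arrs
  split
  · rfl
  · next hi =>
    have := h.m_le_L
    refine (c_zero ?_).symm
    have : ¬ i < π.L := fun h => hi ⟨hn, h⟩
    omega

theorem Ok.run_fill (h : π.Ok) {st n : ℕ} (a : Fin 32) {e : Ex} (ha : (a : ℕ) = n + 1)
    (he : e.free a = true)
    (hf : ∀ i < π.L, e.eval (π.arrs n) (Function.update (π.vars st) 25 i) = π.raw (n + 1) i) :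
    (St.fill a e).run π.L π.B ⟨π.vars st, π.arrs n⟩ = ⟨π.vars st, π.arrs (n + 1)⟩ := by
  rw [St.run_fill (h.fits st n) h.L_lt (by simp [vars]) a he (π.raw (n + 1))
    fun i hi => ⟨hf i hi, h.raw_lt _ i hi⟩]
  ext1
  · rfl
  · funext b i
    by_cases hb : b = a
    · subst hb
      simp [arrs, ha]
    · have : (b : ℕ) ≠ n + 1 := fun h => hb (Fin.ext (h.trans ha.symm))
      simp only [Function.update_of_ne hb, arrs]
      exact if_congr (by omega) rfl rfl

theorem eval_patE (h : π.Ok) {i : ℕ} (_ : i < π.L) :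
    Ex.patE.eval (π.arrs 0) (Function.update (π.vars 0) 25 i) = π.raw 1 i := by
  have h1 := h.m_le_L
  simp only [Ex.patE, Ex.eval_ite, Ex.holds_lt, Ex.eval_var, Ex.eval_add, Ex.eval_arr, Ex.eval_cst,
    Function.update_self, raw, c]
  have h0 : Function.update (π.vars 0) 25 i 0 = π.m := by simp [vars]
  rw [h0]
  split
  · rw [arrs_eq (by simp) (by omega)]; rfl
  · rfl

theorem eval_powE {i : ℕ} (hi : i < π.L) :
    Ex.powE.eval (π.arrs 2) (Function.update (π.vars 1) 25 i) = π.raw 3 i := by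
  have h7 : Function.update (π.vars 1) 25 i 7 = π.L := by simp [vars]
  simp only [Ex.powE, Ex.eval_ite, Ex.holds_eq, Ex.eval_var, Ex.eval_cst, Function.update_self, raw,
    Ex.eval_sum, h7, Ex.eval_lt_op, Ex.eval_arr, ne_eq, Nat.reduceEqDiff, not_false_eq_true,
    Function.update_of_ne]
  split
  · next h0 => subst h0; simp; omega
  · next h0 =>
    rw [← Finset.card_filter]
    have : (Finset.range π.L).filter (fun x => π.arrs 2 2 x < i) =
        Finset.range (min (2 ^ i) π.L) := by
      ext x
      simp only [Finset.mem_filter, Finset.mem_range, lt_min_iff, and_comm]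
      refine and_congr_right fun hx => ?_
      rw [arrs_eq (by simp) hx]
      change Nat.log 2 x < i ↔ _
      rcases Nat.eq_zero_or_pos x with rfl | hpos
      · simp; omega
      · rw [Nat.log_lt_iff_lt_pow (by omega) hpos.ne']
    convert congrArg Finset.card this
    simp

theorem eval_rankE (h : π.Ok) {i : ℕ} (_ : i < π.L) :
    Ex.rankE.eval (π.arrs 3) (Function.update (π.vars 1) 25 i) = π.raw 4 i := by
  classical
  simp only [Ex.rankE, Ex.eval_sum, raw, sufRank, Finset.card_filter]
  refine Finset.sum_congr (by simp [vars]) fun j _ => ?_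
  rw [Ex.eval_sufLtE _ _ (by simp) (by simp) (by simp) (by simp), h.arrs_one (by simp)]
  have h0 : Function.update (Function.update (π.vars 1) 25 i) 210 j 0 = π.m := by simp [vars]
  rw [h0]
  simp

theorem eval_sufArrE (h : π.Ok) {i : ℕ} (_ : i < π.L) :
    Ex.sufArrE.eval (π.arrs 4) (Function.update (π.vars 1) 25 i) = π.raw 5 i := by
  have h1 := h.m_le_L
  have h0 : Function.update (π.vars 1) 25 i 0 = π.m := by simp [vars]
  simp only [Ex.sufArrE, Ex.eval_mu, Ex.eval_var, h0, Ex.holds_eq, Ex.eval_arr,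
    Function.update_self, raw, sufArr]
  refine mu_congr fun j hj => ?_
  rw [arrs_eq (by simp) (by omega)]
  simp [raw]

end Par
end MultiStream

namespace MultiStream

namespace Par

variable {π : Par}

theorem eval_neighbourE (h : π.Ok) {i : ℕ} (_ : i < π.L) :
    Ex.neighbourE.eval (π.arrs 5) (Function.update (π.vars 1) 25 i) = π.raw 6 i := by
  have h1 := h.m_le_L
  have h0 : Function.update (π.vars 1) 25 i 0 = π.m := by simp [vars]
  simp only [Ex.neighbourE, Ex.eval_ite, Ex.holds_lt, Ex.eval_var, Ex.eval_cst, h0,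
    Function.update_self, Ex.eval_letE, Ex.eval_add, raw]
  refine if_ctx_congr Iff.rfl (fun hi => ?_) fun _ => rfl
  rw [Ex.eval_rankLceE _ _ (by simp), h.arrs_one (by simp), rankLce]
  have h0' : Function.update (Function.update (π.vars 1) 25 i) 210 (i + 1) 0 = π.m := by simp [vars]
  rw [h0', Function.update_self, Function.update_of_ne (by simp), Function.update_self,
    arrs_eq (by simp) (by omega), arrs_eq (by simp) (by omega)]
  rfl

theorem eval_maskE (h : π.Ok) {i : ℕ} (_ : i < π.L) :
    Ex.maskE.eval (π.arrs 6) (Function.update (π.vars 1) 25 i) = π.raw 7 i := by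
  classical
  have h1 := h.m_le_L
  have hb := b_le h
  have h0 : Function.update (π.vars 1) 25 i 0 = π.m := by simp [vars]
  have h10 : Function.update (π.vars 1) 25 i 10 = π.b := by simp [vars]
  simp only [Ex.maskE, Ex.eval_ite, Ex.holds_lt, Ex.eval_var, Ex.eval_cst, h0,
    Function.update_self, Ex.eval_letE, Ex.eval_add, raw, Ex.eval_sum, h10, mask]
  refine if_ctx_congr Iff.rfl (fun hi => ?_) fun _ => rfl
  refine Finset.sum_congr rfl fun t ht => ?_
  have htb := Finset.mem_range.1 ht
  have hpow : 2 ^ t ≤ 2 ^ π.b := Nat.pow_le_pow_right (by omega) (by omega)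
  have hbl := b_lt h
  have htlt : t < 2 ^ t := Nat.lt_two_pow_self
  have e3 : π.arrs 6 3 t = 2 ^ t := by
    rw [arrs_eq (by simp) (by omega)]
    change min (2 ^ t) π.L = _
    omega
  simp only [Ex.eval_rankLceE _ _ (show 212 ≠ 202 by simp),
    Ex.eval_rankLceE _ _ (show 211 ≠ 202 by simp), Ex.eval_arr, Ex.eval_var, h.arrs_one (n := 6) (by simp)]
  simp only [Function.update_apply, Ex.holds_eq, Ex.eval_var, Ex.eval_cst, vars]
  simp only [Nat.reduceEqDiff, if_false, if_true, OfNat.ofNat_ne_zero, e3,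
    OfNat.zero_ne_ofNat]
  rw [arrs_eq (i := i + t + 1) (by simp) (by omega), arrs_eq (i := i + t) (by simp) (by omega),
    arrs_eq (i := i) (by simp) (by omega)]
  change (if t = 0 then 2 ^ t else if rankLce π.c π.m i (i + t + 1) < rankLce π.c π.m i (i + t) then
    2 ^ t else 0) = _
  by_cases ht0 : t = 0
  · simp [ht0]
  · simp [ht0]

theorem eval_blocksE (h : π.Ok) {i : ℕ} (hi : i < π.L) :
    Ex.blocksE.eval (π.arrs 7) (Function.update (π.vars 1) 25 i) = π.raw 8 i := by
  have h1 := h.m_le_L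
  have hm := h.m_pos
  have hx : i % (π.m / π.b + 1) * π.b < π.L := by
    have h2 : i % (π.m / π.b + 1) ≤ π.m / π.b := Nat.le_of_lt_succ (Nat.mod_lt _ (Nat.succ_pos _))
    have h3 := (Nat.mul_le_mul_right π.b h2).trans (Nat.div_mul_le_self _ _)
    omega
  have hj : i / (π.m / π.b + 1) < π.L := (Nat.div_le_self _ _).trans_lt hi
  have e3 : π.arrs 7 3 (i / (π.m / π.b + 1)) = min (2 ^ (i / (π.m / π.b + 1))) π.L :=
    arrs_eq (by simp) hj
  have e10 : Function.update (π.vars 1) 25 i 10 = π.b := by simp [vars]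
  have e11 : Function.update (π.vars 1) 25 i 11 = π.m / π.b + 1 := by simp [vars]
  have e0 : π.vars 1 0 = π.m := by simp [vars]
  have e10' : π.vars 1 10 = π.b := by simp [vars]
  have e11' : π.vars 1 11 = π.m / π.b + 1 := by simp [vars]
  simp only [Ex.blocksE, Ex.eval_letE, Ex.eval_mod, Ex.eval_mul, Ex.eval_add, Ex.eval_arr,
    Ex.eval_div, Ex.eval_ite, Ex.holds_lt, Ex.eval_var, Ex.eval_cst, raw,
    Ex.eval_rankLceE _ _ (show 212 ≠ 202 by simp), h.arrs_one (n := 7) (by simp)]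
  simp only [Function.update_apply, Nat.reduceEqDiff, if_false, if_true, e10', e11', e0, e3,
    OfNat.zero_ne_ofNat]
  rw [arrs_eq (by simp) hx]
  split
  · next hlt => rw [arrs_eq (by simp) (by omega)]; rfl
  · rw [arrs_eq (by simp) (by omega)]; rfl

theorem eval_prevLenE (h : π.Ok) {i : ℕ} (_ : i < π.L) :
    Ex.prevLenE.eval (π.arrs 8) (Function.update (π.vars 1) 25 i) = π.raw 9 i := by
  have e0 : π.vars 1 0 = π.m := by simp [vars]
  simp only [Ex.prevLenE, Ex.eval_mu, Ex.holds_all, Ex.holds_le, Ex.eval_var,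
    Ex.eval_lceE _ _ (show 211 ≠ 200 by simp) (show 25 ≠ 200 by simp), h.arrs_one (n := 8) (by simp),
    raw, prevLen]
  simp only [Function.update_apply, Nat.reduceEqDiff, if_false, if_true, e0, OfNat.zero_ne_ofNat]

theorem eval_prevPosE (h : π.Ok) {i : ℕ} (hi : i < π.L) :
    Ex.prevPosE.eval (π.arrs 9) (Function.update (π.vars 1) 25 i) = π.raw 10 i := by
  have e0 : π.vars 1 0 = π.m := by simp [vars]
  simp only [Ex.prevPosE, Ex.eval_mu, Ex.holds_le, Ex.eval_var, Ex.eval_arr,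
    Ex.eval_lceE _ _ (show 210 ≠ 200 by simp) (show 25 ≠ 200 by simp), h.arrs_one (n := 9) (by simp),
    raw, prevPos]
  simp only [Function.update_apply, Nat.reduceEqDiff, if_false, if_true, e0, OfNat.zero_ne_ofNat]
  rw [arrs_eq (by simp) hi]
  rfl

theorem eval_keyE (h : π.Ok) {i : ℕ} (hi : i < π.L) :
    Ex.keyE.eval (π.arrs 10) (Function.update (π.vars 1) 25 i) = π.raw 11 i := by
  have e0 : Function.update (π.vars 1) 25 i 0 = π.m := by simp [vars]
  have e3 : Function.update (π.vars 1) 25 i 3 = π.q := by simp [vars]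
  simp only [Ex.keyE, Ex.codeE, Ex.eval_add, Ex.eval_mul, Ex.eval_var, Ex.eval_arr, Ex.eval_cst,
    Function.update_self, e0, e3, h.arrs_one (n := 10) (by simp), raw, key, code]
  rw [arrs_eq (by simp) hi, arrs_eq (by simp) hi]
  rfl

theorem eval_branchE {i : ℕ} (hi : i < π.L) :
    Ex.branchE.eval (π.arrs 11) (Function.update (π.vars 1) 25 i) = π.raw 12 i := by
  have e0 : Function.update (π.vars 1) 25 i 0 = π.m := by simp [vars]
  simp only [Ex.branchE, Ex.eval_ite, Ex.holds_and, Ex.holds_lt, Ex.eval_add, Ex.eval_var,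
    Ex.eval_arr, Ex.eval_cst, Function.update_self, e0, raw]
  rw [arrs_eq (by simp) hi]
  classical
  exact if_congr Iff.rfl rfl rfl

theorem arrs_branch {n i : ℕ} (h : π.Ok) (hn : 12 ≤ n) (hi : i < π.m) :
    π.arrs n 12 i ≠ 0 ↔ IsBranch π.c π.m i := by
  classical
  have h1 := h.m_le_L
  rw [arrs_eq (by simpa using hn) (by omega)]
  change (if IsBranch π.c π.m i then 1 else 0) ≠ 0 ↔ _
  by_cases hb : IsBranch π.c π.m i <;> simp [hb]

theorem arrs_key {n i : ℕ} (h : π.Ok) (hn : 11 ≤ n) (hi : i < π.m) :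
    π.arrs n 11 i = π.key i := by
  have h1 := h.m_le_L
  rw [arrs_eq (by simpa using hn) (by omega)]; rfl

theorem eval_firstHashE (h : π.Ok) : Ex.firstHashE.eval (π.arrs 12) (π.vars 1) = π.D.t := by
  classical
  have e0 : π.vars 1 0 = π.m := by simp [vars]
  have e14 : π.vars 1 14 = π.U := by simp [vars]
  change _ = mu (π.U * π.U) fun t => (∑ i ∈ Finset.range π.m, ∑ j ∈ Finset.range π.m,
    if IsBranch π.c π.m i ∧ IsBranch π.c π.m j ∧
      hash π.U t (π.key i) % π.m = hash π.U t (π.key j) % π.m then 1 else 0) ≤ 3 * π.m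
  simp only [Ex.firstHashE, Ex.eval_mu, Ex.holds_le, Ex.eval_mul, Ex.eval_var, Ex.eval_sum,
    Ex.eval_ite, Ex.holds_and, Ex.holds_eq, Ex.eval_mod, Ex.eval_hashE, Ex.eval_arr, Ex.eval_cst,
    Ex.holds_arr]
  simp only [Function.update_apply, Nat.reduceEqDiff, if_false, if_true, e0, e14,
    OfNat.zero_ne_ofNat]
  refine mu_congr fun t _ => ?_
  rw [Finset.sum_congr rfl fun i hi => Finset.sum_congr rfl fun j hj => ?_]
  have hi' := Finset.mem_range.1 hi
  have hj' := Finset.mem_range.1 hj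
  rw [arrs_key h (by simp) hi', arrs_key h (by simp) hj']
  simp only [arrs_branch h (by simp : 12 ≤ 12) hi', arrs_branch h (by simp : 12 ≤ 12) hj']

theorem eval_bucketE {i : ℕ} (hi : i < π.L) :
    (Ex.bucketE (.arr 11 (.var 25))).eval (π.arrs 12) (Function.update (π.vars 2) 25 i) =
      π.raw 13 i := by
  have e0 : Function.update (π.vars 2) 25 i 0 = π.m := by simp [vars]
  have e12 : Function.update (π.vars 2) 25 i 12 = π.D.t := by simp [vars]
  have e14 : Function.update (π.vars 2) 25 i 14 = π.U := by simp [vars]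
  simp only [Ex.bucketE, Ex.eval_mod, Ex.eval_hashE, Ex.eval_var, Ex.eval_arr, e0, e12, e14,
    Function.update_self]
  rw [arrs_eq (by simp) hi]
  rfl

theorem arrs_bucket {n i : ℕ} (h : π.Ok) (hn : 13 ≤ n) (hi : i < π.m) :
    π.arrs n 13 i = hash π.U π.D.t (π.key i) % π.m := by
  have h1 := h.m_le_L
  rw [arrs_eq (by simpa using hn) (by omega)]; rfl

theorem eval_sizeE (h : π.Ok) {i : ℕ} (_ : i < π.L) :
    Ex.sizeE.eval (π.arrs 13) (Function.update (π.vars 2) 25 i) = π.raw 14 i := by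
  classical
  have e0 : π.vars 2 0 = π.m := by simp [vars]
  change _ = 2 * ((∑ j ∈ Finset.range π.m,
      if IsBranch π.c π.m j ∧ hash π.U π.D.t (π.key j) % π.m = i then 1 else 0) *
    (∑ j ∈ Finset.range π.m,
      if IsBranch π.c π.m j ∧ hash π.U π.D.t (π.key j) % π.m = i then 1 else 0))
  simp only [Ex.sizeE, Ex.eval_letE, Ex.eval_mul, Ex.eval_var, Ex.eval_sum, Ex.eval_ite,
    Ex.holds_and, Ex.holds_eq, Ex.eval_arr, Ex.eval_cst, Ex.holds_arr, Function.update_self]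
  simp only [Function.update_apply, Nat.reduceEqDiff, if_false, if_true, e0, OfNat.zero_ne_ofNat]
  have : ∀ j ∈ Finset.range π.m, (if π.arrs 13 12 j ≠ 0 ∧ π.arrs 13 13 j = i then 1 else 0) =
      if IsBranch π.c π.m j ∧ hash π.U π.D.t (π.key j) % π.m = i then 1 else 0 := by
    intro j hj
    have hj' := Finset.mem_range.1 hj
    rw [arrs_bucket h (by simp) hj']
    simp only [arrs_branch h (by simp : 12 ≤ 13) hj']
  rw [Finset.sum_congr rfl this]

theorem eval_offE {i : ℕ} (hi : i < π.L) :
    Ex.offE.eval (π.arrs 14) (Function.update (π.vars 2) 25 i) = π.raw 15 i := by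
  have e0 : Function.update (π.vars 2) 25 i 0 = π.m := by simp [vars]
  simp only [Ex.offE, Ex.eval_ite, Ex.holds_lt, Ex.eval_var, Ex.eval_cst, e0,
    Function.update_self, raw, Ex.eval_sum, Ex.eval_arr]
  refine if_congr Iff.rfl ?_ rfl
  change _ = ∑ x ∈ Finset.range i, π.D.size x
  refine Finset.sum_congr rfl fun x hx => ?_
  have := Finset.mem_range.1 hx
  rw [arrs_eq (by simp) (by omega)]; rfl

theorem eval_secondHashE (h : π.Ok) {i : ℕ} (hi : i < π.L) :
    Ex.secondHashE.eval (π.arrs 15) (Function.update (π.vars 2) 25 i) = π.raw 16 i := by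
  classical
  have e0 : π.vars 2 0 = π.m := by simp [vars]
  have e14 : π.vars 2 14 = π.U := by simp [vars]
  change _ = mu (π.U * π.U) fun u => ∀ j < π.m, ∀ l < π.m,
    IsBranch π.c π.m j ∧ hash π.U π.D.t (π.key j) % π.m = i →
    IsBranch π.c π.m l ∧ hash π.U π.D.t (π.key l) % π.m = i → j ≠ l →
    hash π.U u (π.key j) % π.D.size i ≠ hash π.U u (π.key l) % π.D.size i
  have e15 : π.arrs 15 14 i = π.D.size i := arrs_eq (by simp) hi
  simp only [Ex.secondHashE, Ex.eval_mu, Ex.holds_all, Ex.holds_not, Ex.eval_mul, Ex.eval_var,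
    Ex.holds_and, Ex.holds_eq, Ex.holds_ne, Ex.eval_mod, Ex.eval_hashE, Ex.eval_arr, Ex.holds_arr]
  simp only [Function.update_apply, Nat.reduceEqDiff, if_false, if_true, e0, e14,
    OfNat.zero_ne_ofNat, e15]
  refine mu_congr fun u _ => forall₂_congr fun j hj => forall₂_congr fun l hl => ?_
  rw [arrs_bucket h (by simp) hj, arrs_bucket h (by simp) hl, arrs_key h (by simp) hj,
    arrs_key h (by simp) hl, arrs_branch h (by simp) hj, arrs_branch h (by simp) hl]
  tauto

/-- The value of the place of a key in the hash table, once the table has been set up. -/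
theorem eval_slotE (h : π.Ok) {n y : ℕ} (hn : 16 ≤ n) {ε : ℕ → ℕ} {x : Ex} {v : ℕ}
    (e0 : ε 0 = π.m) (e12 : ε 12 = π.D.t) (e14 : ε 14 = π.U) (hy : y ≠ 14)
    (hx : x.eval (π.arrs n) ε = v)
    (hx' : x.eval (π.arrs n) (Function.update ε y (π.D.bucket v)) = v) :
    (Ex.slotE y x).eval (π.arrs n) ε = π.D.slot v := by
  have h1 := h.m_le_L
  have hb := D_bucket_lt h v
  have e1 : (Ex.bucketE x).eval (π.arrs n) ε = π.D.bucket v := by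
    simp only [Ex.bucketE, Ex.eval_mod, Ex.eval_hashE, Ex.eval_var, hx, e0, e12, e14]
    rfl
  simp only [Ex.slotE, Ex.eval_letE, e1, Ex.eval_add, Ex.eval_mod, Ex.eval_hashE, Ex.eval_arr,
    Ex.eval_var, Function.update_self, hx', Function.update_of_ne hy.symm, e14]
  rw [arrs_eq (a := 14) (by simp; omega) (by omega), arrs_eq (a := 15) (by simp; omega) (by omega),
    arrs_eq (a := 16) (by simp; omega) (by omega)]
  change (if π.D.bucket v < π.m then π.D.off (π.D.bucket v) else 0) + _ = _
  rw [if_pos hb]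
  rfl

theorem eval_tableE (h : π.Ok) {i : ℕ} (_ : i < π.L) :
    Ex.tableE.eval (π.arrs 16) (Function.update (π.vars 2) 25 i) = π.raw 17 i := by
  have e0 : Function.update (π.vars 2) 25 i 0 = π.m := by simp [vars]
  simp only [Ex.tableE, Ex.eval_mu, Ex.holds_and, Ex.holds_eq, Ex.eval_var, Ex.holds_arr, e0, raw,
    Function.update_self]
  refine mu_congr fun j hj => ?_
  rw [eval_slotE h (v := π.key j) (by simp) (by simp [vars]) (by simp [vars]) (by simp [vars])
    (by simp) (by simp [arrs_key h (by simp : 11 ≤ 16) hj])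
    (by simp [arrs_key h (by simp : 11 ≤ 16) hj]), arrs_branch h (by simp) hj]
  simp

theorem arrs_zero_two (h : π.Ok) : St.logs.run π.L π.B ⟨π.vars 0, π.arrs 1⟩ =
    ⟨π.vars 0, π.arrs 2⟩ := by
  rw [St.run_logs (h.fits 0 1) h.L_lt (by simp [vars])]
  ext1
  · rfl
  · funext b i
    by_cases hb : b = 2
    · subst hb
      simp [arrs, raw]
    · have : (b : ℕ) ≠ 2 := fun h => hb (Fin.ext h)
      simp only [Function.update_of_ne hb, arrs]
      exact if_congr (by omega) rfl rfl

/-- The preprocessing computes the tables. -/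
theorem run_prepare (h : π.Ok) :
    St.prepare.run π.L π.B ⟨π.vars 0, π.arrs 0⟩ = ⟨π.vars 2, π.arrs 17⟩ := by
  have hm := h.m_pos
  have hL := h.m_le_L
  have hLB := h.L_lt
  have hbm := b_le h
  have hdiv := Nat.div_le_self π.m π.b
  have e2 : π.arrs 2 2 π.m = Nat.log 2 π.m := arrs_eq (by simp) (by omega)
  -- the parameters of the tables
  have hvars : (((((⟨π.vars 0, π.arrs 2⟩ : Sto).setV 10 π.b).setV 11 (π.m / π.b + 1)).setV 13
      π.X).setV 14 π.U) = ⟨π.vars 1, π.arrs 2⟩ := by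
    ext x
    · simp only [Sto.setV_v, Function.update_apply, vars]
      by_cases h10 : x = 10
      · subst h10; simp
      by_cases h11 : x = 11
      · subst h11; simp
      by_cases h13 : x = 13
      · subst h13; simp
      by_cases h14 : x = 14
      · subst h14; simp
      simp [h10, h11, h13, h14]
    · rfl
  have hvars' : (⟨π.vars 1, π.arrs 12⟩ : Sto).setV 12 π.D.t = ⟨π.vars 2, π.arrs 12⟩ := by
    ext x
    · simp only [Sto.setV_v, Function.update_apply, vars]
      by_cases h12 : x = 12
      · subst h12; simp
      simp [h12]
    · rfl
  have a1 : (St.assign 0 (.arr 2 (.var 0) + .cst 1)).run π.L π.B ⟨π.vars 0, π.arrs 2⟩ =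
      (⟨π.vars 0, π.arrs 2⟩ : Sto).setV 10 π.b := by
    have : π.vars 0 0 = π.m := by simp [vars]
    simp only [St.run, Ex.eval_add, Ex.eval_arr, Ex.eval_var, Ex.eval_cst, this, e2]
    rw [show Nat.log 2 π.m + 1 = π.b from rfl, Nat.mod_eq_of_lt (by omega)]
    rfl
  have a2 : ∀ S : Sto, S.v 0 = π.m → S.v 10 = π.b →
      (St.assign 1 (.var 0 / .var 10 + .cst 1)).run π.L π.B S = S.setV 11 (π.m / π.b + 1) := by
    intro S h0 h10
    simp only [St.run, Ex.eval_add, Ex.eval_div, Ex.eval_var, Ex.eval_cst, h0, h10]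
    rw [Nat.mod_eq_of_lt (by omega)]
    rfl
  have a3 : ∀ S : Sto, S.v 0 = π.m → S.v 3 = π.q →
      (St.assign 3 ((.var 0 + .cst 1) * (.var 0 + .cst 1) * (.var 3 + .cst 1))).run π.L π.B S =
        S.setV 13 π.X := by
    intro S h0 h3
    simp only [St.run, Ex.eval_add, Ex.eval_mul, Ex.eval_var, Ex.eval_cst, h0, h3]
    rw [show (π.m + 1) * (π.m + 1) * (π.q + 1) = π.X from rfl, Nat.mod_eq_of_lt h.X_lt]
    rfl
  have a4 : ∀ S : Sto, S.v 13 = π.X →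
      (St.assign 4 (.cst 2 * .var 13 + .cst 2)).run π.L π.B S = S.setV 14 π.U := by
    intro S h13
    simp only [St.run, Ex.eval_add, Ex.eval_mul, Ex.eval_var, Ex.eval_cst, h13]
    rw [show 2 * π.X + 2 = π.U from rfl, Nat.mod_eq_of_lt h.U_le]
    rfl
  have a5 : (St.assign 2 Ex.firstHashE).run π.L π.B ⟨π.vars 1, π.arrs 12⟩ =
      ⟨π.vars 2, π.arrs 12⟩ := by
    rw [← hvars']
    simp only [St.run, eval_firstHashE h]
    rw [Nat.mod_eq_of_lt (D_t_le.trans_lt h.U_lt)]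
    rfl
  rw [St.prepare, St.run, h.run_fill (st := 0) (n := 0) 1 rfl (by decide) fun i => eval_patE h,
    St.run, arrs_zero_two h, St.run, a1, St.run, a2 _ (by simp [vars]) (by simp), St.run,
    a3 _ (by simp [vars]) (by simp [vars]), St.run, a4 _ (by simp), hvars,
    St.run, h.run_fill (st := 1) (n := 2) 3 rfl (by decide) fun i => eval_powE,
    St.run, h.run_fill (st := 1) (n := 3) 4 rfl (by decide) fun i => eval_rankE h,
    St.run, h.run_fill (st := 1) (n := 4) 5 rfl (by decide) fun i => eval_sufArrE h,
    St.run, h.run_fill (st := 1) (n := 5) 6 rfl (by decide) fun i => eval_neighbourE h,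
    St.run, h.run_fill (st := 1) (n := 6) 7 rfl (by decide) fun i => eval_maskE h,
    St.run, h.run_fill (st := 1) (n := 7) 8 rfl (by decide) fun i => eval_blocksE h,
    St.run, h.run_fill (st := 1) (n := 8) 9 rfl (by decide) fun i => eval_prevLenE h,
    St.run, h.run_fill (st := 1) (n := 9) 10 rfl (by decide) fun i => eval_prevPosE h,
    St.run, h.run_fill (st := 1) (n := 10) 11 rfl (by decide) fun i => eval_keyE h,
    St.run, h.run_fill (st := 1) (n := 11) 12 rfl (by decide) fun i => eval_branchE,
    St.run, a5,
    St.run, h.run_fill (st := 2) (n := 12) 13 rfl (by decide) fun i => eval_bucketE,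
    St.run, h.run_fill (st := 2) (n := 13) 14 rfl (by decide) fun i => eval_sizeE h,
    St.run, h.run_fill (st := 2) (n := 14) 15 rfl (by decide) fun i => eval_offE,
    St.run, h.run_fill (st := 2) (n := 15) 16 rfl (by decide) fun i => eval_secondHashE h,
    h.run_fill (st := 2) (n := 16) 17 rfl (by decide) fun i => eval_tableE h]

end Par
end MultiStream

namespace MultiStream

/-! ### Constant time queries -/

namespace Ex

/-- The minimum of two values. -/
def minE (a b : Ex) : Ex := ite (ltE a b) a b

@[simp] theorem eval_minE (A : Fin 32 → ℕ → ℕ) (ε : ℕ → ℕ) (a b : Ex) :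
    (minE a b).eval A ε = min (a.eval A ε) (b.eval A ε) := by
  simp only [minE, eval_ite, holds_lt]
  split <;> omega

/-- The minimum of the common extensions of neighbours in the suffix array, in an interval of
length `n ≤ b` starting at `l`. -/
def shortE (l n : Ex) : Ex := arr 6 (l + arr 2 (arr 7 l % arr 3 n))

/-- The entry of the table of block intervals for the `2 ^ j` blocks from `x` on. -/
def blockE (j x : Ex) : Ex := arr 8 (j * var 11 + x)

/-- The longest common extension at the positions that are the values of the variables
`x` and `y`. -/
def queryE (x y : ℕ) : Ex :=
  ite (eqE (var x) (var y)) (var 0) <|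
  letE 210 (arr 4 (var x)) <| letE 211 (arr 4 (var y)) <|
  letE 212 (minE (var 210) (var 211)) <|
  letE 213 (ite (ltE (var 210) (var 211)) (var 211) (var 210)) <|
  ite (leE (var 213) (var 212 + var 10)) (shortE (var 212) (var 213 - var 212)) <|
  letE 214 ((var 212 + var 10 - cst 1) / var 10) <| letE 215 (var 213 / var 10) <|
  letE 216 (arr 2 (var 215 - var 214)) <|
  minE (minE (shortE (var 212) (var 10)) (shortE (var 213 - var 10) (var 10)))
    (ite (ltE (var 214) (var 215))
      (minE (blockE (var 216) (var 214)) (blockE (var 216) (var 215 - arr 3 (var 216)))) (var 0))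

/-- The candidate branch for the factor of length `l` at `p` and the symbol `a`. -/
def findE (p l a : Ex) : Ex := arr 17 (slotE 210 (codeE p l a))

/-- Whether the value of `i` is the branch for the factor of length `l` at `p` and the
symbol `a`. -/
def foundE (i p l a : Ex) : Ex :=
  andE (arr 12 i) (andE (eqE (arr 10 i) p) (andE (eqE (arr 9 i) l) (eqE (arr 1 (i + l)) a)))

end Ex

/-- The arrays and variables hold the tables for the pattern. -/
structure Tables (π : Par) (A : Fin 32 → ℕ → ℕ) (ε : ℕ → ℕ) : Prop where
  arr : ∀ a : Fin 32, (a : ℕ) ≤ 17 → A a = π.arrs 17 a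
  m : ε 0 = π.m
  k : ε 1 = π.k
  q : ε 3 = π.q
  b : ε 10 = π.b
  nb : ε 11 = π.m / π.b + 1
  t : ε 12 = π.D.t
  U : ε 14 = π.U

namespace Tables

variable {π : Par} {A : Fin 32 → ℕ → ℕ} {ε : ℕ → ℕ}

theorem raw (h : Tables π A ε) {a : Fin 32} (ha : (a : ℕ) ≤ 17) {i : ℕ} (hi : i < π.L) :
    A a i = π.raw a i := by
  rw [h.arr a ha, Par.arrs_eq ha hi]

theorem pat (h : Tables π A ε) (hπ : π.Ok) : A 1 = π.c := by
  rw [h.arr 1 (by simp), hπ.arrs_one (by simp)]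

theorem eval_shortE (h : Tables π A ε) (hπ : π.Ok) {l n : Ex} {i d : ℕ} (hl : l.eval A ε = i)
    (hn : n.eval A ε = d) (hd : 0 < d) (hdb : d ≤ π.b) (him : i + d < π.m) :
    (Ex.shortE l n).eval A ε = rankLce π.c π.m i (i + d) := by
  have hL := hπ.m_le_L
  have hb := Par.b_lt hπ
  have hpow : 2 ^ d ≤ 2 ^ π.b := Nat.pow_le_pow_right (by omega) hdb
  have hd2 : d < 2 ^ d := Nat.lt_two_pow_self
  obtain ⟨n', rfl⟩ : ∃ n', d = n' + 1 := ⟨d - 1, by omega⟩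
  obtain ⟨h1, h2⟩ := rankLce_eq_mask hπ.sentinel i n' him
  have hmask := mask_lt (c := π.c) (m := π.m) i (n' + 1)
  have e7 : A 7 i = mask π.c π.m i π.b := by
    rw [h.raw (by simp) (by omega)]
    exact if_pos (by omega)
  have e3 : A 3 (n' + 1) = 2 ^ (n' + 1) := by
    rw [h.raw (by simp) (by omega)]
    exact min_eq_left (by omega)
  have e2 : A 2 (mask π.c π.m i (n' + 1)) = Nat.log 2 (mask π.c π.m i (n' + 1)) :=
    h.raw (by simp) (by omega)
  have e6 : A 6 (i + Nat.log 2 (mask π.c π.m i (n' + 1))) =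
      rankLce π.c π.m (i + Nat.log 2 (mask π.c π.m i (n' + 1)))
        (i + Nat.log 2 (mask π.c π.m i (n' + 1)) + 1) := by
    rw [h.raw (by simp) (by omega)]
    exact if_pos (by omega)
  simp only [Ex.shortE, Ex.eval_arr, Ex.eval_add, Ex.eval_mod, hl, hn, e7, e3, mask_mod i hdb, e2,
    e6]
  exact h1.symm

theorem eval_blockE (h : Tables π A ε) (hπ : π.Ok) {j x : Ex} {g i : ℕ} (hj : j.eval A ε = g)
    (hx : x.eval A ε = i) (hlt : i * π.b + π.b * 2 ^ g < π.m) :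
    (Ex.blockE j x).eval A ε = rankLce π.c π.m (i * π.b) (i * π.b + π.b * 2 ^ g) := by
  have hL := hπ.m_le_L
  have hbpos : 0 < π.b := Nat.succ_pos _
  have hbm := Par.b_le hπ
  have hi : i ≤ π.m / π.b := (Nat.le_div_iff_mul_le hbpos).2 (by omega)
  have hg2 : 2 ^ g ≤ π.b * 2 ^ g := Nat.le_mul_of_pos_left _ hbpos
  have hgb : g + 1 ≤ π.b := by
    have : g ≤ Nat.log 2 π.m := Nat.le_log_of_pow_le (by omega) (by omega)
    unfold Par.b; omega
  have hidx : g * (π.m / π.b + 1) + i < π.L := by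
    have h1 : (g + 1) * (π.m / π.b + 1) ≤ π.b * (π.m / π.b + 1) := Nat.mul_le_mul_right _ hgb
    have h2 := Nat.mul_div_le π.m π.b
    rw [add_mul, mul_add π.b] at h1
    omega
  have hdiv : (g * (π.m / π.b + 1) + i) / (π.m / π.b + 1) = g := by
    rw [mul_comm, Nat.mul_add_div (Nat.succ_pos _), Nat.div_eq_of_lt (by omega), add_zero]
  have hmod : (g * (π.m / π.b + 1) + i) % (π.m / π.b + 1) = i := by
    rw [mul_comm, Nat.mul_add_mod, Nat.mod_eq_of_lt (by omega)]
  simp only [Ex.blockE, Ex.eval_arr, Ex.eval_add, Ex.eval_mul, Ex.eval_var, hj, hx, h.nb]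
  rw [h.raw (by simp) hidx]
  change rankLce π.c π.m ((g * (π.m / π.b + 1) + i) % (π.m / π.b + 1) * π.b)
    (if (g * (π.m / π.b + 1) + i) % (π.m / π.b + 1) * π.b +
      π.b * min (2 ^ ((g * (π.m / π.b + 1) + i) / (π.m / π.b + 1))) π.L < π.m then
      (g * (π.m / π.b + 1) + i) % (π.m / π.b + 1) * π.b +
        π.b * min (2 ^ ((g * (π.m / π.b + 1) + i) / (π.m / π.b + 1))) π.L else 0) = _
  rw [hdiv, hmod, min_eq_left (by omega), if_pos hlt]

theorem update (h : Tables π A ε) {x v : ℕ} (_ : 15 ≤ x) :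
    Tables π A (Function.update ε x v) := by
  refine ⟨h.arr, ?_, ?_, ?_, ?_, ?_, ?_, ?_⟩ <;>
    (rw [Function.update_of_ne (by omega)])
  exacts [h.m, h.k, h.q, h.b, h.nb, h.t, h.U]

/-- The longest common extension is the minimum of the common extensions of neighbours between the
ranks of the two positions. -/
theorem eval_queryE (h : Tables π A ε) (hπ : π.Ok) {x y : ℕ} (_ : x < 200) (hy : y < 200)
    (hxm : ε x < π.m) (hym : ε y < π.m) :
    (Ex.queryE x y).eval A ε = lce π.c π.m (ε x) (ε y) := by
  have hL := hπ.m_le_L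
  have hbpos : 0 < π.b := Nat.succ_pos _
  have hbm := Par.b_le hπ
  simp only [Ex.queryE, Ex.eval_ite, Ex.holds_eq, Ex.eval_var]
  split
  · next heq => rw [heq, lce_self, h.m]
  next hne =>
  set u := sufRank π.c π.m (ε x) with hu
  set v := sufRank π.c π.m (ε y) with hv
  have hum : u < π.m := sufRank_lt hxm
  have hvm : v < π.m := sufRank_lt hym
  have huv : u ≠ v := fun he => hne (sufRank_inj hπ.sentinel hxm hym he)
  have eu : A 4 (ε x) = u := h.raw (by simp) (by omega)
  have ev : A 4 (ε y) = v := h.raw (by simp) (by omega)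
  have goal : lce π.c π.m (ε x) (ε y) = rankLce π.c π.m (min u v) (max u v) := by
    unfold rankLce
    rcases le_total u v with hle | hle
    · rw [min_eq_left hle, max_eq_right hle, hu, hv, sufArr_sufRank hπ.sentinel hxm,
        sufArr_sufRank hπ.sentinel hym]
    · rw [min_eq_right hle, max_eq_left hle, hu, hv, sufArr_sufRank hπ.sentinel hxm,
        sufArr_sufRank hπ.sentinel hym, lce_symm]
  have hmax : (if u < v then v else u) = max u v := by split <;> omega
  rw [goal]
  simp only [Ex.eval_letE, Ex.eval_arr, Ex.eval_var, eu,
    Function.update_of_ne (show y ≠ 210 by omega), ev, Ex.eval_minE, Ex.eval_ite, Ex.holds_lt,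
    Function.update_self, ne_eq, Nat.reduceEqDiff, not_false_eq_true, Function.update_of_ne, hmax,
    Ex.holds_le, Ex.eval_add, h.b]
  set l := min u v with hl
  set r := max u v with hr
  have hlr : l < r := by omega
  have hrm : r < π.m := by omega
  have h1 := (((h.update (x := 210) (v := u) (by omega)).update (x := 211) (v := v)
    (by omega)).update (x := 212) (v := l) (by omega)).update (x := 213) (v := r) (by omega)
  split
  · next hshort =>
    have hd : r - l ≤ π.b := by omega
    rw [h1.eval_shortE hπ (i := l) (d := r - l) (by simp) (by simp) (by omega) hd (by omega)]
    congr 1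
    omega
  · next hlong =>
    simp only [Ex.eval_sub, Ex.eval_div, Ex.eval_var, Ex.eval_add, Ex.eval_cst,
      Function.update_self, ne_eq, Nat.reduceEqDiff, not_false_eq_true, Function.update_of_ne, h.b]
    set X := (l + π.b - 1) / π.b with hX
    set Y := r / π.b with hY
    have h2 := ((h1.update (x := 214) (v := X) (by omega)).update (x := 215) (v := Y)
      (by omega)).update (x := 216) (v := A 2 (Y - X)) (by omega)
    rw [h2.eval_shortE hπ (i := l) (d := π.b) (by simp) (by simp [h.b]) hbpos le_rfl (by omega),
      h2.eval_shortE hπ (i := r - π.b) (d := π.b) (by simp [h.b]) (by simp [h.b]) hbpos le_rfl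
        (by omega), show r - π.b + π.b = r by omega,
      rankLce_long hπ.sentinel hbpos (l := l) (r := r) (by omega) hrm, ← hX, ← hY]
    congr 1
    split
    · next hXY =>
      have hYb : Y * π.b ≤ r := Nat.div_mul_le_self _ _
      have hYm : Y ≤ π.m := (Nat.div_le_self _ _).trans hrm.le
      clear_value X Y
      have e2 : A 2 (Y - X) = Nat.log 2 (Y - X) := h.raw (by simp) (by omega)
      set j := Nat.log 2 (Y - X) with hj
      have hpow : 2 ^ j ≤ Y - X := Nat.pow_log_le_self 2 (by omega)
      have hj2 : j < 2 ^ j := Nat.lt_two_pow_self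
      have e3 : A 3 j = 2 ^ j := by
        rw [h.raw (by simp) (by omega)]
        exact min_eq_left (by omega)
      have hb1 : X * π.b + π.b * 2 ^ j < π.m := by
        have := Nat.mul_le_mul_right π.b (show X + 2 ^ j ≤ Y by omega)
        rw [add_mul, mul_comm (2 ^ j)] at this
        omega
      have hb2 : (Y - 2 ^ j) * π.b + π.b * 2 ^ j < π.m := by
        rw [mul_comm π.b, ← add_mul, Nat.sub_add_cancel (by omega)]
        omega
      rw [h2.eval_blockE hπ (g := j) (i := X) (by simp [e2]) (by simp) hb1,
        h2.eval_blockE hπ (g := j) (i := Y - 2 ^ j) (by simp [e2]) (by simp [e2, e3]) hb2,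
        rankLce_blocks hπ.sentinel hXY (by omega)]
    · exact h.m

/-- The lookup is checked against the tables, so that a query for a missing key is rejected. -/
theorem holds_foundE (h : Tables π A ε) (hπ : π.Ok) {i p l a : Ex} :
    (Ex.foundE i p l a).Holds A ε ↔ IsBranch π.c π.m (i.eval A ε) ∧
      prevPos π.c π.m (i.eval A ε) = p.eval A ε ∧ prevLen π.c π.m (i.eval A ε) = l.eval A ε ∧
      π.c (i.eval A ε + l.eval A ε) = a.eval A ε := by
  classical
  have hL := hπ.m_le_L
  simp only [Ex.foundE, Ex.holds_and, Ex.holds_arr, Ex.holds_eq, Ex.eval_arr, Ex.eval_add, h.pat hπ]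
  by_cases hi : i.eval A ε < π.L
  · rw [h.raw (a := 10) (by simp) hi, h.raw (a := 9) (by simp) hi, h.raw (a := 12) (by simp) hi]
    change ((if _ then 1 else 0) ≠ 0 ∧ _) ↔ _
    simp only [ne_eq, ite_eq_right_iff, one_ne_zero, imp_false, not_not]
    rfl
  · refine ⟨fun h0 => absurd ?_ h0.1, fun h0 => absurd h0.1.lt (by omega)⟩
    rw [h.arr 12 (by simp)]
    exact if_neg (by omega)

/-- The hash table returns the branch for a key, if there is one. -/
theorem eval_findE (h : Tables π A ε) (hπ : π.Ok) {i pv lv av : ℕ} {p l a : Ex}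
    (hb : IsBranch π.c π.m i) (hp : prevPos π.c π.m i = pv) (hl : prevLen π.c π.m i = lv)
    (ha : π.c (i + lv) = av)
    (hcode : ∀ ε', (∀ x, x ≠ 210 → ε' x = ε x) → (Ex.codeE p l a).eval A ε' = π.code pv lv av) :
    (Ex.findE p l a).eval A ε = i := by
  have hL := hπ.m_le_L
  have hk : π.code pv lv av = π.key i := by rw [Par.key, hp, hl, ha]
  obtain ⟨hs, hinj⟩ := hπ.hash_spec
  have hbd := Par.D_bucket_lt hπ (π.key i)
  have h15 := h.raw (a := 15) (by simp) (i := π.D.bucket (π.key i)) (by omega)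
  have hslot : (Ex.slotE 210 (Ex.codeE p l a)).eval A ε = π.D.slot (π.key i) := by
    have e1 : (Ex.bucketE (Ex.codeE p l a)).eval A ε = π.D.bucket (π.key i) := by
      simp only [Ex.bucketE, Ex.eval_mod, Ex.eval_hashE, Ex.eval_var, hcode ε (fun _ _ => rfl), hk,
        h.m, h.t, h.U]
      rfl
    simp only [Ex.slotE, Ex.eval_letE, e1, Ex.eval_add, Ex.eval_mod, Ex.eval_hashE, Ex.eval_arr,
      Ex.eval_var, Function.update_self,
      hcode (Function.update ε 210 _) (fun x hx => Function.update_of_ne hx _ _), hk,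
      Function.update_of_ne (show 14 ≠ 210 by simp), h.U]
    rw [h15, h.raw (a := 14) (by simp) (by omega), h.raw (a := 16) (by simp) (by omega)]
    change (if π.D.bucket _ < π.m then π.D.off _ else 0) + _ = _
    rw [if_pos hbd]
    rfl
  have hlt := hs i hb.lt hb
  simp only [Ex.findE, Ex.eval_arr, hslot]
  rw [h.raw (by simp) (by omega)]
  exact mu_eq hb.lt.le (fun j hj hcon => hj.ne (hinj j (hj.trans hb.lt) i hb.lt hcon.1 hb hcon.2))
    fun _ => ⟨hb, rfl⟩

end Tables

end MultiStream

namespace MultiStream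

/-! ### Processing an arrival -/

namespace St

/-- The statement changes no array and none of the variables below `10 + n`. -/
def keeps (n : ℕ) : St → Bool
  | assign x _ => decide (n ≤ x)
  | store _ _ _ => false
  | seq p q => p.keeps n && q.keeps n
  | ite _ p q => p.keeps n && q.keeps n
  | loop x _ p => decide (n ≤ x) && p.keeps n

theorem run_of_keeps {n L B : ℕ} (p : St) : ∀ {S : Sto}, p.keeps n = true →
    (p.run L B S).a = S.a ∧ ∀ y < 10 + n, (p.run L B S).v y = S.v y := by
  induction p with
  | assign x e =>
    intro S h
    simp only [keeps, decide_eq_true_eq] at h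
    exact ⟨rfl, fun y hy => Function.update_of_ne (by omega) _ _⟩
  | store => intro S h; simp [keeps] at h
  | seq p q ihp ihq =>
    intro S h
    simp only [keeps, Bool.and_eq_true] at h
    obtain ⟨h1, h2⟩ := ihp (S := S) h.1
    obtain ⟨h3, h4⟩ := ihq (S := p.run L B S) h.2
    exact ⟨h3.trans h1, fun y hy => (h4 y hy).trans (h2 y hy)⟩
  | ite e p q ihp ihq =>
    intro S h
    simp only [keeps, Bool.and_eq_true] at h
    simp only [run]
    split
    · exact ihp h.1
    · exact ihq h.2
  | loop x e p ih =>
    intro S h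
    simp only [keeps, Bool.and_eq_true, decide_eq_true_eq] at h
    have key : ∀ t, (iter (p.run L B) (10 + x) S t).a = S.a ∧
        ∀ y < 10 + n, (iter (p.run L B) (10 + x) S t).v y = S.v y := by
      intro t
      induction t with
      | zero => exact ⟨rfl, fun _ _ => rfl⟩
      | succ t iht =>
        obtain ⟨h1, h2⟩ := ih (S := (iter (p.run L B) (10 + x) S t).setV (10 + x) t) h.2
        refine ⟨h1.trans iht.1, fun y hy => (h2 y hy).trans ?_⟩
        exact (Function.update_of_ne (by omega) _ _).trans (iht.2 y hy)
    obtain ⟨h1, h2⟩ := key (e.eval S.a S.v % B)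
    exact ⟨h1, fun y hy => (Function.update_of_ne (by omega) _ _).trans (h2 y hy)⟩

/-- The arrived symbol, as a positive number. -/
def symE : Ex := .var 5 + .cst 1
/-- The first position in the pattern of the open piece of the stream. -/
def openPosE : Ex := .arr 18 (.var 4)
/-- The length of the open piece of the stream. -/
def openLenE : Ex := .arr 19 (.var 4)

/-- The open piece, extended by the arrived symbol, occurs first at the value of variable `22`. -/
def branch : St := .seq (.store 18 (.var 4) (.var 22)) (.store 19 (.var 4) (openLenE + .cst 1))

/-- Closes the open piece. The closed pieces of stream `r` are kept in a ring of `k + 1` cells, from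
cell `r * (k + 1)` on, and the newest one is in the place given by array `20`. -/
def close : St :=
  .seq (.store 20 (.var 4) ((.arr 20 (.var 4) + .var 1) % (.var 1 + .cst 1))) <|
  .seq (.assign 13 (.var 4 * (.var 1 + .cst 1) + .arr 20 (.var 4))) <|
  .seq (.store 21 (.var 23) openPosE) <| .seq (.store 22 (.var 23) openLenE) <|
  .seq (.store 23 (.var 23) symE) <| .seq (.store 18 (.var 4) (.cst 0)) <|
  .store 19 (.var 4) (.cst 0)

/-- Appends the arrived symbol to its stream: the open piece grows by the symbol or is closed. -/
def update : St :=
  .ite (.eqE (.arr 1 (openPosE + openLenE)) symE)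
    (.store 19 (.var 4) (openLenE + .cst 1)) <|
  .seq (.assign 12 (.findE openPosE openLenE symE)) <|
  .ite (.foundE (.var 22) openPosE openLenE symE) branch close

/-- Sets the variables `15, …, 20` for the comparison: the place up to which pieces have been
considered, the place that is compared next, the position in the pattern of the factor it faces, the
length of the rest of this factor, and the numbers of pieces and of mismatches. -/
def start : St :=
  .seq (.assign 5 (.var 0 - openLenE)) <| .seq (.assign 6 (.var 15)) <|
  .seq (.assign 7 openPosE) <| .seq (.assign 8 openLenE) <|
  .seq (.assign 9 (.cst 0)) <| .assign 10 (.cst 0)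

/-- One step of the comparison: to the next mismatch or to the end of the piece, or to the
next piece. -/
def compare : St :=
  .ite (.ltE (.cst 0) (.var 18))
    (.seq (.assign 12 (.queryE 17 16)) <|
      .ite (.ltE (.var 22) (.var 18))
        (.seq (.assign 10 (.var 20 + .cst 1)) <| .seq (.assign 7 (.var 17 + .var 22 + .cst 1)) <|
          .seq (.assign 6 (.var 16 + .var 22 + .cst 1)) <|
          .assign 8 (.var 18 - (.var 22 + .cst 1)))
        (.assign 8 (.cst 0))) <|
  .ite (.andE (.ltE (.cst 0) (.var 15)) (.leE (.var 19) (.var 1)))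
    (.seq (.assign 12
        (.var 4 * (.var 1 + .cst 1) + (.arr 20 (.var 4) + .var 19) % (.var 1 + .cst 1))) <|
      .ite (.arr 23 (.var 22))
        (.seq (.assign 10 (.var 20 +
            .ite (.eqE (.arr 1 (.var 15 - .cst 1)) (.arr 23 (.var 22))) (.cst 0) (.cst 1))) <|
          .seq (.assign 8 (.minE (.arr 22 (.var 22)) (.var 15 - .cst 1))) <|
          .seq (.assign 7 (.arr 21 (.var 22) + (.arr 22 (.var 22) - .var 18))) <|
          .seq (.assign 5 (.var 15 - .cst 1 - .var 18)) <|
          .seq (.assign 6 (.var 15)) <| .assign 9 (.var 19 + .cst 1))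
        (.assign 12 (.cst 0)))
    (.assign 12 (.cst 0))

/-- The number of mismatches, if the comparison has reached the start of the pattern and there are at
most `k` of them, and `k + 1` otherwise. -/
def report : St :=
  .assign 11 (.ite (.andE (.eqE (.var 15) (.cst 0)) (.andE (.eqE (.var 18) (.cst 0))
    (.leE (.var 20) (.var 1)))) (.var 20) (.var 1 + .cst 1))

/-- The processing of an arrival. A comparison that has not stopped after `3 * k + 4` steps has found
more than `k` mismatches. -/
def arrival : St :=
  .seq update <| .seq start <| .seq (.loop 14 (.cst 3 * .var 1 + .cst 4) compare) report

end St

/-- The newest `k + 1` of the closed pieces `ps` of stream `r` are stored in the arrays `A`. -/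
structure Stored (π : Par) (A : Fin 32 → ℕ → ℕ) (r : ℕ) (ps : List Piece) : Prop where
  head_le : A 20 r ≤ π.k
  none : ∀ j ≤ π.k, ps[j]? = none → A 23 (r * (π.k + 1) + (A 20 r + j) % (π.k + 1)) = 0
  some : ∀ j ≤ π.k, ∀ b, ps[j]? = some b →
    A 21 (r * (π.k + 1) + (A 20 r + j) % (π.k + 1)) = b.pos ∧
    A 22 (r * (π.k + 1) + (A 20 r + j) % (π.k + 1)) = b.len ∧
    A 23 (r * (π.k + 1) + (A 20 r + j) % (π.k + 1)) = b.sym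

/-- The arrays `A` represent the text of stream `r`, of which `R` is the reverse. -/
def Stream (π : Par) (A : Fin 32 → ℕ → ℕ) (r : ℕ) (R : List ℕ) : Prop :=
  ∃ ps, Divided π.c π.m R ps (A 18 r) (A 19 r) ∧ Stored π A r ps

/-- The arrays agree apart from the cells for stream `r`. -/
def Elsewhere (π : Par) (r : ℕ) (A A' : Fin 32 → ℕ → ℕ) : Prop :=
  ∀ (a : Fin 32) i,
    ((a : ℕ) ≤ 17 ∨ (a : ℕ) ≤ 20 ∧ i ≠ r ∨ 20 < (a : ℕ) ∧ i / (π.k + 1) ≠ r) → A' a i = A a i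

namespace Elsewhere

variable {π : Par} {r : ℕ} {A A' : Fin 32 → ℕ → ℕ}

theorem trans {A'' : Fin 32 → ℕ → ℕ} (h : Elsewhere π r A A') (h' : Elsewhere π r A' A'') :
    Elsewhere π r A A'' := fun a i hi => (h' a i hi).trans (h a i hi)

theorem refl : Elsewhere π r A A := fun _ _ _ => rfl

theorem setA_low {S : Sto} (h : Elsewhere π r A S.a) {a : Fin 32} (ha : 17 < (a : ℕ))
    (ha' : (a : ℕ) ≤ 20) (v : ℕ) : Elsewhere π r A (S.setA a r v).a := by
  refine h.trans fun b i hi => ?_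
  by_cases hb : b = a
  · subst hb
    simp [Function.update_of_ne (show i ≠ r by omega)]
  · simp [hb]

theorem setA_high {S : Sto} (h : Elsewhere π r A S.a) {a : Fin 32} (ha : 20 < (a : ℕ)) {i : ℕ}
    (hr : i / (π.k + 1) = r) (v : ℕ) : Elsewhere π r A (S.setA a i v).a := by
  refine h.trans fun b j hj => ?_
  by_cases hb : b = a
  · subst hb
    have : j ≠ i := by rintro rfl; omega
    simp [Function.update_of_ne this]
  · simp [hb]

theorem stream (h : Elsewhere π r A A') {r' : ℕ} (hr : r' ≠ r) {R : List ℕ}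
    (hs : Stream π A r' R) : Stream π A' r' R := by
  obtain ⟨ps, hd, hst⟩ := hs
  have h18 := h 18 r' (by simp [hr])
  have h19 := h 19 r' (by simp [hr])
  have h20 := h 20 r' (by simp [hr])
  have hq : ∀ i, (r' * (π.k + 1) + (A 20 r' + i) % (π.k + 1)) / (π.k + 1) ≠ r := by
    intro i
    rwa [mul_comm, Nat.mul_add_div (Nat.succ_pos _),
      Nat.div_eq_of_lt (Nat.mod_lt _ (Nat.succ_pos _)), add_zero]
  refine ⟨ps, by rwa [h18, h19], by rw [h20]; exact hst.head_le, ?_, ?_⟩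
  · rw [h20]
    intro j hj hn
    rw [h 23 _ (by simp [hq])]
    exact hst.none j hj hn
  · rw [h20]
    intro j hj b hb
    rw [h 21 _ (by simp [hq]), h 22 _ (by simp [hq]), h 23 _ (by simp [hq])]
    exact hst.some j hj b hb

theorem tables (h : Elsewhere π r A A') {ε : ℕ → ℕ} (hT : Tables π A ε) : Tables π A' ε :=
  ⟨fun a ha => (funext fun i => h a i (Or.inl ha)).trans (hT.arr a ha), hT.m, hT.k, hT.q, hT.b,
    hT.nb, hT.t, hT.U⟩

end Elsewhere

theorem Tables.of_eq {π : Par} {A : Fin 32 → ℕ → ℕ} {ε ε' : ℕ → ℕ} (h : Tables π A ε)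
    (he : ∀ y < 15, ε' y = ε y) : Tables π A ε' := by
  refine ⟨h.arr, ?_, ?_, ?_, ?_, ?_, ?_, ?_⟩ <;> rw [he _ (by omega)]
  exacts [h.m, h.k, h.q, h.b, h.nb, h.t, h.U]

section

variable {π : Par} {S : Sto} {r a : ℕ} {R : List ℕ}

/-- The newest piece overwrites the oldest one in the ring. -/
theorem Stored.push {A A' : Fin 32 → ℕ → ℕ} {ps : List Piece} (h : Stored π A r ps) (b : Piece)
    (h20 : A' 20 r = (A 20 r + π.k) % (π.k + 1))
    (h21 : A' 21 = Function.update (A 21) (r * (π.k + 1) + A' 20 r) b.pos)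
    (h22 : A' 22 = Function.update (A 22) (r * (π.k + 1) + A' 20 r) b.len)
    (h23 : A' 23 = Function.update (A 23) (r * (π.k + 1) + A' 20 r) b.sym) :
    Stored π A' r (b :: ps) := by
  have hlt : A' 20 r < π.k + 1 := h20 ▸ Nat.mod_lt _ (Nat.succ_pos _)
  have h0 : (A' 20 r + 0) % (π.k + 1) = A' 20 r := Nat.mod_eq_of_lt hlt
  have hs : ∀ j, (A' 20 r + (j + 1)) % (π.k + 1) = (A 20 r + j) % (π.k + 1) := by
    intro j
    rw [h20, Nat.mod_add_mod, show A 20 r + π.k + (j + 1) = A 20 r + j + (π.k + 1) by ring,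
      Nat.add_mod_right]
  have hne : ∀ j, j + 1 ≤ π.k → (A 20 r + j) % (π.k + 1) ≠ A' 20 r := by
    intro j hj he
    rw [← hs] at he
    rcases lt_or_ge (A' 20 r + (j + 1)) (π.k + 1) with h | h
    · rw [Nat.mod_eq_of_lt h] at he; omega
    · rw [Nat.mod_eq_sub_mod h, Nat.mod_eq_of_lt (by omega)] at he; omega
  refine ⟨by omega, ?_, ?_⟩
  · rintro (_ | j) hj hn
    · simp at hn
    · have := hne j hj
      rw [hs, h23, Function.update_of_ne (by omega)]
      exact h.none j (by omega) (by simpa using hn)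
  · rintro (_ | j) hj b' hb
    · simp only [List.getElem?_cons_zero, Option.some.injEq] at hb
      subst hb
      rw [h0, h21, h22, h23]
      simp
    · have := hne j hj
      rw [hs, h21, h22, h23, Function.update_of_ne (by omega), Function.update_of_ne (by omega),
        Function.update_of_ne (by omega)]
      exact h.some j (by omega) b' (by simpa using hb)

/-- The arrived symbol is appended to its stream, and the other streams and the tables are kept. -/
theorem run_update (hπ : π.Ok) (hS : Fits π.L π.B S) (hT : Tables π S.a S.v) (h4 : S.v 4 = r)
    (hr : r < π.s) (ha : S.v 5 < π.q) (hR : Stream π S.a r R) :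
    Stream π (St.update.run π.L π.B S).a r ((S.v 5 + 1) :: R) ∧
      Elsewhere π r S.a (St.update.run π.L π.B S).a ∧
      ∀ y < 15, (St.update.run π.L π.B S).v y = S.v y := by
  classical
  obtain ⟨ps, hd, hst⟩ := hR
  have hL := hπ.m_le_L
  have hLB := hπ.L_lt
  have hks : (π.k + 1) * π.s ≤ π.L := by rw [hπ.L_eq]; omega
  have hrs : r * (π.k + 1) + π.k < (π.k + 1) * π.s := by
    have := Nat.mul_le_mul_left (π.k + 1) (Nat.succ_le_of_lt hr)
    rw [Nat.mul_succ, mul_comm _ r] at this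
    omega
  have hrL : r < π.L := by
    have : r ≤ r * (π.k + 1) := Nat.le_mul_of_pos_right _ (Nat.succ_pos _)
    omega
  have hqB : π.q < π.B := by
    have : π.q ≤ π.X := by
      unfold Par.X
      exact (Nat.le_succ _).trans (Nat.le_mul_of_pos_left _ (by positivity))
    have := hπ.X_lt
    omega
  have hfirst := hd.first.1
  have hpat := hT.pat hπ
  set cp := S.a 18 r with hcp
  set cl := S.a 19 r with hcl
  set sy := S.v 5 + 1 with hsy
  have hsy0 : sy ≠ 0 := by omega
  have hcode : ∀ ε' : ℕ → ℕ, (∀ x, x ≠ 210 → ε' x = S.v x) →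
      (Ex.codeE St.openPosE St.openLenE St.symE).eval S.a ε' = π.code cp cl sy := by
    intro ε' he
    simp [Ex.codeE, St.openPosE, St.openLenE, St.symE, he, h4, hT.m, hT.q, Par.code, hcp, hcl, hsy]
  have hmodcl : cl < π.m → (cl + 1) % π.B = cl + 1 := fun h => Nat.mod_eq_of_lt (by omega)
  have hcpos : ∀ i, π.c i ≠ 0 → i < π.m := fun i hi => by
    by_contra hge
    exact hi (Par.c_zero (not_lt.1 hge))
  by_cases h1 : π.c (cp + cl) = sy
  · have hm := hcpos (cp + cl) (h1 ▸ hsy0)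
    have e : St.update.run π.L π.B S = S.setA 19 r (cl + 1) := by
      have hh : (Ex.eqE (.arr 1 (St.openPosE + St.openLenE)) St.symE).eval S.a S.v ≠ 0 := by
        refine (Ex.holds_eq _ _ _ _).2 ?_
        simpa [St.openPosE, St.openLenE, St.symE, h4, hpat] using h1
      rw [St.update, St.run, if_pos hh]
      simp [St.run, St.openLenE, h4, hrL, ← hcl, hmodcl (by omega)]
    rw [e]
    refine ⟨⟨ps, ?_, ?_⟩, Elsewhere.refl.setA_low (by simp) (by simp) _, fun _ _ => rfl⟩
    · simpa using hd.extend hπ.sentinel hsy0 h1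
    · exact ⟨by simpa using hst.head_le, by simpa using hst.none, by simpa using hst.some⟩
  have hh : ¬ (Ex.eqE (.arr 1 (St.openPosE + St.openLenE)) St.symE).eval S.a S.v ≠ 0 := by
    refine fun hh => h1 ?_
    simpa [St.openPosE, St.openLenE, St.symE, h4, hpat] using (Ex.holds_eq _ _ _ _).1 hh
  set i := (Ex.findE St.openPosE St.openLenE St.symE).eval S.a S.v with hi
  have hiB : i < π.B := hS.cell_lt _ _
  have hfound : (Ex.foundE (.var 22) St.openPosE St.openLenE St.symE).eval S.a
      (Function.update S.v 22 i) ≠ 0 ↔ IsBranch π.c π.m i ∧ prevPos π.c π.m i = cp ∧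
        prevLen π.c π.m i = cl ∧ π.c (i + cl) = sy := by
    refine ((hT.update (x := 22) (v := i) (by omega)).holds_foundE hπ).trans ?_
    simp [St.openPosE, St.openLenE, St.symE, h4, hcp, hcl, hsy]
  have e : St.update.run π.L π.B S =
      (St.ite (.foundE (.var 22) St.openPosE St.openLenE St.symE) .branch .close).run π.L π.B
        (S.setV 22 i) := by
    rw [St.update, St.run, if_neg hh, St.run]
    rw [St.run, ← hi, Nat.mod_eq_of_lt hiB]
    rfl
  by_cases h2 : IsBranch π.c π.m i ∧ prevPos π.c π.m i = cp ∧
        prevLen π.c π.m i = cl ∧ π.c (i + cl) = sy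
  · have hm := hcpos (i + cl) (h2.2.2.2 ▸ hsy0)
    have e' : St.update.run π.L π.B S = ((S.setV 22 i).setA 18 r i).setA 19 r (cl + 1) := by
      refine e.trans ?_
      rw [St.run]
      refine (if_pos (hfound.2 h2)).trans ?_
      simp [St.branch, St.run, St.openLenE, h4, hrL, ← hcl, hmodcl (by omega), Nat.mod_eq_of_lt hiB,
        Sto.setA, Sto.setV]
    rw [e']
    refine ⟨⟨ps, ?_, ?_⟩, ?_, fun y hy => ?_⟩
    · simpa using hd.branch h2.1 h2.2.1 h2.2.2.1 h2.2.2.2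
    · exact ⟨by simpa using hst.head_le, by simpa using hst.none, by simpa using hst.some⟩
    · have h0 : Elsewhere π r S.a (S.setV 22 i).a := Elsewhere.refl
      exact (h0.setA_low (a := 18) (by simp) (by simp) i).setA_low (a := 19) (by simp) (by simp) _
    · simp [Function.update_of_ne (show y ≠ 22 by omega)]
  · have hno : ¬ ∃ i, IsBranch π.c π.m i ∧ prevPos π.c π.m i = cp ∧ prevLen π.c π.m i = cl ∧
        π.c (i + cl) = sy := by
      rintro ⟨i', hb, hp, hl, hia⟩
      have := hT.eval_findE hπ hb hp hl hia hcode
      rw [← hi] at this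
      exact h2 (this ▸ ⟨hb, hp, hl, hia⟩)
    set hd' := (S.a 20 r + π.k) % (π.k + 1) with hhd
    have hdlt : hd' < π.k + 1 := Nat.mod_lt _ (Nat.succ_pos _)
    have hkB := hπ.k_lt
    set n := r * (π.k + 1) + hd' with hn
    have e' : St.update.run π.L π.B S = ((((((((S.setV 22 i).setA 20 r hd').setV 23 n).setA 21 n
        cp).setA 22 n cl).setA 23 n sy).setA 18 r 0).setA 19 r 0) := by
      refine e.trans ?_
      rw [St.run]
      refine (if_neg (fun hf => h2 (hfound.1 hf))).trans ?_
      have e1 : hd' % π.B = hd' := Nat.mod_eq_of_lt (by omega)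
      have e2 : n % π.B = n := Nat.mod_eq_of_lt (by omega)
      have e3 : cp % π.B = cp := Nat.mod_eq_of_lt (by omega)
      have e4 : cl % π.B = cl := Nat.mod_eq_of_lt (by omega)
      have e5 : sy % π.B = sy := Nat.mod_eq_of_lt (by omega)
      have hnL : n < π.L := by omega
      simp [St.close, St.run, St.openLenE, St.openPosE, St.symE, h4, hrL, ← hcl, ← hcp, ← hsy, ← hhd, hT.k,
        e1, e2, e3, e4, e5, ← hn, hnL, Sto.setA, Sto.setV]
    rw [e']
    have hdiv : n / (π.k + 1) = r := by
      rw [hn, mul_comm, Nat.mul_add_div (Nat.succ_pos _), Nat.div_eq_of_lt hdlt, add_zero]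
    refine ⟨⟨⟨cp, cl, sy⟩ :: ps, ?_, ?_⟩, ?_, fun y hy => ?_⟩
    · simpa using hd.close hπ.sentinel hsy0 h1 hno
    · refine hst.push ⟨cp, cl, sy⟩ ?_ ?_ ?_ ?_ <;> simp [hhd, hn]
    · have h0 : Elsewhere π r S.a (S.setV 22 i).a := Elsewhere.refl
      have h1 : Elsewhere π r S.a (((S.setV 22 i).setA 20 r hd').setV 23 n).a :=
        h0.setA_low (a := 20) (by simp) (by simp) hd'
      exact ((((h1.setA_high (a := 21) (by simp) hdiv cp).setA_high (a := 22) (by simp) hdiv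
        cl).setA_high (a := 23) (by simp) hdiv sy).setA_low (a := 18) (by simp) (by simp)
          0).setA_low (a := 19) (by simp) (by simp) 0
    · simp [Function.update_of_ne (show y ≠ 22 by omega),
        Function.update_of_ne (show y ≠ 23 by omega)]

end

end MultiStream

namespace MultiStream

/-! ### The comparison with the pattern -/

section

variable {π : Par} {S : Sto} {r : ℕ} {R : List ℕ} {ps : List Piece}

/-- After `t` steps the variables `15, …, 20` hold a state of the comparison, which has made
progress unless it cannot go on. Each step finds a mismatch, finishes a piece or enters a new one,
so the number of steps is bounded in terms of the numbers of mismatches and of pieces. -/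
def Progress (π : Par) (R : List ℕ) (ps : List Piece) (t : ℕ) (S : Sto) : Prop :=
  Comparing π.c π.m π.k R ps (S.v 15) (S.v 16) (S.v 17) (S.v 18) (S.v 19) (S.v 20) ∧
    (Stuck π.k ps (S.v 15) (S.v 18) (S.v 19) ∨
      t ≤ S.v 20 + 2 * S.v 19 + if S.v 18 = 0 then 1 else 0)

/-- Every step of the comparison makes progress. -/
theorem Progress.step (hπ : π.Ok) (hT : Tables π S.a S.v) (h4 : S.v 4 = r)
    (hr : r < π.s) (hps : ∀ b ∈ ps, b.Maximal π.c π.m) (hst : Stored π S.a r ps) {t : ℕ}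
    (h : Progress π R ps t S) : Progress π R ps (t + 1) (St.compare.run π.L π.B S) := by
  classical
  obtain ⟨hc, hp⟩ := h
  have hL := hπ.m_le_L
  have hLB := hπ.L_lt
  have hkB := hπ.k_lt
  have hx := hc.x_le
  have hy := hc.y_le
  have ha := hc.a_le
  have hj := hc.j_le
  have hcnt := hc.cnt_le.trans (misFrom_le R _)
  have hpat := hT.pat hπ
  have hm := hπ.m_pos
  have mod {v : ℕ} (hv : v < π.B) : v % π.B = v := Nat.mod_eq_of_lt hv
  by_cases hrem : 0 < S.v 18
  · have e1 : (Ex.ltE (.cst 0) (.var 18)).eval S.a S.v ≠ 0 := (Ex.holds_lt _ _ _ _).2 hrem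
    have e2 := hT.eval_queryE hπ (x := 17) (y := 16) (by omega) (by omega) (by omega) (by omega)
    set d := lce π.c π.m (S.v 17) (S.v 16) with hd
    have hdm : d ≤ π.m := lce_le _ _
    by_cases hlt : d < S.v 18
    · have e3 : (Ex.ltE (.var 22) (.var 18)).eval S.a (Function.update S.v 22 d) ≠ 0 :=
        (Ex.holds_lt _ _ _ _).2 (by simpa using hlt)
      have hdiff := hc.differ hd.symm hlt
      have hcnt' := hdiff.cnt_le.trans (misFrom_le R _)
      have e : St.compare.run π.L π.B S = ((((S.setV 22 d).setV 20 (S.v 20 + 1)).setV 17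
          (S.v 17 + d + 1)).setV 16 (S.v 16 + d + 1)).setV 18 (S.v 18 - (d + 1)) := by
        rw [St.compare, St.run, if_pos e1, St.run, St.run, St.run, e2, mod (by omega)]
        refine (if_pos e3).trans ?_
        simp [St.run, Sto.setV, mod (show S.v 20 + 1 < π.B by omega),
          mod (show S.v 17 + d + 1 < π.B by omega), mod (show S.v 16 + d + 1 < π.B by omega),
          mod (show S.v 18 - (d + 1) < π.B by omega)]
      rw [e]
      refine ⟨by simpa using hdiff, Or.inr ?_⟩
      have hp' := hp.resolve_left fun hs => by have := hs.1; omega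
      rw [if_neg (by omega)] at hp'
      simp
      omega
    · have e3 : ¬ (Ex.ltE (.var 22) (.var 18)).eval S.a (Function.update S.v 22 d) ≠ 0 :=
        fun h => hlt (by simpa using (Ex.holds_lt _ _ _ _).1 h)
      have e : St.compare.run π.L π.B S = (S.setV 22 d).setV 18 0 := by
        rw [St.compare, St.run, if_pos e1, St.run, St.run, St.run, e2, mod (by omega)]
        refine (if_neg e3).trans ?_
        simp [St.run, Sto.setV]
      rw [e]
      refine ⟨by simpa using hc.agree (not_lt.1 hlt), Or.inr ?_⟩
      have hp' := hp.resolve_left fun hs => by have := hs.1; omega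
      rw [if_neg (by omega)] at hp'
      simp
      omega
  have hrem0 : S.v 18 = 0 := by omega
  have e1 : ¬ (Ex.ltE (.cst 0) (.var 18)).eval S.a S.v ≠ 0 :=
    fun h => hrem ((Ex.holds_lt _ _ _ _).1 h)
  by_cases hgo : 0 < S.v 15 ∧ S.v 19 ≤ π.k
  · have e2 : (Ex.andE (.ltE (.cst 0) (.var 15)) (.leE (.var 19) (.var 1))).eval S.a S.v ≠ 0 := by
      refine (Ex.holds_and _ _ _ _).2 ⟨(Ex.holds_lt _ _ _ _).2 hgo.1, (Ex.holds_le _ _ _ _).2 ?_⟩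
      simpa [hT.k] using hgo.2
    set n := r * (π.k + 1) + (S.a 20 r + S.v 19) % (π.k + 1) with hn
    have hnB : n < π.B := by
      have h1 := Nat.mul_le_mul_left (π.k + 1) (Nat.succ_le_of_lt hr)
      have h2 := Nat.mod_lt (S.a 20 r + S.v 19) (show 0 < π.k + 1 by omega)
      have h3 := hπ.L_eq
      rw [Nat.mul_succ, mul_comm _ r] at h1
      omega
    have e3 : (Ex.var 4 * (Ex.var 1 + Ex.cst 1) + (Ex.arr 20 (Ex.var 4) + Ex.var 19) %
        (Ex.var 1 + Ex.cst 1)).eval S.a S.v = n := by simp [h4, hT.k, hn]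
    rcases hb : ps[S.v 19]? with _ | b
    · have e4 : ¬ (Ex.arr 23 (.var 22)).eval S.a (Function.update S.v 22 n) ≠ 0 := by
        simpa using hst.none _ hgo.2 hb
      have e : St.compare.run π.L π.B S = (S.setV 22 n).setV 22 0 := by
        rw [St.compare, St.run, if_neg e1, St.run, if_pos e2, St.run, St.run, St.run, e3, mod hnB]
        refine (if_neg e4).trans ?_
        simp [St.run]
      rw [e]
      exact ⟨by simpa using hc, Or.inl ⟨by simpa using hrem0, Or.inr (Or.inr (by simpa using hb))⟩⟩
    · obtain ⟨h21, h22, h23⟩ := hst.some _ hgo.2 b hb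
      rw [← hn] at h21 h22 h23
      have hbm := hps b (List.mem_of_getElem? hb)
      have hble := hbm.le
      have e4 : (Ex.arr 23 (.var 22)).eval S.a (Function.update S.v 22 n) ≠ 0 := by
        simpa [h23] using hbm.sym_ne
      have hload := (hrem0 ▸ hc).load hps hgo.1 hgo.2 hb
      have hcnt' := hload.cnt_le.trans (misFrom_le R _)
      set l := min b.len (S.v 15 - 1) with hl
      have hl1 : l ≤ b.len := min_le_left _ _
      set u := if π.c (S.v 15 - 1) = b.sym then 0 else 1 with hu
      have e : St.compare.run π.L π.B S = ((((((S.setV 22 n).setV 20 (S.v 20 + u)).setV 18 l).setV 17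
          (b.pos + (b.len - l))).setV 15 (S.v 15 - 1 - l)).setV 16 (S.v 15 - 1 - l)).setV 19
            (S.v 19 + 1) := by
        rw [St.compare, St.run, if_neg e1, St.run, if_pos e2, St.run, St.run, St.run, e3, mod hnB]
        refine (if_pos e4).trans ?_
        simp [St.run, Sto.setV, hpat, h21, h22, h23, ← hu, ← hl, mod (show S.v 20 + u < π.B by omega),
          mod (show l < π.B by omega), mod (show b.pos + (b.len - l) < π.B by omega),
          mod (show S.v 15 - 1 - l < π.B by omega), mod (show S.v 19 + 1 < π.B by omega)]
      rw [e]
      refine ⟨by simpa using hload, Or.inr ?_⟩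
      have hp' := hp.resolve_left fun hs => by
        rcases hs.2 with h | h | h
        · omega
        · omega
        · simp [hb] at h
      rw [if_pos hrem0] at hp'
      simp
      omega
  · have e2 : ¬ (Ex.andE (.ltE (.cst 0) (.var 15)) (.leE (.var 19) (.var 1))).eval S.a S.v ≠ 0 := by
      intro h
      obtain ⟨h1, h2⟩ := (Ex.holds_and _ _ _ _).1 h
      refine hgo ⟨(Ex.holds_lt _ _ _ _).1 h1, ?_⟩
      simpa [hT.k] using (Ex.holds_le _ _ _ _).1 h2
    have e : St.compare.run π.L π.B S = S.setV 22 0 := by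
      rw [St.compare, St.run, if_neg e1, St.run, if_neg e2]
      simp [St.run]
    rw [e]
    exact ⟨by simpa using hc, Or.inl ⟨by simpa using hrem0, by
      rcases Nat.eq_zero_or_pos (S.v 15) with h | h
      · exact Or.inl (by simpa using h)
      · exact Or.inr (Or.inl (by simp; omega))⟩⟩

theorem Progress.of_eq {t : ℕ} {S' : Sto} (h : Progress π R ps t S)
    (he : ∀ y, 15 ≤ y → y ≤ 20 → S'.v y = S.v y) : Progress π R ps t S' := by
  unfold Progress
  rw [he 15 (by omega) (by omega), he 16 (by omega) (by omega), he 17 (by omega) (by omega),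
    he 18 (by omega) (by omega), he 19 (by omega) (by omega), he 20 (by omega) (by omega)]
  exact h

/-- The report for the reverse text `R`. -/
noncomputable def Par.answer (π : Par) (R : List ℕ) : ℕ :=
  if π.m ≤ R.length ∧ misFrom π.c π.m R 0 ≤ π.k then misFrom π.c π.m R 0 else π.k + 1

/-- After `3 * k + 4` steps the comparison cannot go on or has found more than `k` mismatches, as at
most `k + 1` pieces are considered. -/
theorem run_arrival (hπ : π.Ok) (hS : Fits π.L π.B S) (hT : Tables π S.a S.v) (h4 : S.v 4 = r)
    (hr : r < π.s) (ha : S.v 5 < π.q) (hR : Stream π S.a r R) :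
    Stream π (St.arrival.run π.L π.B S).a r ((S.v 5 + 1) :: R) ∧
      Elsewhere π r S.a (St.arrival.run π.L π.B S).a ∧
      (∀ y < 15, (St.arrival.run π.L π.B S).v y = S.v y) ∧
      (St.arrival.run π.L π.B S).v 21 = π.answer ((S.v 5 + 1) :: R) := by
  classical
  obtain ⟨hR₁, hE, hv⟩ := run_update hπ hS hT h4 hr ha hR
  set S₁ := St.update.run π.L π.B S with hS₁
  set R₁ := (S.v 5 + 1) :: R
  have hT₁ : Tables π S₁.a S₁.v := (hE.tables hT).of_eq hv
  have h4₁ : S₁.v 4 = r := by rw [hv 4 (by omega), h4]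
  obtain ⟨ps, hd, hst⟩ := id hR₁
  have hL := hπ.m_le_L
  have hLB := hπ.L_lt
  have hkB := hπ.k_lt
  have hfirst := hd.first.1
  have mod {v : ℕ} (hv : v < π.B) : v % π.B = v := Nat.mod_eq_of_lt hv
  -- the initial state of the comparison
  obtain ⟨hA₂, hv₂⟩ := St.start.run_of_keeps (n := 5) (L := π.L) (B := π.B) (S := S₁) (by decide)
  have hP₂ : Progress π R₁ ps 0 (St.start.run π.L π.B S₁) := by
    have e : St.start.run π.L π.B S₁ = (((((S₁.setV 15 (π.m - S₁.a 19 r)).setV 16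
        (π.m - S₁.a 19 r)).setV 17 (S₁.a 18 r)).setV 18 (S₁.a 19 r)).setV 19 0).setV 20 0 := by
      simp [St.start, St.run, St.openLenE, St.openPosE, Sto.setV, h4₁, hT₁.m,
        mod (show π.m - S₁.a 19 r < π.B by omega), mod (show S₁.a 18 r < π.B by omega),
        mod (show S₁.a 19 r < π.B by omega)]
    rw [e]
    exact ⟨by simpa using hd.comparing π.k, Or.inr (Nat.zero_le _)⟩
  set S₂ := St.start.run π.L π.B S₁ with hS₂
  -- the steps of the comparison
  have key : ∀ t, (iter (St.compare.run π.L π.B) 24 S₂ t).a = S₁.a ∧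
      (∀ y < 15, (iter (St.compare.run π.L π.B) 24 S₂ t).v y = S₁.v y) ∧
      Progress π R₁ ps t (iter (St.compare.run π.L π.B) 24 S₂ t) := by
    intro t
    induction t with
    | zero => exact ⟨hA₂, hv₂, hP₂⟩
    | succ t ih =>
      obtain ⟨h1, h2, h3⟩ := ih
      set S₃ := (iter (St.compare.run π.L π.B) 24 S₂ t).setV 24 t with hS₃
      have hA : S₃.a = S₁.a := h1
      have hv₃ : ∀ y < 15, S₃.v y = S₁.v y := fun y hy =>
        (Function.update_of_ne (by omega) _ _).trans (h2 y hy)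
      have hP : Progress π R₁ ps t S₃ := h3.of_eq fun y _ _ => Function.update_of_ne (by omega) _ _
      obtain ⟨h4, h5⟩ := St.compare.run_of_keeps (n := 5) (L := π.L) (B := π.B) (S := S₃)
        (by decide)
      refine ⟨h4.trans hA, fun y hy => (h5 y hy).trans (hv₃ y hy), ?_⟩
      refine hP.step hπ (r := r) ?_ ?_ hr hd.maximal ?_
      · rw [hA]; exact hT₁.of_eq hv₃
      · rw [hv₃ 4 (by omega), h4₁]
      · rw [hA]; exact hst
  obtain ⟨h1, h2, hP⟩ := key (3 * π.k + 4)
  set S₄ := iter (St.compare.run π.L π.B) 24 S₂ (3 * π.k + 4) with hS₄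
  have e : St.arrival.run π.L π.B S = (S₄.setV 24 0).setV 21 (π.answer R₁) := by
    have e1 : (Ex.cst 3 * Ex.var 1 + Ex.cst 4).eval S₂.a S₂.v % π.B = 3 * π.k + 4 := by
      have : S₂.v 1 = π.k := by rw [hv₂ 1 (by omega), hT₁.k]
      simp [this, mod hkB]
    have e2 : (St.loop 14 (.cst 3 * .var 1 + .cst 4) .compare).run π.L π.B S₂ = S₄.setV 24 0 := by
      rw [St.run, e1]; rfl
    have hk : S₄.v 1 = π.k := by rw [h2 1 (by omega), hT₁.k]
    have hrep := hP.1.report (hP.2.imp_right fun h => by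
      have := hP.1.j_le
      split at h <;> omega)
    rw [St.arrival, St.run, ← hS₁, St.run, ← hS₂, St.run, e2, St.report, St.run]
    refine congrArg ((S₄.setV 24 0).setV 21) ?_
    refine (congrArg (· % π.B) (Eq.trans ?_ hrep)).trans (mod ?_)
    · simp [hk]
    · split <;> omega
  rw [e]
  refine ⟨?_, ?_, fun y hy => ?_, by simp⟩
  · rw [Sto.setV_a, Sto.setV_a, h1]; exact hR₁
  · rw [Sto.setV_a, Sto.setV_a, h1]; exact hE
  · simp [Function.update_of_ne (show y ≠ 21 by omega), Function.update_of_ne (show y ≠ 24 by omega),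
      h2 y hy, hv y hy]

end

end MultiStream

namespace MultiStream

/-! ### The time for an arrival -/

/-- The expression contains no sums. -/
def Ex.flat : Ex → Bool
  | var _ => true
  | cst _ => true
  | op _ a b => a.flat && b.flat
  | arr _ i => i.flat
  | ite c a b => c.flat && a.flat && b.flat
  | letE _ e b => e.flat && b.flat
  | sum _ _ _ => false

/-- A bound for the running time of flat expressions. -/
def Ex.time : Ex → ℕ
  | var _ => 2
  | cst _ => 1
  | op _ a b => a.time + b.time + 1
  | arr _ i => i.time + 6
  | ite c a b => c.time + 1 + (a.time + b.time)
  | letE _ e b => e.time + b.time + 2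
  | sum _ _ _ => 0

theorem Ex.cost_le (A : Fin 32 → ℕ → ℕ) (e : Ex) :
    ∀ ε, e.flat = true → e.cost A ε ≤ e.time := by
  induction e with
  | var x => intro ε _; exact le_rfl
  | cst c => intro ε _; exact le_rfl
  | op o a b iha ihb =>
    intro ε h
    simp only [flat, Bool.and_eq_true] at h
    have := iha ε h.1
    have := ihb ε h.2
    simp only [cost, time]; omega
  | arr a i ih =>
    intro ε h
    have := ih ε h
    simp only [cost, time]; omega
  | ite c a b ihc iha ihb =>
    intro ε h
    simp only [flat, Bool.and_eq_true] at h
    have := ihc ε h.1.1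
    have := iha ε h.1.2
    have := ihb ε h.2
    simp only [cost, time]; split <;> omega
  | letE x e b ihe ihb =>
    intro ε h
    simp only [flat, Bool.and_eq_true] at h
    have := ihe ε h.1
    have := ihb (Function.update ε x (e.eval A ε)) h.2
    simp only [cost, time]; omega
  | sum x n b => intro ε h; simp [flat] at h

/-- The statement contains neither loops nor sums. -/
def St.flat : St → Bool
  | assign _ e => e.flat
  | store _ i e => i.flat && e.flat
  | seq p q => p.flat && q.flat
  | ite e p q => e.flat && p.flat && q.flat
  | loop _ _ _ => false

/-- A bound for the running time of flat statements. -/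
def St.time : St → ℕ
  | assign _ e => e.time + 1
  | store _ i e => i.time + e.time + 7
  | seq p q => p.time + q.time
  | ite e p q => e.time + 1 + (p.time + q.time)
  | loop _ _ _ => 0

theorem St.cost_le (L B : ℕ) (p : St) : ∀ S, p.flat = true → p.cost L B S ≤ p.time := by
  induction p with
  | assign x e =>
    intro S h
    have := e.cost_le S.a S.v h
    simp only [cost, time]; omega
  | store a i e =>
    intro S h
    simp only [flat, Bool.and_eq_true] at h
    have := i.cost_le S.a S.v h.1
    have := e.cost_le S.a S.v h.2
    simp only [cost, time]; omega
  | seq p q ihp ihq =>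
    intro S h
    simp only [flat, Bool.and_eq_true] at h
    have := ihp S h.1
    have := ihq (p.run L B S) h.2
    simp only [cost, time]; omega
  | ite e p q ihp ihq =>
    intro S h
    simp only [flat, Bool.and_eq_true] at h
    have := e.cost_le S.a S.v h.1.1
    have := ihp S h.1.2
    have := ihq S h.2
    simp only [cost, time]; split <;> omega
  | loop => intro S h; simp [flat] at h

/-- A bound, per round, for the time of flat statements around a loop over a flat statement that
has at most `4 * t` rounds. -/
def St.factor (p q : St) (n : Ex) (c w : St) : ℕ :=
  p.time + q.time + n.time + 5 + 4 * (c.time + 6) + w.time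

theorem St.cost_seq_loop (L B : ℕ) (p q : St) (x : Fin 16) (n : Ex) (c w : St) (S : Sto)
    (hp : p.flat = true) (hq : q.flat = true) (hn : n.flat = true) (hc : c.flat = true)
    (hw : w.flat = true) {t : ℕ} (ht : 0 < t)
    (h : n.eval (q.run L B (p.run L B S)).a (q.run L B (p.run L B S)).v % B ≤ 4 * t) :
    (St.seq p (.seq q (.seq (.loop x n c) w))).cost L B S ≤ factor p q n c w * t := by
  have h1 := p.cost_le L B S hp
  simp only [cost]
  set S₁ := p.run L B S
  have h2 := q.cost_le L B S₁ hq
  set S₂ := q.run L B S₁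
  have h3 := n.cost_le S₂.a S₂.v hn
  have h4 : ∑ i ∈ Finset.range (n.eval S₂.a S₂.v % B),
      (c.cost L B ((iter (c.run L B) (10 + x) S₂ i).setV (10 + x) i) + 6) ≤
      4 * t * (c.time + 6) := by
    refine (Finset.sum_le_card_nsmul _ _ (c.time + 6) fun i _ => ?_).trans ?_
    · exact Nat.add_le_add_right (c.cost_le _ _ _ hc) _
    · rw [Finset.card_range, smul_eq_mul]
      exact Nat.mul_le_mul_right _ h
  have h5 := w.cost_le L B ((St.loop x n c).run L B S₂) hw
  have h6 : ∀ y, y ≤ y * t := fun y => Nat.le_mul_of_pos_right _ ht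
  have h7 := h6 (p.time + q.time + n.time + 5 + w.time)
  have h8 : factor p q n c w * t =
      (p.time + q.time + n.time + 5 + w.time) * t + 4 * t * (c.time + 6) := by unfold factor; ring
  omega

/-- The factor of `k + 1` in the time bound for an arrival. -/
def St.arrivalFactor : ℕ := factor update start (.cst 3 * .var 1 + .cst 4) compare report

theorem cost_arrival {π : Par} {S : Sto} (hπ : π.Ok) (hS : Fits π.L π.B S) (hT : Tables π S.a S.v)
    (hr : S.v 4 < π.s) (ha : S.v 5 < π.q) {R : List ℕ} (hR : Stream π S.a (S.v 4) R) :
    St.arrival.cost π.L π.B S ≤ St.arrivalFactor * (π.k + 1) := by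
  obtain ⟨-, -, hv⟩ := run_update hπ hS hT rfl hr ha hR
  rw [St.arrivalFactor, St.arrival]
  apply St.cost_seq_loop (t := π.k + 1) (ht := Nat.succ_pos _)
  · rfl
  · rfl
  · rfl
  · rfl
  · rfl
  have hv₂ := (St.start.run_of_keeps (n := 5) (L := π.L) (B := π.B)
    (S := St.update.run π.L π.B S) (by decide)).2 1 (by omega)
  refine (Nat.mod_le _ _).trans ?_
  rw [Ex.eval_add, Ex.eval_mul, Ex.eval_var, hv₂, hv 1 (by omega), hT.k, Ex.eval_cst, Ex.eval_cst]
  omega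

/-! ### The report -/

theorem answer_eq {π : Par} {q : ℕ} (P : Fin π.m → Fin q) (hP : ∀ i, π.c i.1 = P i + 1)
    (T : List (Fin q)) :
    π.answer (T.map fun x => x.1 + 1).reverse = (kMismatch π.k P T).getD (π.k + 1) := by
  classical
  unfold Par.answer kMismatch
  simp only [List.length_reverse, List.length_map]
  by_cases h : π.m ≤ T.length
  · have hd : misFrom π.c π.m (T.map fun x => x.1 + 1).reverse 0 =
        hammingDist (fun j : Fin π.m => T[T.length - π.m + j.1]'(by omega)) P := by
      unfold misFrom hammingDist
      rw [Finset.card_filter, ← Finset.range_eq_Ico, Finset.sum_range]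
      refine Finset.sum_congr rfl fun i _ => ?_
      have hi := i.2
      have e : (T.map fun x => x.1 + 1).reverse[π.m - 1 - i.1]? =
          some ((T[T.length - π.m + i.1]'(by omega)).1 + 1) := by
        rw [List.getElem?_reverse (by simp; omega), List.length_map, List.getElem?_map,
          show T.length - 1 - (π.m - 1 - i.1) = T.length - π.m + i.1 by omega,
          List.getElem?_eq_getElem (by omega)]
        rfl
      rw [mis, e, hP]
      simp only [Option.some.injEq, Nat.add_right_cancel_iff, Fin.val_inj, ne_eq, ite_not]
    rw [dif_pos h, hd]
    by_cases hk : hammingDist (fun j : Fin π.m => T[T.length - π.m + j.1]'(by omega)) P ≤ π.k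
    · simp [h, hk]
    · simp [hk]
  · simp [h]

end MultiStream

namespace MultiStream

/-! ### The algorithm -/

/-- Sets register `7` to the length of the arrays and register `8` to the modulus. -/
def prologue : Com :=
  .seq (.const 26 1) <| .seq (.op .add 7 1 26) <| .seq (.op .mul 7 7 2) <| .seq (.op .add 7 7 0) <|
  .seq (.const 26 8) <| .seq (.op .mul 7 7 26) <| .seq (.op .add 8 0 1) <| .seq (.op .add 8 8 2) <|
  .seq (.op .add 8 8 3) <| .seq (.const 26 2) <| .seq (.op .add 8 8 26) <| .seq (.op .mul 26 8 8) <|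
  .seq (.op .mul 26 26 26) <| .seq (.op .mul 26 26 26) <| .op .mul 8 8 26

/-- The registers during the prologue, with `u`, `v`, `w` in those that change. -/
def prologueReg (m k s q u v w x : ℕ) : ℕ :=
  if x = 0 then m else if x = 1 then k else if x = 2 then s else if x = 3 then q
  else if x = 7 then v else if x = 8 then w else if x = 26 then u else 0

theorem exec_prologue {W N m k s q : ℕ} {σ : Config} (hL : 8 * (m + (k + 1) * s) < W)
    (hB : (m + k + s + q + 2) ^ 9 < W) (hσ : ∀ x < 27, σ.reg x = prologueReg m k s q 0 0 0 x) :
    ∃ t σ', Exec W N prologue σ t σ' ∧ σ'.mem = σ.mem ∧ ∃ u, ∀ x < 27, σ'.reg x =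
      prologueReg m k s q u (8 * (m + (k + 1) * s)) ((m + k + s + q + 2) ^ 9) x := by
  obtain ⟨β, hβ⟩ : ∃ β, β = m + k + s + q + 2 := ⟨_, rfl⟩
  rw [← hβ] at hB ⊢
  have p {i : ℕ} (hi : i ≤ 9) : β ^ i < W := (Nat.pow_le_pow_right (by omega) hi).trans_lt hB
  have p1 := p (i := 1) (by omega)
  rw [pow_one] at p1
  have hW : 9 < W := by
    have : 2 ^ 9 ≤ β ^ 9 := Nat.pow_le_pow_left (by omega) 9
    omega
  -- one instruction with a target among the registers `26`, `7`, `8`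
  have step {c c' : Com} {σ₀ : Config} {u v w x a u' v' w' : ℕ} {φ : Config → Prop}
      (h : ∀ x < 27, σ₀.reg x = prologueReg m k s q u v w x)
      (hc : (∀ x < 27, σ₀.reg x = prologueReg m k s q u v w x) →
        Exec W N c σ₀ 1 (σ₀.setReg x a))
      (hx : ∀ y < 27, Function.update (prologueReg m k s q u v w) x a y =
        prologueReg m k s q u' v' w' y)
      (h' : ∀ σ₁ : Config, σ₁.mem = σ₀.mem →
        (∀ x < 27, σ₁.reg x = prologueReg m k s q u' v' w' x) →
        ∃ t σ', Exec W N c' σ₁ t σ' ∧ σ'.mem = σ₁.mem ∧ φ σ') :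
      ∃ t σ', Exec W N (.seq c c') σ₀ t σ' ∧ σ'.mem = σ₀.mem ∧ φ σ' := by
    obtain ⟨t, σ', h1, h2, h3⟩ := h' (σ₀.setReg x a) rfl fun y hy => by
      rw [← hx y hy, Config.setReg_reg, Function.update_apply, Function.update_apply, h y hy]
    exact ⟨_, σ', (hc h).seq h1, h2, h3⟩
  have op {o : Op} {x y z a : ℕ} {σ₀ : Config} {u v w : ℕ} (hy : y < 27) (hz : z < 27)
      (ha : o.eval (prologueReg m k s q u v w y) (prologueReg m k s q u v w z) = a) (haW : a < W)
      (h : ∀ x < 27, σ₀.reg x = prologueReg m k s q u v w x) :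
      Exec W N (.op o x y z) σ₀ 1 (σ₀.setReg x a) := by
    have := Exec.op (W := W) (N := N) σ₀ o x y z (by rwa [h y hy, h z hz, ha])
    rwa [h y hy, h z hz, ha] at this
  have t26 {u v w a : ℕ} : ∀ y < 27, Function.update (prologueReg m k s q u v w) 26 a y =
      prologueReg m k s q a v w y := by
    intro y hy
    by_cases h : y = 26
    · subst h; simp [prologueReg]
    · simp [prologueReg, h]
  have t7 {u v w a : ℕ} : ∀ y < 27, Function.update (prologueReg m k s q u v w) 7 a y =
      prologueReg m k s q u a w y := by
    intro y hy
    by_cases h : y = 7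
    · subst h; simp [prologueReg]
    · simp [prologueReg, h]
  have t8 {u v w a : ℕ} : ∀ y < 27, Function.update (prologueReg m k s q u v w) 8 a y =
      prologueReg m k s q u v a y := by
    intro y hy
    by_cases h : y = 8
    · subst h; simp [prologueReg]
    · simp [prologueReg, h]
  refine step hσ (fun _ => .const _ 26 1 (by omega)) t26 fun σ₁ _ h₁ => ?_
  refine step h₁ (op (a := k + 1) (by omega) (by omega) rfl (by omega)) t7 fun σ₂ _ h₂ => ?_
  refine step h₂ (op (a := (k + 1) * s) (by omega) (by omega) rfl (by omega)) t7 fun σ₃ _ h₃ => ?_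
  refine step h₃ (op (a := (k + 1) * s + m) (by omega) (by omega) rfl (by omega)) t7
    fun σ₄ _ h₄ => ?_
  refine step h₄ (fun _ => .const _ 26 8 (by omega)) t26 fun σ₅ _ h₅ => ?_
  refine step h₅ (op (a := 8 * (m + (k + 1) * s)) (by omega) (by omega)
    (show ((k + 1) * s + m) * 8 = _ by ring) hL) t7 fun σ₆ _ h₆ => ?_
  refine step h₆ (op (a := m + k) (by omega) (by omega) rfl (by omega)) t8 fun σ₇ _ h₇ => ?_
  refine step h₇ (op (a := m + k + s) (by omega) (by omega) rfl (by omega)) t8 fun σ₈ _ h₈ => ?_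
  refine step h₈ (op (a := m + k + s + q) (by omega) (by omega) rfl (by omega)) t8
    fun σ₉ _ h₉ => ?_
  refine step h₉ (fun _ => .const _ 26 2 (by omega)) t26 fun σ₁₀ _ h₁₀ => ?_
  refine step h₁₀ (op (a := β) (by omega) (by omega) hβ.symm p1) t8 fun σ₁₁ _ h₁₁ => ?_
  refine step h₁₁ (op (a := β ^ 2) (by omega) (by omega) (show β * β = _ by ring)
    (p (by omega))) t26 fun σ₁₂ _ h₁₂ => ?_
  refine step h₁₂ (op (a := β ^ 4) (by omega) (by omega) (show β ^ 2 * β ^ 2 = _ by ring)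
    (p (by omega))) t26 fun σ₁₃ _ h₁₃ => ?_
  refine step h₁₃ (op (a := β ^ 8) (by omega) (by omega) (show β ^ 4 * β ^ 4 = _ by ring)
    (p (by omega))) t26 fun σ₁₄ _ h₁₄ => ?_
  refine ⟨_, _, op (a := β ^ 9) (by omega) (by omega) (show β * β ^ 8 = _ by ring)
    (p (by omega)) h₁₄, rfl, β ^ 8, fun y hy => ?_⟩
  rw [← t8 y hy, Config.setReg_reg, Function.update_apply, Function.update_apply, h₁₄ y hy]

/-- The algorithm. The report is copied from variable `21`. -/
def algorithm : Algorithm where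
  pre := .seq prologue (St.prepare.comp 26)
  step := .seq (St.arrival.comp 26) (.op .add 6 21 9)

/-- The configurations after the arrivals are chosen by means of an invariant that each step
preserves; as the machine is deterministic, the choice does not matter. -/
theorem Algorithm.solves_of_invariant (A : Algorithm) {W N τ m q k s : ℕ} {P : Fin m → Fin q}
    (I : List (Fin s × Fin q) → Config → Prop)
    (h0 : ∃ t σ, Exec W N A.pre (initConfig k s P) t σ ∧ I [] σ)
    (hs : ∀ l a σ, I l σ → ∃ t σ', t ≤ τ ∧ Exec W N A.step (σ.arrive a) t σ' ∧ I (l ++ [a]) σ' ∧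
      σ'.reg 6 = (kMismatch k P (streamText (l ++ [a]) a.1)).getD (k + 1)) :
    A.SolvesKMismatch W N τ k s P := by
  classical
  obtain ⟨t, σ₀, hpre, hI⟩ := h0
  let next (σ : Config) (a : Fin s × Fin q) : Config :=
    if h : ∃ σ', ∃ t ≤ τ, Exec W N A.step (σ.arrive a) t σ' then h.choose else σ
  have hnext : ∀ {σ σ' : Config} {a : Fin s × Fin q} {t : ℕ}, t ≤ τ →
      Exec W N A.step (σ.arrive a) t σ' → next σ a = σ' := by
    intro σ σ' a t ht h
    have hex : ∃ σ', ∃ t ≤ τ, Exec W N A.step (σ.arrive a) t σ' := ⟨σ', t, ht, h⟩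
    obtain ⟨t', -, h'⟩ := hex.choose_spec
    exact (dif_pos hex).trans (h'.deterministic h).2
  have hinv : ∀ l, I l (l.foldl next σ₀) := by
    intro l
    induction l using List.reverseRecOn with
    | nil => exact hI
    | append_singleton l a ih =>
      obtain ⟨t, σ', ht, h1, h2, -⟩ := hs l a _ ih
      rw [List.foldl_append, List.foldl_cons, List.foldl_nil, hnext ht h1]
      exact h2
  refine ⟨fun l => l.foldl next σ₀, ⟨t, hpre⟩, fun l a => ?_⟩
  obtain ⟨t, σ', ht, h1, -, h3⟩ := hs l a _ (hinv l)
  have e : (l ++ [a]).foldl next σ₀ = σ' := by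
    rw [List.foldl_append, List.foldl_cons, List.foldl_nil, hnext ht h1]
  simp only [e]
  exact ⟨⟨t, ht, h1⟩, h3⟩

/-- Variables `4`, `5` and `6` take the input and the output. -/
theorem Fits.setPort {L B : ℕ} {S : Sto} (h : Fits L B S) {x v : ℕ} (hx : 4 ≤ x) (hx' : x ≤ 6)
    (hv : v ≤ B) : Fits L B (S.setV x v) := by
  refine ⟨?_, ?_, fun y => ?_, fun y hy => ?_, h.cell_lt, h.cell_zero⟩
  · simpa [Function.update_of_ne (show 7 ≠ x by omega)] using h.len
  · simpa [Function.update_of_ne (show 8 ≠ x by omega)] using h.modulus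
  · by_cases hy : y = x
    · subst hy; simpa
    · simpa [hy] using h.var_le y
  · simpa [Function.update_of_ne (show y ≠ x by omega)] using h.var_zero y hy

theorem Tables.setPort {π : Par} {A : Fin 32 → ℕ → ℕ} {ε : ℕ → ℕ} (h : Tables π A ε) {x v : ℕ}
    (hx : 4 ≤ x) (hx' : x ≤ 6) : Tables π A (Function.update ε x v) := by
  refine ⟨h.arr, ?_, ?_, ?_, ?_, ?_, ?_, ?_⟩ <;> rw [Function.update_of_ne (by omega)]
  exacts [h.m, h.k, h.q, h.b, h.nb, h.t, h.U]

/-- The text of a stream over the positive numbers, the newest symbol coming first. -/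
def revStream {s q : ℕ} (l : List (Fin s × Fin q)) (r : Fin s) : List ℕ :=
  ((streamText l r).map fun x => x.1 + 1).reverse

/-- The configuration represents the texts after the arrivals `l`. -/
def Represents (π : Par) (q : ℕ) (l : List (Fin π.s × Fin q)) (σ : Config) : Prop :=
  ∃ S, Fits π.L π.B S ∧ Rep π.L σ S ∧ Tables π S.a S.v ∧
    ∀ r, Stream π S.a r.1 (revStream l r)

/-- An arrival is processed correctly and in time `O(k + 1)`. -/
theorem Represents.step {π : Par} (hπ : π.Ok) {W N D : ℕ} (hR : Room W N π.L (π.B + 1) D)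
    (hBW : π.B < W) (hD : St.arrival.deg ≤ D) {l : List (Fin π.s × Fin π.q)} {σ : Config}
    (h : Represents π π.q l σ) (a : Fin π.s × Fin π.q) :
    ∃ t σ', t ≤ (St.arrivalFactor + 1) * (π.k + 1) ∧
      Exec W N algorithm.step (σ.arrive a) t σ' ∧ Represents π π.q (l ++ [a]) σ' ∧
      σ'.reg 6 = π.answer (revStream (l ++ [a]) a.1) := by
  obtain ⟨S, hS, hσ, hT, hst⟩ := h
  have ha1 := a.1.2
  have ha2 := a.2.2
  have hsB := hπ.s_lt
  have hqB : π.q ≤ π.B := by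
    have : π.q ≤ π.X := by
      unfold Par.X
      exact (Nat.le_succ _).trans (Nat.le_mul_of_pos_left _ (by positivity))
    have := hπ.X_lt
    omega
  have hS₁ : Fits π.L π.B ((S.setV 4 a.1).setV 5 a.2) :=
    (hS.setPort (by omega) (by omega) (by omega)).setPort (by omega) (by omega) (by omega)
  have hσ₁ : Rep π.L (σ.arrive a) ((S.setV 4 a.1).setV 5 a.2) := (hσ.setReg 4 a.1).setReg 5 a.2
  have hT₁ : Tables π ((S.setV 4 a.1).setV 5 a.2).a ((S.setV 4 a.1).setV 5 a.2).v :=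
    (hT.setPort (by omega) (by omega)).setPort (by omega) (by omega)
  set S₁ := (S.setV 4 a.1).setV 5 a.2 with hS₁'
  have h4 : S₁.v 4 = a.1 := by simp [S₁]
  have h5 : S₁.v 5 = a.2 := by simp [S₁]
  have hst₁ : ∀ r, Stream π S₁.a r.1 (revStream l r) := hst
  obtain ⟨h1, h2, h3, h6⟩ := run_arrival hπ hS₁ hT₁ h4 ha1 (h5 ▸ ha2) (hst₁ a.1)
  have hcost := cost_arrival hπ hS₁ hT₁ (h4 ▸ ha1) (h5 ▸ ha2) (h4 ▸ hst₁ a.1)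
  obtain ⟨σ₂, hx, hσ₂, -⟩ := St.exec hR hBW St.arrival hS₁ hσ₁ le_rfl hD
  have hS₂ := hS₁.run St.arrival
  have hT₂ := (h2.tables hT₁).of_eq h3
  set S₂ := St.arrival.run π.L π.B S₁ with hS₂'
  have hrev : (S₁.v 5 + 1) :: revStream l a.1 = revStream (l ++ [a]) a.1 := by
    simp [revStream, streamText, h5]
  rw [hrev] at h1 h6
  have hv : Op.add.eval (σ₂.reg 21) (σ₂.reg 9) = S₂.v 21 := by
    rw [hσ₂.1 21 (by omega), hσ₂.1 9 (by omega), hS₂.var_zero 9 (Or.inl rfl)]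
    rfl
  have hle := hS₂.var_le 21
  have hop := Exec.op (W := W) (N := N) σ₂ .add 6 21 9 (by rw [hv]; omega)
  rw [hv] at hop
  refine ⟨_, _, ?_, Exec.seq hx hop, ⟨S₂.setV 6 (S₂.v 21), hS₂.setPort (by omega) (by omega) hle,
    hσ₂.setReg _ _, hT₂.setPort (by omega) (by omega), fun r => ?_⟩, ?_⟩
  · rw [add_mul, one_mul]
    exact Nat.add_le_add hcost (Nat.le_add_left _ _)
  · rw [Sto.setV_a]
    by_cases hr : r = a.1
    · subst hr; exact h1
    · have hsame : revStream (l ++ [a]) r = revStream l r := by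
        simp [revStream, streamText, Ne.symm hr]
      rw [hsame]
      exact h2.stream (fun he => hr (Fin.ext he)) (hst₁ r)
  · simpa using h6

theorem represents_nil {π : Par} (hπ : π.Ok) {σ : Config}
    (hσ : Rep π.L σ ⟨π.vars 2, π.arrs 17⟩) : Represents π π.q [] σ := by
  refine ⟨_, hπ.fits 2 17, hσ, ⟨fun _ _ => rfl, ?_, ?_, ?_, ?_, ?_, ?_, ?_⟩, fun r => ⟨[], ?_, ?_⟩⟩
  · simp [Par.vars]
  · simp [Par.vars]
  · simp [Par.vars]
  · simp [Par.vars]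
  · simp [Par.vars]
  · simp [Par.vars]
  · simp [Par.vars]
  · simpa [Par.arrs, revStream, streamText] using Divided.nil
  · exact ⟨by simp [Par.arrs], by simp [Par.arrs], by simp⟩

end MultiStream

namespace MultiStream

/-- The parameters of a problem instance; array `0` starts out with the pattern. -/
def instancePar {m q : ℕ} (k s : ℕ) (P : Fin m → Fin q) : Par where
  m := m
  k := k
  s := s
  q := q
  L := 8 * (m + (k + 1) * s)
  B := (m + k + s + q + 2) ^ 9
  p i := if h : i < m then (P ⟨i, h⟩ : ℕ) else 0

section

variable {m k s q : ℕ}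

theorem length_le (hm : 0 < m) :
    32 * (8 * (m + (k + 1) * s)) ≤ (m + k + s + q + 2) ^ 8 := by
  obtain ⟨β, hβ⟩ : ∃ β, β = m + k + s + q + 2 := ⟨_, rfl⟩
  rw [← hβ]
  have h1 : (k + 1) * s ≤ β * β := Nat.mul_le_mul (by omega) (by omega)
  have h2 : β ≤ β * β := Nat.le_mul_self _
  calc 32 * (8 * (m + (k + 1) * s)) ≤ 3 ^ 6 * (β * β) := by omega
    _ ≤ β ^ 6 * (β * β) := Nat.mul_le_mul_right _ (Nat.pow_le_pow_left (by omega) 6)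
    _ = β ^ 8 := by ring

theorem instancePar_ok (P : Fin m → Fin q) (hm : 0 < m) : (instancePar k s P).Ok := by
  have hlen := length_le (k := k) (s := s) (q := q) hm
  obtain ⟨β, hβ⟩ : ∃ β, β = m + k + s + q + 2 := ⟨_, rfl⟩
  have hlt : β ^ 8 < β ^ 9 := Nat.pow_lt_pow_right (by omega) (by omega)
  have hB : (instancePar k s P).B = β ^ 9 := by rw [hβ]; rfl
  have h4 : 4 * β ≤ β ^ 9 := by
    calc 4 * β ≤ 3 ^ 8 * β := by omega
      _ ≤ β ^ 8 * β := Nat.mul_le_mul_right _ (Nat.pow_le_pow_left (by omega) 8)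
      _ = β ^ 9 := by ring
  rw [← hβ] at hlen
  refine ⟨hm, rfl, fun i hi => ?_, fun i hi => dif_neg (not_lt.2 hi), ?_, ?_, ?_, ?_⟩
  · exact (dif_pos (show i < m from hi)).trans_lt (P ⟨i, hi⟩).2
  · rw [hB]
    refine lt_of_le_of_lt ?_ (hlen.trans_lt hlt)
    exact Nat.le_mul_of_pos_left _ (by omega)
  · rw [hB]
    refine lt_of_le_of_lt ?_ hlt
    have hX : (m + 1) * (m + 1) * (q + 1) + β * β ≤ β * β * β := by
      calc (m + 1) * (m + 1) * (q + 1) + β * β ≤ β * β * (q + 1) + β * β := by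
            gcongr <;> omega
        _ = β * β * (q + 2) := by ring
        _ ≤ β * β * β := Nat.mul_le_mul_left _ (by omega)
    have hU : (instancePar k s P).U ≤ 2 * (β * β * β) := by
      change 2 * ((m + 1) * (m + 1) * (q + 1)) + 2 ≤ _
      have : 1 ≤ β * β := Nat.mul_pos (by omega) (by omega)
      omega
    calc _ ≤ 2 * (β * β * β) * (2 * (β * β * β)) := Nat.mul_le_mul hU hU
      _ = 2 ^ 2 * β ^ 6 := by ring
      _ ≤ β ^ 2 * β ^ 6 := Nat.mul_le_mul_right _ (Nat.pow_le_pow_left (by omega) 2)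
      _ = β ^ 8 := by ring
  · rw [hB]
    change 3 * k + 4 < _
    omega
  · rw [hB]
    change s ≤ _
    omega

/-- The exponent for the word size is ten times this number. -/
def wordExp : ℕ := St.prepare.deg + St.arrival.deg + 1

theorem algorithm_solves (P : Fin m → Fin q) (hm : 0 < m) :
    algorithm.SolvesKMismatch ((m + k + s + q + 2) ^ (10 * wordExp))
      (32 * (8 * (m + (k + 1) * s))) ((St.arrivalFactor + 1) * (k + 1)) k s P := by
  have hlen := length_le (k := k) (s := s) (q := q) hm
  have hπ := instancePar_ok (k := k) (s := s) P hm
  have hdeg : St.prepare.deg ≤ wordExp ∧ St.arrival.deg ≤ wordExp ∧ 1 ≤ wordExp := by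
    unfold wordExp; exact ⟨by omega, by omega, by omega⟩
  generalize wordExp = D at *
  set π := instancePar k s P with hπ'
  have hB : π.B = (m + k + s + q + 2) ^ 9 := rfl
  have hL : π.L = 8 * (m + (k + 1) * s) := rfl
  obtain ⟨β, hβ⟩ : ∃ β, β = m + k + s + q + 2 := ⟨_, rfl⟩
  rw [← hβ] at hB hlen ⊢
  have hW {i : ℕ} (hi : i ≤ 10) : β ^ i ≤ β ^ (10 * D) :=
    Nat.pow_le_pow_right (by omega) (by omega)
  have h910 : β ^ 9 < β ^ 10 := Nat.pow_lt_pow_right (by omega) (by omega)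
  have hBW : π.B < β ^ (10 * D) := hB ▸ h910.trans_le (hW le_rfl)
  have hNW : 32 * π.L ≤ β ^ (10 * D) := hlen.trans (hW (by omega))
  have hLpos : 0 < π.L := by rw [hL]; omega
  have hroom : Room (β ^ (10 * D)) (32 * π.L) π.L (π.B + 1) D :=
    ⟨by have := hπ.L_lt; omega, hLpos, le_rfl, hNW, by
      rw [pow_mul]; exact Nat.pow_le_pow_left (by omega) D⟩
  refine algorithm.solves_of_invariant (P := P) (fun l σ => Represents π q l σ) ?_ ?_
  · obtain ⟨t, σ, hx, hmem, u, hreg⟩ := exec_prologue (W := β ^ (10 * D)) (N := 32 * π.L)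
      (m := m) (k := k) (s := s) (q := q) (σ := initConfig k s P) (by omega)
      (by rw [← hβ]; omega) (fun x hx => by simp [initConfig, prologueReg])
    have hrep : Rep π.L σ ⟨π.vars 0, π.arrs 0⟩ := by
      refine ⟨fun x hx => ?_, fun a i hi => ?_⟩
      · rw [hreg x (by omega)]
        simp only [prologueReg, Par.vars]
        simp [show x ≠ 26 by omega]
        rfl
      · rw [hmem]
        have hmL : π.m ≤ π.L := by have := hπ.m_le_L; omega
        by_cases ha : (a : ℕ) = 0
        · rw [ha, zero_mul, zero_add]
          refine (Eq.trans ?_ (if_pos ⟨ha.le, hi⟩).symm)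
          rw [ha]
          rfl
        · have : π.L ≤ a * π.L := Nat.le_mul_of_pos_left _ (by omega)
          exact (hπ.p_zero _ (by omega)).trans (if_neg fun h => ha (Nat.le_zero.1 h.1)).symm
    obtain ⟨σ', hx', hrep', -⟩ := St.exec hroom hBW St.prepare (hπ.fits 0 0) hrep le_rfl hdeg.1
    rw [Par.run_prepare hπ] at hrep'
    exact ⟨_, σ', hx.seq hx', represents_nil hπ hrep'⟩
  · intro l a σ h
    obtain ⟨t, σ', ht, hx, hI, hout⟩ := Represents.step hπ hroom hBW hdeg.2.1 h a
    refine ⟨t, σ', ht, hx, hI, hout.trans ?_⟩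
    exact answer_eq (π := π) P (fun i => (if_pos i.2).trans
      (congrArg (· + 1) (dif_pos i.2))) _

end

end MultiStream

theorem mainTheorem2 :
    ∃ (A : MultiStream.Algorithm) (C e : ℕ),
      ∀ (m k s q : ℕ) (P : Fin m → Fin q), 0 < m →
        ∃ N : ℕ, N + A.numRegs ≤ C * (m + (k + 1) * s) ∧
          A.SolvesKMismatch ((m + k + s + q + 2) ^ e) N (C * (k + 1)) k s P := by
  refine ⟨MultiStream.algorithm,
    32 * 8 + MultiStream.algorithm.numRegs + (MultiStream.St.arrivalFactor + 1),
    10 * MultiStream.wordExp, fun m k s q P hm => ⟨32 * (8 * (m + (k + 1) * s)), ?_, ?_⟩⟩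
  · generalize MultiStream.algorithm.numRegs = x
    have h1 : x ≤ x * (m + (k + 1) * s) := Nat.le_mul_of_pos_right _ (by omega)
    rw [add_mul _ (MultiStream.St.arrivalFactor + 1), add_mul _ x, ← mul_assoc 32]
    omega
  · obtain ⟨run, h1, h2⟩ := MultiStream.algorithm_solves (k := k) (s := s) P hm
    refine ⟨run, h1, fun l a => ?_⟩
    obtain ⟨⟨t, ht, hx⟩, h3⟩ := h2 l a
    exact ⟨⟨t, ht.trans (Nat.mul_le_mul_right _ (Nat.le_add_left _ _)), hx⟩, h3⟩
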